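/- Work in the upper half-space model $\mathbb{H}^3=\{(\zeta,w)\in\mathbb{C}\times\mathbb{R} : w>0\}$ with the metric $\langle\cdot,\cdot\rangle=(|d\zeta|^2+dw^2)/w^2$, oriented by $du\wedge dv\wedge dw$ where $\zeta=u+iv$, and with asymptotic boundary $\bar{\mathbb{C}}=\mathbb{C}\cup\{\infty\}$. A Bryant surface is a conformal immersion $X:\Sigma\to\mathbb{H}^3$ of a connected Riemann surface $\Sigma$ with constant mean curvature $1$ (half the trace of the second fundamental form) with respect to the unit normal $N$ such that $(\partial_xX,\partial_yX,N)$ is direct for every holomorphic coordinate $x+iy$ of $\Sigma$; thus the mean curvature vector is $\vec H=N$. It is $n$-catenoidal if the induced metric is complete and $\Sigma$ has exactly $n$ ends, each of which is an embedded end of finite total curvature: $\Sigma$ is the union of a compact set and of $n$ pairwise disjoint annular ends $E_1,\dots,E_n$, on each of which $X$ is an embedding and $\int_{E_j}|K_\Sigma|\,dA<\infty$, where $K_\Sigma$ is the Gauss curvature. For a vector field $Y$ on $\mathbb{H}^3$, the flux of $Y$ through an annular end $E$ is $$\varphi_E(Y)=\int_\Gamma\langle\eta,Y\rangle-2\int_K\langle\nu,Y\rangle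 ,$$ where $\Gamma$ is a closed curve generating $\pi_1(E)$, $\eta$ is its unit conormal in the direction of the end, $\Gamma$ is oriented so that $(\Gamma,\eta,-\vec H)$ is direct, $K$ is a (parametrized) disc in $\mathbb{H}^3$ with boundary $\Gamma$, and $\nu$ is the unit normal to $K$ that induces the given orientation on $\Gamma$. Let $X:\Sigma\to\mathbb{H}^3$ be an $n$-catenoidal surface with ends $E_1,\dots,E_n$. (1) For every Killing field $Y$ of $\mathbb{H}^3$ and every $j$, the flux $\varphi_{E_j}(Y)$ is well defined (it exists and does not depend on the choice of $\Gamma$ and $K$), and $$\sum_{j=1}^n\varphi_{E_j}(Y)=0.$$ (2) For every $j$ there is a unique polynomial $P_{E_j}\in\mathbb{C}[X,Y]$ such that, for all distinct $\mathcal{C},\mathcal{D}\in\bar{\mathbb{C}}$, the fluxes through $E_j$ of the Killing fields associated to the translation along, and to the rotation about, the oriented geodesic $(\mathcal{C},\mathcal{D})$ are respectively $$\operatorname{Re}\frac{P_{E_j}(\mathcal{C},\mathcal{D})}{\mathcal{C}-\mathcal{D}}\qquad\text{and}\qquad-\operatorname{Im}\frac{P_{E_j}(\mathcal{C},\mathcal{D})}{\mathcal{C}-\mathcal{D}}$$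 (the quotient being understood as a limit, which exists, when $\mathcal{C}$ or $\mathcal{D}$ is $\infty$). The flux polynomials $\Pi_{E_j}(X)=P_{E_j}(X,X)$ satisfy $$\sum_{j=1}^n\Pi_{E_j}=0.$$ -/

import Mathlib

open scoped Manifold ContDiff Topology MatrixGroups

noncomputable section

namespace BryantFlux

/-! ### Hyperbolic 3-space

The upper half-space model: points `(ζ, w) : ℂ × ℝ` with `0 < w`; tangent vectors at a point are
also elements of `ℂ × ℝ`. Only the topology and the linear structure of `ℂ × ℝ` are used, never its
norm. -/

/-- The open upper half-space. -/
def halfSpace : Set (ℂ × ℝ) := {p | 0 < p.2}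

/-- The hyperbolic metric `(|dζ|² + dw²) / w²` at `p`. -/
def hInner (p a b : ℂ × ℝ) : ℝ :=
  ((starRingEnd ℂ a.1 * b.1).re + a.2 * b.2) / p.2 ^ 2

/-- The hyperbolic norm of the tangent vector `a` at `p`. -/
def hNorm (p a : ℂ × ℝ) : ℝ := Real.sqrt (hInner p a a)

/-- The hyperbolic volume form `du ∧ dv ∧ dw / w³` at `p = (u + iv, w)`. -/
def hVol (p a b c : ℂ × ℝ) : ℝ :=
  (a.1.re * (b.1.im * c.2 - b.2 * c.1.im)
    + a.1.im * (b.2 * c.1.re - b.1.re * c.2)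
    + a.2 * (b.1.re * c.1.im - b.1.im * c.1.re)) / p.2 ^ 3

/-- The hyperbolic cross product at `p`: the vector `a × b` with
`hInner p (a × b) c = hVol p a b c` for all `c`. -/
def hCross (p a b : ℂ × ℝ) : ℂ × ℝ :=
  (p.2⁻¹ : ℝ) •
    ((⟨a.1.im * b.2 - a.2 * b.1.im, a.2 * b.1.re - a.1.re * b.2⟩ : ℂ),
      a.1.re * b.1.im - a.1.im * b.1.re)

/-- The vector `v / ‖v‖` for the hyperbolic norm at `p`. -/
def hUnit (p v : ℂ × ℝ) : ℂ × ℝ := (hNorm p v)⁻¹ • v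

/-- The Christoffel symbols of the hyperbolic metric, as a symmetric bilinear map:
the Levi-Civita connection is `∇_a V = D V a + christoffel p a V`. -/
def christoffel (p a b : ℂ × ℝ) : ℂ × ℝ :=
  (p.2⁻¹ : ℝ) • (((0 : ℂ), (starRingEnd ℂ a.1 * b.1).re + a.2 * b.2) - a.2 • b - b.2 • a)

/-- A Killing field of hyperbolic space: a smooth vector field `Y` on the half-space for which the
Lie derivative of the metric vanishes. -/
structure IsKillingField (Y : ℂ × ℝ → ℂ × ℝ) : Prop where
  smooth : ContDiffOn ℝ ∞ Y halfSpace
  killing : ∀ p ∈ halfSpace, ∀ a b : ℂ × ℝ,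
    fderiv ℝ (fun q => hInner q a b) p (Y p)
      + hInner p (fderiv ℝ Y p a) b + hInner p a (fderiv ℝ Y p b) = 0

/-! ### Direct isometries, translations and rotations -/

/-- The direct isometry of the half-space that extends the Möbius transformation
`ζ ↦ (a ζ + b) / (c ζ + d)` of the asymptotic boundary. -/
def hAct (g : SL(2, ℂ)) (p : ℂ × ℝ) : ℂ × ℝ :=
  let r : ℝ := ‖g 1 0 * p.1 + g 1 1‖ ^ 2 + ‖g 1 0‖ ^ 2 * p.2 ^ 2
  (((g 0 0 * p.1 + g 0 1) * starRingEnd ℂ (g 1 0 * p.1 + g 1 1)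
      + g 0 0 * starRingEnd ℂ (g 1 0) * ((p.2 ^ 2 : ℝ) : ℂ)) / (r : ℂ),
    p.2 / r)

/-- The translation of distance `t` along the geodesic `(0, ∞)`. -/
def axialTranslation (t : ℝ) (p : ℂ × ℝ) : ℂ × ℝ := Real.exp t • p

/-- The rotation of angle `t`, in the direct sense, about the geodesic `(0, ∞)`. -/
def axialRotation (t : ℝ) (p : ℂ × ℝ) : ℂ × ℝ := (Complex.exp (t * Complex.I) * p.1, p.2)

/-- `g` carries the oriented geodesic `(C, D)` to the oriented geodesic `(0, ∞)`. -/
def SendsToAxis (g : SL(2, ℂ)) (C D : OnePoint ℂ) : Prop :=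
  (g : GL (Fin 2) ℂ) • C = ((0 : ℂ) : OnePoint ℂ) ∧ (g : GL (Fin 2) ℂ) • D = OnePoint.infty

/-- `Y` is, on the half-space, the velocity field of the family of maps `Φ`:
`dΦ_t / dt = Y(Φ_t)`. -/
def IsVelocityField (Φ : ℝ → ℂ × ℝ → ℂ × ℝ) (Y : ℂ × ℝ → ℂ × ℝ) : Prop :=
  ∀ p ∈ halfSpace, ∀ t : ℝ, HasDerivAt (fun s => Φ s p) (Y (Φ t p)) t

/-- `Y` is the Killing field associated to the translation along the geodesic `(C, D)`. -/
def IsTranslationField (C D : OnePoint ℂ) (Y : ℂ × ℝ → ℂ × ℝ) : Prop :=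
  ∃ g : SL(2, ℂ), SendsToAxis g C D ∧
    IsVelocityField (fun t p => hAct g⁻¹ (axialTranslation t (hAct g p))) Y

/-- `Y` is the Killing field associated to the rotation about the geodesic `(C, D)`. -/
def IsRotationField (C D : OnePoint ℂ) (Y : ℂ × ℝ → ℂ × ℝ) : Prop :=
  ∃ g : SL(2, ℂ), SendsToAxis g C D ∧
    IsVelocityField (fun t p => hAct g⁻¹ (axialRotation t (hAct g p))) Y

/-! ### Local geometry of a parametrized surface `f : U ⊆ ℂ → ℍ³`, with `z = x + iy` -/

/-- `∂f/∂x`. -/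
def dx (f : ℂ → ℂ × ℝ) (z : ℂ) : ℂ × ℝ := fderiv ℝ f z 1

/-- `∂f/∂y`. -/
def dy (f : ℂ → ℂ × ℝ) (z : ℂ) : ℂ × ℝ := fderiv ℝ f z Complex.I

/-- The unit normal `N` for which `(∂f/∂x, ∂f/∂y, N)` is direct. -/
def unitNormal (f : ℂ → ℂ × ℝ) (z : ℂ) : ℂ × ℝ :=
  hUnit (f z) (hCross (f z) (dx f z) (dy f z))

/-- The mean curvature of `f` at `z` with respect to `unitNormal f`: one half of the trace of the
second fundamental form `h(a, b) = ⟨∇_a (∂_b f), N⟩` with respect to the first fundamental form. -/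
def meanCurvature (f : ℂ → ℂ × ℝ) (z : ℂ) : ℝ :=
  let p := f z
  let E := hInner p (dx f z) (dx f z)
  let F := hInner p (dx f z) (dy f z)
  let G := hInner p (dy f z) (dy f z)
  let hxx := hInner p (dx (dx f) z + christoffel p (dx f z) (dx f z)) (unitNormal f z)
  let hxy := hInner p (dx (dy f) z + christoffel p (dx f z) (dy f z)) (unitNormal f z)
  let hyy := hInner p (dy (dy f) z + christoffel p (dy f z) (dy f z)) (unitNormal f z)
  (E * hyy - 2 * F * hxy + G * hxx) / (2 * (E * G - F ^ 2))

/-- `f` is, at `z`, a conformal immersion. -/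
def IsConformalImmersionAt (f : ℂ → ℂ × ℝ) (z : ℂ) : Prop :=
  0 < hInner (f z) (dx f z) (dx f z) ∧
    hInner (f z) (dx f z) (dx f z) = hInner (f z) (dy f z) (dy f z) ∧
    hInner (f z) (dx f z) (dy f z) = 0

/-- The conformal factor `λ` of a conformal immersion: the induced metric is `λ |dz|²`. -/
def conformalFactor (f : ℂ → ℂ × ℝ) (z : ℂ) : ℝ := hInner (f z) (dx f z) (dx f z)

/-- The Gauss curvature `-Δ(log λ) / (2λ)` of the metric `λ |dz|²` induced by a conformal
immersion. -/
def gaussCurvature (f : ℂ → ℂ × ℝ) (z : ℂ) : ℝ :=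
  -(Laplacian.laplacian (fun u => Real.log (conformalFactor f u)) z) / (2 * conformalFactor f z)

/-! ### Bryant surfaces -/

section Surface

variable {M : Type*} [TopologicalSpace M] [ChartedSpace ℂ M]

/-- A Bryant surface: a smooth conformal immersion `X` of the Riemann surface `M` into hyperbolic
space, of constant mean curvature one with respect to the unit normal defined by the orientation of
`M`. The condition is stated in every holomorphic local coordinate. -/
structure IsBryantImmersion (X : M → ℂ × ℝ) : Prop where
  mem_halfSpace : ∀ x, X x ∈ halfSpace
  smooth : ContMDiff 𝓘(ℝ, ℂ) 𝓘(ℝ, ℂ × ℝ) ∞ X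
  conformal : ∀ e ∈ IsManifold.maximalAtlas 𝓘(ℂ) ω M, ∀ z ∈ e.target,
    IsConformalImmersionAt (fun u => X (e.symm u)) z
  meanCurvature_eq_one : ∀ e ∈ IsManifold.maximalAtlas 𝓘(ℂ) ω M, ∀ z ∈ e.target,
    meanCurvature (fun u => X (e.symm u)) z = 1

/-- The distance on `M` of the metric induced by `X`: the infimum of the lengths of the `C¹` curves
joining `x` to `y`. -/
def inducedEDist (X : M → ℂ × ℝ) (x y : M) : ENNReal :=
  ⨅ (c : ℝ → M) (_ : ContMDiff 𝓘(ℝ, ℝ) 𝓘(ℝ, ℂ) 1 c) (_ : c 0 = x) (_ : c 1 = y),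
    ∫⁻ t in Set.Icc (0 : ℝ) 1, ENNReal.ofReal (hNorm (X (c t)) (deriv (fun s => X (c s)) t))

/-- Completeness of the induced metric: Cauchy sequences converge. -/
def IsCompleteSurface (X : M → ℂ × ℝ) : Prop :=
  ∀ u : ℕ → M,
    (∀ ε : ENNReal, 0 < ε → ∃ N, ∀ m ≥ N, ∀ k ≥ N, inducedEDist X (u m) (u k) < ε) →
      ∃ x, Filter.Tendsto u Filter.atTop (𝓝 x)

/-- The annulus `r < |z| < s`. -/
def annulus (r s : ℝ) : Set ℂ := {z | r < ‖z‖ ∧ ‖z‖ < s}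

variable (M) in
/-- An annular end of the Riemann surface `M`, parametrized conformally and injectively by
`{r < |z| < 1}` for some `0 ≤ r < 1` (a punctured disc if `r = 0`), in such a way that `|z| → r`
corresponds to leaving every compact subset of `M`. -/
structure AnnularEnd where
  radius : ℝ
  radius_nonneg : 0 ≤ radius
  radius_lt_one : radius < 1
  param : ℂ → M
  holomorphic : ContMDiffOn 𝓘(ℂ) 𝓘(ℂ) ω param (annulus radius 1)
  injective : Set.InjOn param (annulus radius 1)
  escapes : Filter.Tendsto param (Filter.comap norm (𝓝[>] radius)) (Filter.cocompact M)

/-- The end, as a parametrized surface in hyperbolic space. -/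
def AnnularEnd.map (E : AnnularEnd M) (X : M → ℂ × ℝ) : ℂ → ℂ × ℝ := fun z => X (E.param z)

/-- The end `E` of the surface `X` is embedded. -/
def AnnularEnd.IsEmbedded (E : AnnularEnd M) (X : M → ℂ × ℝ) : Prop :=
  Topology.IsEmbedding (fun z : annulus E.radius 1 => E.map X z)

/-- The end `E` of the surface `X` has finite total curvature: `∫_E |K| dA < ∞`. -/
def AnnularEnd.HasFiniteTotalCurvature (E : AnnularEnd M) (X : M → ℂ × ℝ) : Prop :=
  MeasureTheory.IntegrableOn
    (fun z => gaussCurvature (E.map X) z * conformalFactor (E.map X) z) (annulus E.radius 1)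

/-- `X` is an `n`-catenoidal surface, whose ends are `E 0, …, E (n - 1)`: a complete Bryant surface
which is the union of a compact part and of `n` disjoint annular ends, each of them embedded and of
finite total curvature. -/
structure IsCatenoidalSurface {n : ℕ} (X : M → ℂ × ℝ) (E : Fin n → AnnularEnd M) : Prop where
  bryant : IsBryantImmersion X
  complete : IsCompleteSurface X
  disjoint : Pairwise fun i j =>
    Disjoint ((E i).param '' annulus (E i).radius 1) ((E j).param '' annulus (E j).radius 1)
  compact_core : ∃ s : ℝ, s < 1 ∧ (∀ j, (E j).radius < s) ∧
    IsCompact (⋃ j, (E j).param '' annulus (E j).radius s)ᶜ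
  embedded : ∀ j, (E j).IsEmbedded X
  finiteTotalCurvature : ∀ j, (E j).HasFiniteTotalCurvature X

end Surface

/-! ### Flux through an end -/

/-- `Γ` is a regular smooth closed curve (of period `2π`) that generates the fundamental group of
the annulus `{r < |z| < 1}` and has winding number `-1` about `0`: a logarithm of `Γ` decreases by
`2πi` over one period. -/
structure IsEndLoop (r : ℝ) (Γ : ℝ → ℂ) : Prop where
  smooth : ContDiff ℝ ∞ Γ
  mem : ∀ t, Γ t ∈ annulus r 1
  regular : ∀ t, deriv Γ t ≠ 0
  winding : ∃ L : ℝ → ℂ, Continuous L ∧ (∀ t, Γ t = Complex.exp (L t)) ∧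
    ∀ t, L (t + 2 * Real.pi) = L t - 2 * Real.pi * Complex.I

/-- `K` is a smooth disc in hyperbolic space, parametrized by the closed unit disc, whose boundary
is the image by `f` of the loop `Γ`, with its orientation. -/
structure IsSpanningDisc (f : ℂ → ℂ × ℝ) (Γ : ℝ → ℂ) (K : ℂ → ℂ × ℝ) : Prop where
  smooth : ContDiff ℝ ∞ K
  mem_halfSpace : ∀ z, ‖z‖ ≤ 1 → K z ∈ halfSpace
  boundary : ∀ t : ℝ, K (Complex.exp (t * Complex.I)) = f (Γ t)

/-- The unit conormal `η = T × N` along the loop `Γ`, where `T` is the unit tangent: `η` is tangent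
to the surface and `(T, η, -N)` is a direct orthonormal frame. Since `Γ` runs clockwise, `η` points
towards the asymptotic end `|z| → r`. -/
def conormal (f : ℂ → ℂ × ℝ) (Γ : ℝ → ℂ) (t : ℝ) : ℂ × ℝ :=
  hCross (f (Γ t)) (hUnit (f (Γ t)) (deriv (fun s => f (Γ s)) t)) (unitNormal f (Γ t))

/-- `∫_Γ ⟨η, Y⟩ - 2 ∫_K ⟨ν, Y⟩`. The normal `ν` of `K` is the one compatible with the orientation of
`Γ = ∂K`, so that `⟨ν, Y⟩` times the area form of `K` is `hVol (∂K/∂x) (∂K/∂y) Y dx dy`. -/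
def fluxValue (f : ℂ → ℂ × ℝ) (Γ : ℝ → ℂ) (K : ℂ → ℂ × ℝ) (Y : ℂ × ℝ → ℂ × ℝ) : ℝ :=
  (∫ t in (0 : ℝ)..(2 * Real.pi), hInner (f (Γ t)) (conormal f Γ t) (Y (f (Γ t)))
      * hNorm (f (Γ t)) (deriv (fun s => f (Γ s)) t))
    - 2 * ∫ z in Metric.ball (0 : ℂ) 1, hVol (K z) (dx K z) (dy K z) (Y (K z))

section EndFlux

variable {M : Type*} [TopologicalSpace M] [ChartedSpace ℂ M]

/-- `φ` is the flux of `Y` through the end `E`, computed from some generator of the fundamental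
group of `E` and some disc bounded by it. -/
def HasFlux (X : M → ℂ × ℝ) (E : AnnularEnd M) (Y : ℂ × ℝ → ℂ × ℝ) (φ : ℝ) : Prop :=
  ∃ (Γ : ℝ → ℂ) (K : ℂ → ℂ × ℝ), IsEndLoop E.radius Γ ∧ IsSpanningDisc (E.map X) Γ K ∧
    φ = fluxValue (E.map X) Γ K Y

/-- `v` is the value at `(C, D)` of the rational function `P(C, D) / (C - D)`, as a limit when `C`
or `D` is `∞`. -/
def IsQuotientValue (P : MvPolynomial (Fin 2) ℂ) (C D : OnePoint ℂ) (v : ℂ) : Prop :=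
  Filter.Tendsto (fun q : ℂ × ℂ => MvPolynomial.eval ![q.1, q.2] P / (q.1 - q.2))
    (Filter.comap (fun q : ℂ × ℂ => ((q.1 : OnePoint ℂ), (q.2 : OnePoint ℂ))) (𝓝 (C, D))) (𝓝 v)

/-- `P` is the polynomial in two variables that encodes the fluxes through `E` of the Killing fields
associated to translations and rotations: for all distinct `C`, `D` in the Riemann sphere these are
`Re (P(C, D) / (C - D))` and `-Im (P(C, D) / (C - D))`. -/
def EncodesFlux (X : M → ℂ × ℝ) (E : AnnularEnd M) (P : MvPolynomial (Fin 2) ℂ) : Prop :=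
  ∀ C D : OnePoint ℂ, C ≠ D → ∃ v : ℂ, IsQuotientValue P C D v ∧
    (∀ Y, IsTranslationField C D Y → HasFlux X E Y v.re) ∧
    (∀ Y, IsRotationField C D Y → HasFlux X E Y (-v.im))

end EndFlux

/-- The polynomial `Π(X) = P(X, X)`; it is the flux polynomial of `E` when `P` encodes the fluxes
through `E`. -/
def diagonal (P : MvPolynomial (Fin 2) ℂ) : Polynomial ℂ :=
  MvPolynomial.aeval (fun _ => (Polynomial.X : Polynomial ℂ)) P

end BryantFlux

end

noncomputable section

namespace BryantFlux

/-! ### Vector calculus on the half-space -/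

/-! The flux is the period of a closed 1-form on the surface, and the balancing formula is Stokes'
theorem for that form.

For a Killing field Y of a space with Ric = -2g, the Bochner identity gives d⋆dY♭ = -4⋆Y♭. Hence
-¼⋆dY♭, which is `potential`, is a primitive of ι_Y vol (`potential_closed`), and Stokes on a
spanning disc replaces the integral over K by a boundary integral. The flux thus becomes the
integral along Γ of the single form θ = ⟨η, Y⟩ds - 2·potential, called `fluxForm` (`fluxValue_eq`);
the disc has disappeared. On a conformal immersion of mean curvature one, θ is closed
(`fluxForm_closed`): the Laplacian of the immersion is governed by H = 1, the Killing equation kills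
the symmetric part of ∇Y, and what remains is exactly 2 ι_Y vol. A closed form has the same period
on all generators of an annulus (`exists_period`), so the flux is well defined once one spanning
disc is produced (`exists_isSpanningDisc`).

For the sum over the ends, surfaces with boundary are avoided. The constant 1 plus a radial cutoff
equal to -1 near each end is a compactly supported function g. Since θ is closed, dg ∧ θ = d(gθ) has
integral zero, by a partition of unity and integration by parts in charts; the piece at each end is
computed in polar coordinates and equals minus the period there (`sum_periods_eq_zero`).

For the polynomials, the holomorphic fields Aζ² + Bζ + C on the sphere extend to Killing fields
(`quadraticField`). The flux is real linear in (A, B, C), hence of the form Re(Aα + Bβ + Cγ). The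
translation along (C, D) extends (ζ - C)(ζ - D)/(C - D) and the rotation is i times it, so the
fluxes are Re v and Re(iv) = -Im v, where v = (α - β(C + D) + γCD)/(C - D). The numerator is the
polynomial P, determined by its values off the diagonal (`EncodesFlux.unique`). The balancing
formula, applied to all quadratic fields, makes the sums of α, β and γ vanish. -/

lemma isOpen_halfSpace : IsOpen halfSpace := isOpen_lt continuous_const continuous_snd

/-- The Euclidean inner product of `ℂ × ℝ`. -/
def euc (a b : ℂ × ℝ) : ℝ := a.1.re * b.1.re + a.1.im * b.1.im + a.2 * b.2

lemma hInner_eq (p a b : ℂ × ℝ) : hInner p a b = euc a b / p.2 ^ 2 := by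
  simp [hInner, euc]

/-- The coordinate `u` of `ℂ × ℝ`. -/
def cU : ℂ × ℝ →L[ℝ] ℝ := Complex.reCLM.comp (ContinuousLinearMap.fst ℝ ℂ ℝ)
/-- The coordinate `v` of `ℂ × ℝ`. -/
def cV : ℂ × ℝ →L[ℝ] ℝ := Complex.imCLM.comp (ContinuousLinearMap.fst ℝ ℂ ℝ)
/-- The coordinate `w` of `ℂ × ℝ`. -/
def cW : ℂ × ℝ →L[ℝ] ℝ := ContinuousLinearMap.snd ℝ ℂ ℝ

@[simp] lemma cU_apply (a : ℂ × ℝ) : cU a = a.1.re := rfl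
@[simp] lemma cV_apply (a : ℂ × ℝ) : cV a = a.1.im := rfl
@[simp] lemma cW_apply (a : ℂ × ℝ) : cW a = a.2 := rfl

/-- The first vector of the standard basis. -/
def bU : ℂ × ℝ := (1, 0)
/-- The second vector of the standard basis. -/
def bV : ℂ × ℝ := (Complex.I, 0)
/-- The third vector of the standard basis. -/
def bW : ℂ × ℝ := (0, 1)

@[simp] lemma bU_re : bU.1.re = 1 := rfl
@[simp] lemma bU_im : bU.1.im = 0 := rfl
@[simp] lemma bU_snd : bU.2 = 0 := rfl
@[simp] lemma bV_re : bV.1.re = 0 := rfl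
@[simp] lemma bV_im : bV.1.im = 1 := rfl
@[simp] lemma bV_snd : bV.2 = 0 := rfl
@[simp] lemma bW_re : bW.1.re = 0 := rfl
@[simp] lemma bW_im : bW.1.im = 0 := rfl
@[simp] lemma bW_snd : bW.2 = 1 := rfl

lemma eq_basis (a : ℂ × ℝ) : a = a.1.re • bU + a.1.im • bV + a.2 • bW := by
  ext <;> simp [bU, bV, bW]

/-- The Euclidean inner product as a continuous bilinear map. -/
def eucL : ℂ × ℝ →L[ℝ] ℂ × ℝ →L[ℝ] ℝ :=
  cU.smulRight cU + cV.smulRight cV + cW.smulRight cW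

@[simp] lemma eucL_apply (a b : ℂ × ℝ) : eucL a b = euc a b := by
  simp [eucL, euc]

lemma hasFDerivAt_hInner {p : ℂ × ℝ} (hp : p ∈ halfSpace) (a b : ℂ × ℝ) :
    HasFDerivAt (fun q : ℂ × ℝ => hInner q a b) ((-(2 * euc a b / p.2 ^ 3)) • cW) p := by
  have hw : p.2 ≠ 0 := ne_of_gt hp
  have h1 : HasFDerivAt (fun q : ℂ × ℝ => q.2) cW p := cW.hasFDerivAt
  have h2 := ((hasDerivAt_inv (pow_ne_zero 2 hw)).comp_hasFDerivAt p (h1.pow 2)).const_mul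
    (euc a b)
  simp only [hInner_eq, div_eq_mul_inv]
  refine h2.congr_fderiv ?_
  ext v
  · simp
  · simp
    field_simp

lemma hasFDerivAt_fderiv_apply {E F : Type*} [NormedAddCommGroup E] [NormedSpace ℝ E]
    [NormedAddCommGroup F] [NormedSpace ℝ F] {f : E → F} {x : E}
    (hf : ContDiffAt ℝ 2 f x) (a : E) :
    HasFDerivAt (fun y => fderiv ℝ f y a) ((fderiv ℝ (fderiv ℝ f) x).flip a) x := by
  have h1 : DifferentiableAt ℝ (fderiv ℝ f) x :=
    (hf.fderiv_right (m := 1) (by norm_num)).differentiableAt (by norm_num)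
  have := h1.hasFDerivAt.clm_apply (hasFDerivAt_const a x)
  simpa using this

lemma fderiv_fderiv_symm {E F : Type*} [NormedAddCommGroup E] [NormedSpace ℝ E]
    [NormedAddCommGroup F] [NormedSpace ℝ F] {f : E → F} {x : E}
    (hf : ContDiffAt ℝ 2 f x) (a b : E) :
    fderiv ℝ (fderiv ℝ f) x a b = fderiv ℝ (fderiv ℝ f) x b a :=
  (hf.isSymmSndFDerivAt (by simp)) a b

namespace IsKillingField

variable {Y : ℂ × ℝ → ℂ × ℝ}

lemma contDiffAt (hY : IsKillingField Y) {p : ℂ × ℝ} (hp : p ∈ halfSpace) : ContDiffAt ℝ ∞ Y p :=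
  (hY.smooth p hp).contDiffAt (isOpen_halfSpace.mem_nhds hp)

lemma contDiffAt_two (hY : IsKillingField Y) {p : ℂ × ℝ} (hp : p ∈ halfSpace) :
    ContDiffAt ℝ 2 Y p :=
  (hY.contDiffAt hp).of_le (WithTop.coe_le_coe.2 le_top)

lemma differentiableAt (hY : IsKillingField Y) {p : ℂ × ℝ} (hp : p ∈ halfSpace) :
    DifferentiableAt ℝ Y p := (hY.contDiffAt_two hp).differentiableAt (by norm_num)

/-- The Killing equation, in Euclidean terms. -/
lemma euc_fderiv (hY : IsKillingField Y) {p : ℂ × ℝ} (hp : p ∈ halfSpace) (a b : ℂ × ℝ) :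
    euc (fderiv ℝ Y p a) b + euc a (fderiv ℝ Y p b) = 2 * (Y p).2 / p.2 * euc a b := by
  have hw : p.2 ≠ 0 := ne_of_gt hp
  have h := hY.killing p hp a b
  rw [(hasFDerivAt_hInner hp a b).fderiv] at h
  simp only [hInner_eq, smul_apply, cW_apply, smul_eq_mul] at h
  field_simp at h ⊢
  linarith

lemma hasFDerivAt_eucL_left {E : Type*} [NormedAddCommGroup E] [NormedSpace ℝ E]
    {g : E → ℂ × ℝ} {g' : E →L[ℝ] ℂ × ℝ} {x : E} (hg : HasFDerivAt g g' x) (b : ℂ × ℝ) :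
    HasFDerivAt (fun y => euc (g y) b) ((eucL.flip b).comp g') x := by
  have := (eucL.flip b).hasFDerivAt.comp x hg
  simpa [Function.comp_def] using this

/-- The derivative of the Killing equation. -/
lemma euc_fderiv_fderiv (hY : IsKillingField Y) {p : ℂ × ℝ} (hp : p ∈ halfSpace)
    (a b c : ℂ × ℝ) :
    euc (fderiv ℝ (fderiv ℝ Y) p c a) b + euc (fderiv ℝ (fderiv ℝ Y) p c b) a
      = 2 * euc a b * ((fderiv ℝ Y p c).2 / p.2 - (Y p).2 * c.2 / p.2 ^ 2) := by
  have hw : p.2 ≠ 0 := ne_of_gt hp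
  have hcomm : ∀ x y, euc x y = euc y x := fun x y => by simp [euc]; ring
  have h1 : HasFDerivAt (fun q => euc (fderiv ℝ Y q a) b + euc (fderiv ℝ Y q b) a) _ p :=
    (hasFDerivAt_eucL_left (hasFDerivAt_fderiv_apply (hY.contDiffAt_two hp) a) b).add
      (hasFDerivAt_eucL_left (hasFDerivAt_fderiv_apply (hY.contDiffAt_two hp) b) a)
  have h2 : HasFDerivAt (fun q : ℂ × ℝ => 2 * euc a b * ((Y q).2 * q.2⁻¹)) _ p :=
    ((cW.hasFDerivAt.comp p (hY.differentiableAt hp).hasFDerivAt).mul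
      ((hasDerivAt_inv (x := p.2) hw).comp_hasFDerivAt p cW.hasFDerivAt)).const_mul (2 * euc a b)
  have heq : (fun q => euc (fderiv ℝ Y q a) b + euc (fderiv ℝ Y q b) a) =ᶠ[𝓝 p]
      (fun q : ℂ × ℝ => 2 * euc a b * ((Y q).2 * q.2⁻¹)) := by
    filter_upwards [isOpen_halfSpace.mem_nhds hp] with q hq
    rw [hcomm (fderiv ℝ Y q b) a, hY.euc_fderiv hq]; ring
  have := congrArg (fun l => l c) (h1.unique (h2.congr_of_eventuallyEq heq))
  simp at this
  rw [this]
  field_simp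
  ring

end IsKillingField

/-- A potential of the flux of `Y`: if `Y` is a Killing field, its exterior derivative is the
interior product of `Y` with the volume form. -/
def potential (Y : ℂ × ℝ → ℂ × ℝ) (p : ℂ × ℝ) : ℂ × ℝ →L[ℝ] ℝ :=
  (-(2 * p.2)⁻¹ * ((fderiv ℝ Y p bV).2 + (Y p).1.im / p.2)) • cU
    + ((2 * p.2)⁻¹ * ((fderiv ℝ Y p bU).2 + (Y p).1.re / p.2)) • cV
    + (-(2 * p.2)⁻¹ * (fderiv ℝ Y p bU).1.im) • cW

lemma contDiffOn_potential {Y : ℂ × ℝ → ℂ × ℝ} (hY : IsKillingField Y) :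
    ContDiffOn ℝ ∞ (potential Y) halfSpace := by
  have h1 : ContDiffOn ℝ ∞ (fderiv ℝ Y) halfSpace :=
    hY.smooth.fderiv_of_isOpen isOpen_halfSpace (by simp)
  have hw : ContDiffOn ℝ ∞ (fun p : ℂ × ℝ => p.2) halfSpace := contDiff_snd.contDiffOn
  have hw' : ContDiffOn ℝ ∞ (fun p : ℂ × ℝ => (2 * p.2)⁻¹) halfSpace :=
    (contDiffOn_const.mul hw).inv fun p hp => mul_ne_zero two_ne_zero (ne_of_gt hp)
  have hc : ∀ (l : ℂ × ℝ →L[ℝ] ℝ) (a : ℂ × ℝ),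
      ContDiffOn ℝ ∞ (fun p => l (fderiv ℝ Y p a)) halfSpace := fun l a =>
    l.contDiff.comp_contDiffOn (h1.clm_apply contDiffOn_const)
  have hc' : ∀ (l : ℂ × ℝ →L[ℝ] ℝ),
      ContDiffOn ℝ ∞ (fun p => l (Y p) / p.2) halfSpace := fun l =>
    (l.contDiff.comp_contDiffOn hY.smooth).div hw fun p hp => ne_of_gt hp
  exact (((hw'.neg.mul ((hc cW bV).add (hc' cV))).smul contDiffOn_const).add
    ((hw'.mul ((hc cW bU).add (hc' cU))).smul contDiffOn_const)).add
    ((hw'.neg.mul (hc cV bU)).smul contDiffOn_const)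

lemma fderiv_potential {Y : ℂ × ℝ → ℂ × ℝ} (hY : IsKillingField Y) {p : ℂ × ℝ}
    (hp : p ∈ halfSpace) (c v : ℂ × ℝ) :
    fderiv ℝ (potential Y) p c v =
      (-(2 * p.2)⁻¹ * ((fderiv ℝ (fderiv ℝ Y) p c bV).2 + (fderiv ℝ Y p c).1.im / p.2
        - (Y p).1.im * c.2 / p.2 ^ 2)
        + c.2 / (2 * p.2 ^ 2) * ((fderiv ℝ Y p bV).2 + (Y p).1.im / p.2)) * v.1.re
      + ((2 * p.2)⁻¹ * ((fderiv ℝ (fderiv ℝ Y) p c bU).2 + (fderiv ℝ Y p c).1.re / p.2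
        - (Y p).1.re * c.2 / p.2 ^ 2)
        - c.2 / (2 * p.2 ^ 2) * ((fderiv ℝ Y p bU).2 + (Y p).1.re / p.2)) * v.1.im
      + (-(2 * p.2)⁻¹ * (fderiv ℝ (fderiv ℝ Y) p c bU).1.im
        + c.2 / (2 * p.2 ^ 2) * (fderiv ℝ Y p bU).1.im) * v.2 := by
  have hw : p.2 ≠ 0 := ne_of_gt hp
  have h2w : HasFDerivAt (fun q : ℂ × ℝ => (2 * q.2)⁻¹) _ p :=
    (hasDerivAt_inv (x := 2 * p.2) (by simpa using hw)).comp_hasFDerivAt p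
      (cW.hasFDerivAt.const_mul 2)
  have hinv : HasFDerivAt (fun q : ℂ × ℝ => (q.2)⁻¹) _ p :=
    (hasDerivAt_inv (x := p.2) hw).comp_hasFDerivAt p cW.hasFDerivAt
  have hc : ∀ (l : ℂ × ℝ →L[ℝ] ℝ) (a : ℂ × ℝ), HasFDerivAt (fun q => l (fderiv ℝ Y q a)) _ p :=
    fun l a => l.hasFDerivAt.comp p (hasFDerivAt_fderiv_apply (hY.contDiffAt_two hp) a)
  have hc' : ∀ (l : ℂ × ℝ →L[ℝ] ℝ), HasFDerivAt (fun q => l (Y q) * q.2⁻¹) _ p :=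
    fun l => (l.hasFDerivAt.comp p (hY.differentiableAt hp).hasFDerivAt).mul hinv
  have key : HasFDerivAt (potential Y) _ p :=
    (((h2w.neg.mul ((hc cW bV).add (hc' cV))).smul (hasFDerivAt_const cU p)).add
    ((h2w.mul ((hc cW bU).add (hc' cU))).smul (hasFDerivAt_const cV p))).add
    ((h2w.neg.mul (hc cV bU)).smul (hasFDerivAt_const cW p))
  rw [key.fderiv]
  simp
  field_simp
  ring

/-- Written with the Killing equation, `potential Y` is -¼⋆dY♭, and d⋆dY♭ = -4⋆Y♭ is the Bochner
identity for a Killing field in curvature -1. The verification is in coordinates, from the Killing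
equation and its first derivatives. -/
lemma potential_closed {Y : ℂ × ℝ → ℂ × ℝ} (hY : IsKillingField Y) {p : ℂ × ℝ}
    (hp : p ∈ halfSpace) (a b : ℂ × ℝ) :
    fderiv ℝ (potential Y) p a b - fderiv ℝ (potential Y) p b a = hVol p a b (Y p) := by
  have hw : p.2 ≠ 0 := ne_of_gt hp
  have K := fun a b => hY.euc_fderiv hp a b
  have K2 := fun a b c => hY.euc_fderiv_fderiv hp a b c
  have S := fun a b => fderiv_fderiv_symm (hY.contDiffAt_two hp) a b
  have k11 := K bU bU
  have k22 := K bV bV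
  have k33 := K bW bW
  have k13 := K bU bW
  have k23 := K bV bW
  have d1 := K2 bU bW bU
  have d2 := K2 bV bW bV
  have d3 := K2 bU bU bW
  have d4 := K2 bV bV bW
  have d5 := K2 bV bV bU
  have d6 := K2 bW bW bU
  have d7 := K2 bW bW bV
  have d8 := K2 bU bV bU
  have d9 := K2 bU bU bV
  clear K K2
  -- Symmetry of the second derivatives makes the chosen instances speak of the same unknowns as the
  -- derivatives of the potential.
  rw [S bU bW] at d1 d6
  rw [S bV bW] at d2 d7
  rw [S bU bV] at d5 d8
  simp only [euc, bU_re, bU_im, bU_snd, bV_re, bV_im, bV_snd, bW_re, bW_im, bW_snd, mul_zero,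
    zero_mul, mul_one, one_mul, add_zero, zero_add, zero_div, sub_zero]
    at k11 k22 k33 k13 k23 d1 d2 d3 d4 d5 d6 d7 d8 d9
  field_simp at k11 k22 k33 d3 d4 d5 d6 d7 d9
  have h12 : fderiv ℝ (potential Y) p bU bV - fderiv ℝ (potential Y) p bV bU
      = (Y p).2 / p.2 ^ 3 := by
    rw [fderiv_potential hY hp, fderiv_potential hY hp]
    simp only [bU_re, bU_im, bU_snd, bV_re, bV_im, bV_snd]
    field_simp
    linear_combination p.2 ^ 2 * (d1 + d2) - (d3 + d4) / 2 - k33 + (k11 + k22) / 2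
  have h23 : fderiv ℝ (potential Y) p bV bW - fderiv ℝ (potential Y) p bW bV
      = (Y p).1.re / p.2 ^ 3 := by
    rw [fderiv_potential hY hp, fderiv_potential hY hp]
    simp only [bW_re, bW_im, bW_snd, bV_re, bV_im, bV_snd]
    field_simp
    linear_combination -p.2 / 2 * (d5 + d6) - p.2 * k13
  have h31 : fderiv ℝ (potential Y) p bW bU - fderiv ℝ (potential Y) p bU bW
      = (Y p).1.im / p.2 ^ 3 := by
    rw [fderiv_potential hY hp, fderiv_potential hY hp]
    simp only [bU_re, bU_im, bU_snd, bW_re, bW_im, bW_snd]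
    field_simp
    linear_combination -p.2 / 2 * (d7 + d9) - p.2 * k23 + p.2 ^ 2 * d8
  -- Both sides are alternating and bilinear in a and b, so the three basis pairs suffice.
  rw [eq_basis a, eq_basis b]
  generalize fderiv ℝ (potential Y) p = D at *
  simp only [map_add, map_smul, add_apply, smul_apply,
    smul_eq_mul]
  simp only [hVol, ← eq_basis]
  linear_combination (a.1.re * b.1.im - a.1.im * b.1.re) * h12
    + (a.1.im * b.2 - a.2 * b.1.im) * h23 + (a.2 * b.1.re - a.1.re * b.2) * h31

/-! ### The flux form of a parametrized surface -/

/-- The Euclidean cross product of `ℂ × ℝ`. -/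
def eucCross (a b : ℂ × ℝ) : ℂ × ℝ :=
  ((⟨a.1.im * b.2 - a.2 * b.1.im, a.2 * b.1.re - a.1.re * b.2⟩ : ℂ),
      a.1.re * b.1.im - a.1.im * b.1.re)

lemma hCross_eq (p a b : ℂ × ℝ) : hCross p a b = p.2⁻¹ • eucCross a b := rfl

/-- Lagrange's identity, for a pair of orthogonal vectors of equal length. -/
lemma euc_eucCross_self {A B : ℂ × ℝ} (h : euc A A = euc B B) (h0 : euc A B = 0) :
    euc (eucCross A B) (eucCross A B) = euc A A ^ 2 := by
  have : euc (eucCross A B) (eucCross A B) = euc A A * euc B B - euc A B ^ 2 := by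
    simp only [euc, eucCross]; ring
  rw [this, ← h, h0]; ring

lemma euc_smul_left (r : ℝ) (a b : ℂ × ℝ) : euc (r • a) b = r * euc a b := by
  simp [euc]; ring

lemma euc_smul_right (r : ℝ) (a b : ℂ × ℝ) : euc a (r • b) = r * euc a b := by
  simp [euc]; ring

lemma euc_add_left (a b c : ℂ × ℝ) : euc (a + b) c = euc a c + euc b c := by
  simp [euc]; ring

lemma euc_comm (a b : ℂ × ℝ) : euc a b = euc b a := by
  simp [euc]; ring

lemma IsConformalImmersionAt.euc {f : ℂ → ℂ × ℝ} {z : ℂ} (hp : f z ∈ halfSpace)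
    (h : IsConformalImmersionAt f z) :
    0 < euc (dx f z) (dx f z) ∧ euc (dx f z) (dx f z) = euc (dy f z) (dy f z) ∧
      euc (dx f z) (dy f z) = 0 := by
  have hw : 0 < (f z).2 := hp
  obtain ⟨h1, h2, h3⟩ := h
  simp only [hInner_eq] at h1 h2 h3
  refine ⟨?_, ?_, ?_⟩
  · by_contra hn
    exact absurd h1 (not_lt.2 (div_nonpos_of_nonpos_of_nonneg (not_lt.1 hn) (by positivity)))
  · field_simp at h2; exact h2
  · simpa [hw.ne'] using h3

/-- For a conformal frame the cross product has a length free of square roots, which makes the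
normal a rational expression. -/
lemma unitNormal_eq {f : ℂ → ℂ × ℝ} {z : ℂ} (hp : f z ∈ halfSpace)
    (h : IsConformalImmersionAt f z) :
    unitNormal f z = ((f z).2 / euc (dx f z) (dx f z)) • eucCross (dx f z) (dy f z) := by
  have hw : 0 < (f z).2 := hp
  obtain ⟨h1, h2, h3⟩ := h.euc hp
  have hn : hNorm (f z) (hCross (f z) (dx f z) (dy f z))
      = euc (dx f z) (dx f z) / (f z).2 ^ 2 := by
    rw [hNorm, hInner_eq, hCross_eq, euc_smul_left, euc_smul_right, euc_eucCross_self h2 h3,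
      Real.sqrt_eq_iff_mul_self_eq (by positivity) (by positivity)]
    field_simp
  rw [unitNormal, hUnit, hn, hCross_eq, smul_smul]
  congr 1
  field_simp

/-- A, B and A × B form an orthogonal basis, and a vector is determined by its inner products with a
basis. -/
lemma eq_of_euc_eq {A B S T : ℂ × ℝ} (h : 0 < euc A A) (hAB : euc A A = euc B B)
    (h0 : euc A B = 0) (hA : euc S A = euc T A) (hB : euc S B = euc T B)
    (hC : euc S (eucCross A B) = euc T (eucCross A B)) : S = T := by
  have hL : euc A A ≠ 0 := h.ne'
  have hn := euc_eucCross_self hAB h0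
  have key : ∀ V : ℂ × ℝ, euc V A = 0 → euc V B = 0 → euc V (eucCross A B) = 0 → V = 0 := by
    intro V h1 h2 h3
    -- Expansion of V in the basis dual to (A, B, A × B), multiplied by the determinant |A × B|².
    have e : ∀ V : ℂ × ℝ, euc (eucCross A B) (eucCross A B) • V
        = euc V (eucCross A B) • eucCross A B + euc V A • eucCross B (eucCross A B)
          + euc V B • eucCross (eucCross A B) A := by
      intro V
      refine Prod.ext (Complex.ext ?_ ?_) ?_ <;> simp [euc, eucCross] <;> ring
    have := e V
    rw [h1, h2, h3, hn] at this
    simpa [hL] using this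
  have hs : ∀ c, euc (S - T) c = euc S c - euc T c := fun c => by simp [euc]; ring
  exact sub_eq_zero.1 (key _ (by rw [hs, hA, sub_self]) (by rw [hs, hB, sub_self])
    (by rw [hs, hC, sub_self]))

/-- The Euclidean Laplacian of a conformal immersion of mean curvature one. -/
lemma laplacian_of_meanCurvature_eq_one {f : ℂ → ℂ × ℝ} {z : ℂ} (hf : ContDiffAt ℝ 2 f z)
    (hp : f z ∈ halfSpace) (hc : ∀ᶠ u in 𝓝 z, IsConformalImmersionAt f u)
    (hH : meanCurvature f z = 1) :
    fderiv ℝ (fderiv ℝ f) z 1 1 + fderiv ℝ (fderiv ℝ f) z Complex.I Complex.I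
      = (2 * (f z).2⁻¹) • ((dx f z).2 • dx f z + (dy f z).2 • dy f z
        - euc (dx f z) (dx f z) • bW + eucCross (dx f z) (dy f z)) := by
  have hw : 0 < (f z).2 := hp
  obtain ⟨h1, h2, h3⟩ := hc.self_of_nhds.euc hp
  have hx : HasFDerivAt (dx f) ((fderiv ℝ (fderiv ℝ f) z).flip 1) z := hasFDerivAt_fderiv_apply hf 1
  have hy : HasFDerivAt (dy f) ((fderiv ℝ (fderiv ℝ f) z).flip Complex.I) z :=
    hasFDerivAt_fderiv_apply hf Complex.I
  have hpe : ∀ᶠ u in 𝓝 z, f u ∈ halfSpace :=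
    hf.continuousAt.eventually_mem (isOpen_halfSpace.mem_nhds hp)
  have hS := fderiv_fderiv_symm hf 1 Complex.I
  have euc' : ∀ {g k : ℂ → ℂ × ℝ} {g' k' : ℂ →L[ℝ] ℂ × ℝ}, HasFDerivAt g g' z →
      HasFDerivAt k k' z → ∀ v, fderiv ℝ (fun u => euc (g u) (k u)) z v
        = euc (g z) (k' v) + euc (g' v) (k z) := by
    intro g k g' k' hg hk v
    have := eucL.hasFDerivAt_of_bilinear hg hk
    simp only [eucL_apply] at this
    rw [this.fderiv]
    simp
  -- Differentiating the conformality relations shows that the Euclidean Laplacian of f is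
  -- orthogonal to `dx f` and `dy f`; only its normal component is left, and the mean curvature
  -- determines it.
  have c1 : fderiv ℝ (fun u => euc (dx f u) (dx f u)) z
      = fderiv ℝ (fun u => euc (dy f u) (dy f u)) z := by
    apply Filter.EventuallyEq.fderiv_eq
    filter_upwards [hc, hpe] with u hu hu' using (hu.euc hu').2.1
  have c2 : fderiv ℝ (fun u => euc (dx f u) (dy f u)) z = 0 := by
    have : (fun u => euc (dx f u) (dy f u)) =ᶠ[𝓝 z] fun _ => 0 := by
      filter_upwards [hc, hpe] with u hu hu' using (hu.euc hu').2.2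
    rw [this.fderiv_eq]; simp
  have c1x := congrArg (fun l => l 1) c1
  have c1y := congrArg (fun l => l Complex.I) c1
  have c2x := congrArg (fun l => l 1) c2
  have c2y := congrArg (fun l => l Complex.I) c2
  simp only [euc' hx hx, euc' hy hy, euc' hx hy, ContinuousLinearMap.flip_apply, zero_apply, hS]
    at c1x c1y c2x c2y
  have hxx : dx (dx f) z = fderiv ℝ (fderiv ℝ f) z 1 1 := by rw [dx, hx.fderiv]; rfl
  have hyy : dy (dy f) z = fderiv ℝ (fderiv ℝ f) z Complex.I Complex.I := by
    rw [dy, hy.fderiv]; rfl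
  have hN := unitNormal_eq hp hc.self_of_nhds
  simp only [meanCurvature, hxx, hyy, hN] at hH
  have hF : hInner (f z) (dx f z) (dy f z) = 0 := by rw [hInner_eq, h3, zero_div]
  have hG : hInner (f z) (dy f z) (dy f z) = euc (dx f z) (dx f z) / (f z).2 ^ 2 := by
    rw [hInner_eq, h2]
  have hE : hInner (f z) (dx f z) (dx f z) = euc (dx f z) (dx f z) / (f z).2 ^ 2 := by
    rw [hInner_eq]
  rw [hF, hG, hE] at hH
  have hcr := euc_eucCross_self h2 h3
  have hAC : euc (dx f z) (eucCross (dx f z) (dy f z)) = 0 := by simp [euc, eucCross]; ring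
  have hBC : euc (dy f z) (eucCross (dx f z) (dy f z)) = 0 := by simp [euc, eucCross]; ring
  have hchr : ∀ a, christoffel (f z) a a = (f z).2⁻¹ • (euc a a • bW - (2 * a.2) • a) := by
    intro a
    refine Prod.ext (Complex.ext ?_ ?_) ?_ <;> simp [christoffel, euc, bW] <;>
      first | ring1 | (left; ring1)
  rw [hchr, hchr] at hH
  have euc_sub : ∀ a b c, euc (a - b) c = euc a c - euc b c := fun a b c => by simp [euc]; ring
  simp only [hInner_eq, euc_smul_right, euc_smul_left, euc_add_left, euc_sub, hAC, hBC, ← h2,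
    mul_zero, sub_zero] at hH
  have hWA : ∀ a, euc bW a = a.2 := fun a => by simp [euc]
  rw [euc_comm (dx f z) (fderiv ℝ (fderiv ℝ f) z _ _),
    euc_comm (dy f z) (fderiv ℝ (fderiv ℝ f) z _ _)] at c1x c1y
  rw [euc_comm (dx f z) (fderiv ℝ (fderiv ℝ f) z _ _)] at c2x c2y
  refine eq_of_euc_eq h1 h2 h3 ?_ ?_ ?_ <;>
    simp only [euc_add_left, euc_smul_left, euc_sub, hAC, hBC, hcr, hWA, h3, ← h2,
      euc_comm (dy f z) (dx f z), euc_comm (eucCross _ _) (dx f z),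
      euc_comm (eucCross _ _) (dy f z)]
  · linear_combination c1x / 2 + c2y
  · linear_combination c2x - c1y / 2
  · rw [hWA] at hH
    field_simp at hH ⊢
    refine mul_left_cancel₀ h1.ne' ?_
    linear_combination hH

/-- The flux form of `Y` along `f`: on the surface, `⟨η, Y⟩ ds` minus twice the potential. -/
def fluxForm (Y : ℂ × ℝ → ℂ × ℝ) (f : ℂ → ℂ × ℝ) (z : ℂ) : ℂ →L[ℝ] ℝ :=
  (-hInner (f z) (dy f z) (Y (f z)) - 2 * potential Y (f z) (dx f z)) • Complex.reCLM
    + (hInner (f z) (dx f z) (Y (f z)) - 2 * potential Y (f z) (dy f z)) • Complex.imCLM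

/-- A coordinate-free form: the only structure used on the parameter plane is multiplication by I,
whence the invariance under holomorphic changes of chart. -/
lemma fluxForm_apply (Y : ℂ × ℝ → ℂ × ℝ) (f : ℂ → ℂ × ℝ) (z v : ℂ) :
    fluxForm Y f z v = -hInner (f z) (fderiv ℝ f z (Complex.I * v)) (Y (f z))
      - 2 * potential Y (f z) (fderiv ℝ f z v) := by
  have h1 : fderiv ℝ f z v = v.re • dx f z + v.im • dy f z := by
    rw [dx, dy, ← map_smul, ← map_smul, ← map_add]; congr 1; apply Complex.ext <;> simp
  have h2 : fderiv ℝ f z (Complex.I * v) = (-v.im) • dx f z + v.re • dy f z := by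
    rw [dx, dy, ← map_smul, ← map_smul, ← map_add]; congr 1; apply Complex.ext <;> simp
  rw [h1, h2]
  simp only [fluxForm, hInner_eq, euc_add_left, euc_smul_left, map_add, map_smul]
  simp
  ring

lemma contDiffOn_fluxForm {Y : ℂ × ℝ → ℂ × ℝ} (hY : IsKillingField Y) {f : ℂ → ℂ × ℝ} {U : Set ℂ}
    (hU : IsOpen U) (hf : ContDiffOn ℝ ∞ f U) (hm : ∀ z ∈ U, f z ∈ halfSpace) :
    ContDiffOn ℝ ∞ (fluxForm Y f) U := by
  have hd : ContDiffOn ℝ ∞ (fderiv ℝ f) U := hf.fderiv_of_isOpen hU (by simp)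
  have hv : ∀ v, ContDiffOn ℝ ∞ (fun z => fderiv ℝ f z v) U := fun v =>
    hd.clm_apply contDiffOn_const
  have hp : ∀ v, ContDiffOn ℝ ∞ (fun z => potential Y (f z) (fderiv ℝ f z v)) U := fun v =>
    ((contDiffOn_potential hY).comp hf hm).clm_apply (hv v)
  have hi : ∀ v, ContDiffOn ℝ ∞ (fun z => hInner (f z) (fderiv ℝ f z v) (Y (f z))) U := by
    intro v
    have h1 : ContDiffOn ℝ ∞ (fun z => eucL (fderiv ℝ f z v) (Y (f z)) / (f z).2 ^ 2) U :=
      ((eucL.contDiff.comp_contDiffOn (hv v)).clm_apply (hY.smooth.comp hf hm)).div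
        ((contDiff_snd.comp_contDiffOn hf).pow 2) fun z hz => pow_ne_zero 2 (ne_of_gt (hm z hz))
    simpa only [hInner_eq, eucL_apply] using h1
  exact (((hi Complex.I).neg.sub (contDiffOn_const.mul (hp 1))).smul contDiffOn_const).add
    (((hi 1).sub (contDiffOn_const.mul (hp Complex.I))).smul contDiffOn_const)

/-- A continuous real-linear form on `ℂ` valued map is closed if its mixed partials agree. -/
lemma symm_of_one_I (D : ℂ →L[ℝ] ℂ →L[ℝ] ℝ) (h : D 1 Complex.I = D Complex.I 1) (v w : ℂ) :
    D v w = D w v := by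
  have e : ∀ v : ℂ, v = v.re • (1 : ℂ) + v.im • Complex.I := fun v => by
    apply Complex.ext <;> simp
  rw [e v, e w]
  simp only [map_add, map_smul, add_apply, smul_apply, smul_eq_mul, h]
  ring

lemma hasFDerivAt_potential_comp {Y : ℂ × ℝ → ℂ × ℝ} (hY : IsKillingField Y) {f : ℂ → ℂ × ℝ} {z : ℂ}
    (hf : ContDiffAt ℝ 2 f z) (hp : f z ∈ halfSpace) (v : ℂ) :
    HasFDerivAt (fun u => potential Y (f u) (fderiv ℝ f u v))
      ((potential Y (f z)).comp ((fderiv ℝ (fderiv ℝ f) z).flip v)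
        + ((fderiv ℝ (potential Y) (f z)).comp (fderiv ℝ f z)).flip (fderiv ℝ f z v)) z := by
  have h1 : HasFDerivAt (potential Y) (fderiv ℝ (potential Y) (f z)) (f z) :=
    (((contDiffOn_potential hY) _ hp).contDiffAt
      (isOpen_halfSpace.mem_nhds hp)).differentiableAt (by simp) |>.hasFDerivAt
  exact (h1.comp z (hf.differentiableAt (by norm_num)).hasFDerivAt).clm_apply
    (hasFDerivAt_fderiv_apply hf v)

/-- The pull-back of `potential Y` satisfies `dα = ι_Y vol`. -/
lemma fderiv_potential_comp_sub {Y : ℂ × ℝ → ℂ × ℝ} (hY : IsKillingField Y) {f : ℂ → ℂ × ℝ} {z : ℂ}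
    (hf : ContDiffAt ℝ 2 f z) (hp : f z ∈ halfSpace) (v w : ℂ) :
    fderiv ℝ (fun u => potential Y (f u) (fderiv ℝ f u w)) z v
      - fderiv ℝ (fun u => potential Y (f u) (fderiv ℝ f u v)) z w
      = hVol (f z) (fderiv ℝ f z v) (fderiv ℝ f z w) (Y (f z)) := by
  rw [(hasFDerivAt_potential_comp hY hf hp w).fderiv, (hasFDerivAt_potential_comp hY hf hp v).fderiv,
    ← potential_closed hY hp]
  simp [fderiv_fderiv_symm hf v w]

/-- Only the derivative in the direction v itself is evaluated: there DY enters through a diagonal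
term, which the Killing equation expresses by Y alone. -/
lemma hasFDerivAt_hInner_comp {Y : ℂ × ℝ → ℂ × ℝ} (hY : IsKillingField Y) {f : ℂ → ℂ × ℝ} {z : ℂ}
    (hf : ContDiffAt ℝ 2 f z) (hp : f z ∈ halfSpace) (v : ℂ) :
    ∃ D : ℂ →L[ℝ] ℝ, HasFDerivAt (fun u => hInner (f u) (fderiv ℝ f u v) (Y (f u))) D z ∧
      D v = euc (fderiv ℝ (fderiv ℝ f) z v v) (Y (f z)) / (f z).2 ^ 2
        + (Y (f z)).2 * euc (fderiv ℝ f z v) (fderiv ℝ f z v) / (f z).2 ^ 3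
        - 2 * euc (fderiv ℝ f z v) (Y (f z)) * (fderiv ℝ f z v).2 / (f z).2 ^ 3 := by
  have hw : (f z).2 ≠ 0 := ne_of_gt hp
  have hf1 := (hf.differentiableAt (by norm_num)).hasFDerivAt
  have h1 := eucL.hasFDerivAt_of_bilinear (hasFDerivAt_fderiv_apply hf v)
    ((hY.differentiableAt hp).hasFDerivAt.comp z hf1)
  have h2 := (hasDerivAt_inv (pow_ne_zero 2 hw)).comp_hasFDerivAt z
    ((cW.hasFDerivAt.comp z hf1).pow 2)
  have h3 := h1.mul h2
  simp only [eucL_apply, Function.comp_def, cW_apply] at h3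
  refine ⟨_, h3.congr_of_eventuallyEq (Filter.Eventually.of_forall fun u => ?_), ?_⟩
  · simp [hInner_eq, div_eq_mul_inv]
  have hk := hY.euc_fderiv hp (fderiv ℝ f z v) (fderiv ℝ f z v)
  rw [euc_comm (fderiv ℝ Y (f z) _)] at hk
  simp
  field_simp at hk ⊢
  linear_combination hk / 2

/-- The flux form of a Killing field along a conformal immersion of mean curvature one is
closed. -/
lemma fluxForm_closed {Y : ℂ × ℝ → ℂ × ℝ} (hY : IsKillingField Y) {f : ℂ → ℂ × ℝ} {z : ℂ}
    (hf : ContDiffAt ℝ 2 f z) (hp : f z ∈ halfSpace)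
    (hc : ∀ᶠ u in 𝓝 z, IsConformalImmersionAt f u) (hH : meanCurvature f z = 1) (v w : ℂ) :
    fderiv ℝ (fluxForm Y f) z v w = fderiv ℝ (fluxForm Y f) z w v := by
  apply symm_of_one_I
  have hw : (f z).2 ≠ 0 := ne_of_gt hp
  obtain ⟨Dx, hDx, hDx'⟩ := hasFDerivAt_hInner_comp hY hf hp 1
  obtain ⟨Dy, hDy, hDy'⟩ := hasFDerivAt_hInner_comp hY hf hp Complex.I
  have hPx := hasFDerivAt_potential_comp hY hf hp 1
  have hPy := hasFDerivAt_potential_comp hY hf hp Complex.I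
  have hd := fderiv_potential_comp_sub hY hf hp 1 Complex.I
  rw [hPx.fderiv, hPy.fderiv] at hd
  have key : HasFDerivAt (fluxForm Y f) _ z :=
    ((hDy.neg.sub (hPx.const_mul 2)).smul (hasFDerivAt_const Complex.reCLM z)).add
    ((hDx.sub (hPy.const_mul 2)).smul (hasFDerivAt_const Complex.imCLM z))
  have hl := laplacian_of_meanCurvature_eq_one hf hp hc hH
  have hle := congrArg (fun a => euc a (Y (f z))) hl
  have euc_sub : ∀ a b c, euc (a - b) c = euc a c - euc b c := fun a b c => by simp [euc]; ring
  have hWA : ∀ a, euc bW a = a.2 := fun a => by simp [euc]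
  simp only [euc_add_left, euc_smul_left, euc_sub, hWA] at hle
  have hvol : hVol (f z) (dx f z) (dy f z) (Y (f z))
      = euc (eucCross (dx f z) (dy f z)) (Y (f z)) / (f z).2 ^ 3 := by
    simp only [hVol, euc, eucCross]; ring
  obtain ⟨h1, h2, h3⟩ := hc.self_of_nhds.euc hp
  rw [key.fderiv]
  change _ = hVol (f z) (dx f z) (dy f z) (Y (f z)) at hd
  change _ = _ + _ * euc (dx f z) (dx f z) / _ - 2 * euc (dx f z) _ * (dx f z).2 / _ at hDx'
  change _ = _ + _ * euc (dy f z) (dy f z) / _ - 2 * euc (dy f z) _ * (dy f z).2 / _ at hDy'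
  rw [hvol] at hd
  rw [← h2] at hDy'
  -- The divergence of the tangential part of Y. By the formula for the Laplacian and H = 1 it is 2
  -- vol(f_x, f_y, Y), which is what twice the potential compensates.
  have : Dx 1 + Dy Complex.I = 2 * (euc (eucCross (dx f z) (dy f z)) (Y (f z)) / (f z).2 ^ 3) := by
    rw [hDx', hDy']
    field_simp at hle ⊢
    linear_combination (f z).2 ^ 0 * hle
  simp at hd ⊢
  linear_combination this - 2 * hd

/-! ### Stokes' theorem on the disc, and the flux as the integral of a closed form -/

/-- The polar coordinates `(r, t) ↦ r exp (i t)`. -/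
def polarMap (p : ℝ × ℝ) : ℂ := p.1 * Complex.exp (p.2 * Complex.I)

lemma hasDerivAt_exp_mul_I (t : ℝ) :
    HasDerivAt (fun s : ℝ => Complex.exp (s * Complex.I))
      (Complex.I * Complex.exp (t * Complex.I)) t := by
  have h := ((hasDerivAt_id t).ofReal_comp.mul_const Complex.I).cexp
  simpa [mul_comm] using h

lemma hasFDerivAt_cexp_snd (p : ℝ × ℝ) :
    HasFDerivAt (fun q : ℝ × ℝ => Complex.exp (q.2 * Complex.I))
      ((ContinuousLinearMap.snd ℝ ℝ ℝ).smulRight (Complex.I * Complex.exp (p.2 * Complex.I))) p := by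
  have h := (hasDerivAt_exp_mul_I p.2).hasFDerivAt.comp p (hasFDerivAt_snd (𝕜 := ℝ) (p := p))
  refine h.congr_fderiv ?_
  ext <;> simp

lemma hasFDerivAt_polarMap (p : ℝ × ℝ) :
    HasFDerivAt polarMap ((ContinuousLinearMap.fst ℝ ℝ ℝ).smulRight (Complex.exp (p.2 * Complex.I))
      + (ContinuousLinearMap.snd ℝ ℝ ℝ).smulRight
        (p.1 * (Complex.I * Complex.exp (p.2 * Complex.I)))) p := by
  have h := (hasFDerivAt_fst (𝕜 := ℝ) (p := p)).fun_smul (hasFDerivAt_cexp_snd p)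
  have h' : HasFDerivAt polarMap _ p :=
    h.congr_of_eventuallyEq (Filter.Eventually.of_forall fun q => by simp [polarMap])
  refine h'.congr_fderiv ?_
  ext <;> simp

lemma continuous_polarMap : Continuous polarMap := by
  unfold polarMap; fun_prop

lemma norm_polarMap (p : ℝ × ℝ) : ‖polarMap p‖ = |p.1| := by
  simp [polarMap, Complex.norm_exp_ofReal_mul_I]

/-- Integration over a disc or an annulus in polar coordinates. -/
lemma integral_polar (g : ℂ → ℝ) {a b : ℝ} (ha : 0 ≤ a) :
    ∫ z in {z : ℂ | a < ‖z‖ ∧ ‖z‖ < b}, g z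
      = ∫ p in Set.Icc (a, -Real.pi) (b, Real.pi), p.1 * g (polarMap p) := by
  have hm : MeasurableSet {z : ℂ | a < ‖z‖ ∧ ‖z‖ < b} :=
    ((isOpen_lt continuous_const continuous_norm).inter
      (isOpen_lt continuous_norm continuous_const)).measurableSet
  rw [← MeasureTheory.integral_indicator hm, ← Complex.integral_comp_polarCoord_symm]
  have e : ∀ p : ℝ × ℝ, Complex.polarCoord.symm p = polarMap p := fun p => by
    rw [Complex.polarCoord_symm_apply, polarMap, Complex.exp_mul_I]
    simp
  have h1 : ∀ p ∈ polarCoord.target, p.1 • Set.indicator {z : ℂ | a < ‖z‖ ∧ ‖z‖ < b} g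
      (Complex.polarCoord.symm p)
      = Set.indicator (Set.Ioo a b ×ˢ Set.Ioo (-Real.pi) Real.pi)
        (fun p : ℝ × ℝ => p.1 * g (polarMap p)) p := by
    intro p hp
    have hp1 : 0 < p.1 := hp.1
    have hp2 : p.2 ∈ Set.Ioo (-Real.pi) Real.pi := hp.2
    rw [e]
    by_cases h : p.1 ∈ Set.Ioo a b
    · rw [Set.indicator_of_mem, Set.indicator_of_mem, smul_eq_mul]
      · exact ⟨h, hp2⟩
      · simpa [norm_polarMap, abs_of_pos hp1] using h
    · rw [Set.indicator_of_notMem, Set.indicator_of_notMem, smul_zero]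
      · exact fun h' => h h'.1
      · simpa [norm_polarMap, abs_of_pos hp1] using h
  rw [MeasureTheory.setIntegral_congr_fun polarCoord.open_target.measurableSet h1,
    MeasureTheory.setIntegral_indicator (measurableSet_Ioo.prod measurableSet_Ioo)]
  have hsub : Set.Ioo a b ×ˢ Set.Ioo (-Real.pi) Real.pi ⊆ polarCoord.target := by
    rintro p ⟨h1, h2⟩
    exact ⟨lt_of_le_of_lt ha h1.1, h2⟩
  rw [Set.inter_eq_self_of_subset_right hsub]
  apply MeasureTheory.setIntegral_congr_set
  rw [← Set.Icc_prod_Icc]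
  exact MeasureTheory.Measure.set_prod_ae_eq MeasureTheory.Ioo_ae_eq_Icc
    MeasureTheory.Ioo_ae_eq_Icc

/-- Stokes' theorem on the unit disc. -/
lemma integral_ball_eq_integral_circle {α : ℂ → ℂ →L[ℝ] ℝ} {U : Set ℂ} (hU : IsOpen U)
    (hα : ContDiffOn ℝ 1 α U) (hB : Metric.closedBall (0 : ℂ) 1 ⊆ U) :
    ∫ z in Metric.ball (0 : ℂ) 1, (fderiv ℝ α z 1 Complex.I - fderiv ℝ α z Complex.I 1)
      = ∫ t in (0 : ℝ)..(2 * Real.pi), α (Complex.exp (t * Complex.I))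
          (Complex.I * Complex.exp (t * Complex.I)) := by
  have hpi := Real.pi_pos
  set g : ℂ → ℝ := fun z => fderiv ℝ α z 1 Complex.I - fderiv ℝ α z Complex.I 1 with hg
  -- The centre is a null set, so the disc is an annulus of inner radius 0 for the purpose of
  -- integration.
  have hball : Metric.ball (0 : ℂ) 1 =ᵐ[MeasureTheory.volume] {z : ℂ | 0 < ‖z‖ ∧ ‖z‖ < 1} := by
    have : {z : ℂ | 0 < ‖z‖ ∧ ‖z‖ < 1} = Metric.ball (0 : ℂ) 1 \ {0} := by
      ext z; simp [and_comm]
    rw [this]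
    exact (MeasureTheory.sdiff_null_ae_eq_self (by simp)).symm
  rw [MeasureTheory.setIntegral_congr_set hball, integral_polar _ le_rfl]
  have hmem : ∀ p ∈ Set.Icc ((0 : ℝ), -Real.pi) (1, Real.pi), polarMap p ∈ U := by
    intro p hp
    apply hB
    rw [mem_closedBall_zero_iff, norm_polarMap, abs_of_nonneg hp.1.1]
    exact hp.2.1
  have hdα : ∀ z ∈ U, HasFDerivAt α (fderiv ℝ α z) z := fun z hz =>
    ((hα.differentiableOn one_ne_zero).differentiableAt (hU.mem_nhds hz)).hasFDerivAt
  have hcα : ContinuousOn (fderiv ℝ α) U := hα.continuousOn_fderiv_of_isOpen hU le_rfl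
  -- The pull-back of α by the polar map has dr-coefficient α(e^{it}) and dt-coefficient α(iz). The
  -- plane field (dt-coefficient, -dr-coefficient) has divergence r times the coefficient of dα.
  have hQ : ∀ p : ℝ × ℝ, polarMap p ∈ U → HasFDerivAt
      (fun p : ℝ × ℝ => -α (polarMap p) (Complex.exp (p.2 * Complex.I))) _ p := fun p hp =>
    (((hdα _ hp).comp p (hasFDerivAt_polarMap p)).clm_apply (hasFDerivAt_cexp_snd p)).neg
  have hP : ∀ p : ℝ × ℝ, polarMap p ∈ U → HasFDerivAt
      (fun p : ℝ × ℝ => α (polarMap p) (Complex.I * polarMap p)) _ p := fun p hp =>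
    ((hdα _ hp).comp p (hasFDerivAt_polarMap p)).clm_apply
      ((hasFDerivAt_polarMap p).const_mul Complex.I)
  -- The antisymmetrization of a bilinear form takes the same value on every direct orthonormal
  -- frame.
  have hrot : ∀ (D : ℂ →L[ℝ] ℂ →L[ℝ] ℝ) (t : ℝ),
      D (Complex.exp (t * Complex.I)) (Complex.I * Complex.exp (t * Complex.I))
        - D (Complex.I * Complex.exp (t * Complex.I)) (Complex.exp (t * Complex.I))
      = D 1 Complex.I - D Complex.I 1 := by
    intro D t
    have e1 : Complex.exp (t * Complex.I) = Real.cos t • (1 : ℂ) + Real.sin t • Complex.I := by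
      rw [Complex.exp_mul_I]; simp
    have e2 : Complex.I * Complex.exp (t * Complex.I)
        = (-Real.sin t) • (1 : ℂ) + Real.cos t • Complex.I := by
      rw [e1]; apply Complex.ext <;> simp [-Complex.ofReal_cos, -Complex.ofReal_sin]
    rw [e2, e1]
    simp only [map_add, map_smul, add_apply, smul_apply, smul_eq_mul]
    linear_combination (D 1 Complex.I - D Complex.I 1) * Real.cos_sq_add_sin_sq t
  have hc : ContinuousOn (fun p : ℝ × ℝ => p.1 * g (polarMap p))
      (Set.Icc ((0 : ℝ), -Real.pi) (1, Real.pi)) :=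
    continuous_fst.continuousOn.mul (((hcα.clm_apply continuousOn_const).clm_apply
      continuousOn_const).sub ((hcα.clm_apply continuousOn_const).clm_apply
      continuousOn_const) |>.comp continuous_polarMap.continuousOn hmem)
  have hsum : ∀ p : ℝ × ℝ, ∀ hp : polarMap p ∈ U,
      (((α (polarMap p)).comp (Complex.I • ((ContinuousLinearMap.fst ℝ ℝ ℝ).smulRight
          (Complex.exp (p.2 * Complex.I)) + (ContinuousLinearMap.snd ℝ ℝ ℝ).smulRight
          (p.1 * (Complex.I * Complex.exp (p.2 * Complex.I))))))
        + ((fderiv ℝ α (polarMap p)).comp ((ContinuousLinearMap.fst ℝ ℝ ℝ).smulRight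
          (Complex.exp (p.2 * Complex.I)) + (ContinuousLinearMap.snd ℝ ℝ ℝ).smulRight
          (p.1 * (Complex.I * Complex.exp (p.2 * Complex.I))))).flip (Complex.I * polarMap p)) (1, 0)
      + (-((α (polarMap p)).comp ((ContinuousLinearMap.snd ℝ ℝ ℝ).smulRight
          (Complex.I * Complex.exp (p.2 * Complex.I)))
        + ((fderiv ℝ α (polarMap p)).comp ((ContinuousLinearMap.fst ℝ ℝ ℝ).smulRight
          (Complex.exp (p.2 * Complex.I)) + (ContinuousLinearMap.snd ℝ ℝ ℝ).smulRight
          (p.1 * (Complex.I * Complex.exp (p.2 * Complex.I))))).flip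
            (Complex.exp (p.2 * Complex.I)))) (0, 1)
      = p.1 * g (polarMap p) := by
    intro p hp
    have e1 : Complex.I * polarMap p = p.1 • (Complex.I * Complex.exp (p.2 * Complex.I)) := by
      rw [polarMap, Complex.real_smul]; ring
    have e2 : (p.1 : ℂ) * (Complex.I * Complex.exp (p.2 * Complex.I))
        = p.1 • (Complex.I * Complex.exp (p.2 * Complex.I)) := by
      rw [Complex.real_smul]
    rw [e1, e2, hg]
    simp only [← hrot (fderiv ℝ α (polarMap p)) p.2]
    simp [-Complex.real_smul]
    ring
  have key := MeasureTheory.integral_divergence_prod_Icc_of_hasFDerivAt_of_le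
    (fun p : ℝ × ℝ => α (polarMap p) (Complex.I * polarMap p))
    (fun p : ℝ × ℝ => -α (polarMap p) (Complex.exp (p.2 * Complex.I))) _ _
    (0, -Real.pi) (1, Real.pi) ⟨zero_le_one, by simpa using hpi.le⟩
    (fun p hp => (hP p (hmem p hp)).continuousAt.continuousWithinAt)
    (fun p hp => (hQ p (hmem p hp)).continuousAt.continuousWithinAt)
    (fun p hp => hP p (hmem p ⟨⟨hp.1.1.le, hp.2.1.le⟩, ⟨hp.1.2.le, hp.2.2.le⟩⟩))
    (fun p hp => hQ p (hmem p ⟨⟨hp.1.1.le, hp.2.1.le⟩, ⟨hp.1.2.le, hp.2.2.le⟩⟩))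
    ((hc.integrableOn_compact isCompact_Icc).congr_fun
      (fun p hp => (hsum p (hmem p hp)).symm) measurableSet_Icc)
  have key := (MeasureTheory.setIntegral_congr_fun measurableSet_Icc
    (fun p hp => hsum p (hmem p hp))).symm.trans key
  have hper : Function.Periodic (fun t : ℝ => α (Complex.exp (t * Complex.I))
      (Complex.I * Complex.exp (t * Complex.I))) (2 * Real.pi) := by
    intro t
    have : Complex.exp (((t + 2 * Real.pi : ℝ) : ℂ) * Complex.I)
        = Complex.exp (t * Complex.I) := by
      rw [← Complex.exp_periodic (t * Complex.I)]; congr 1; push_cast; ring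
    simp only [this]
  have h0 := hper.intervalIntegral_add_eq 0 (-Real.pi)
  rw [zero_add, show -Real.pi + 2 * Real.pi = Real.pi by ring] at h0
  -- On the boundary of the rectangle, the sides t = ±π cancel and the side r = 0 contributes zero
  -- because the polar map vanishes there.
  rw [key, h0]
  simp [polarMap]

/-- Along a regular curve on a conformal immersion, `η ds = -df(i Γ') dt`. -/
lemma hInner_conormal {f : ℂ → ℂ × ℝ} {Γ : ℝ → ℂ} {t : ℝ} (hf : DifferentiableAt ℝ f (Γ t))
    (hΓ : DifferentiableAt ℝ Γ t) (hp : f (Γ t) ∈ halfSpace)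
    (hc : IsConformalImmersionAt f (Γ t)) (hr : deriv Γ t ≠ 0) (b : ℂ × ℝ) :
    hInner (f (Γ t)) (conormal f Γ t) b * hNorm (f (Γ t)) (deriv (fun s => f (Γ s)) t)
      = -hInner (f (Γ t)) (fderiv ℝ f (Γ t) (Complex.I * deriv Γ t)) b := by
  have hw : 0 < (f (Γ t)).2 := hp
  obtain ⟨h1, h2, h3⟩ := hc.euc hp
  have hd : deriv (fun s => f (Γ s)) t = fderiv ℝ f (Γ t) (deriv Γ t) := by
    have := (hf.hasFDerivAt.comp_hasDerivAt t hΓ.hasDerivAt).deriv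
    exact this
  have e1 : ∀ v : ℂ, fderiv ℝ f (Γ t) v = v.re • dx f (Γ t) + v.im • dy f (Γ t) := fun v => by
    rw [dx, dy, ← map_smul, ← map_smul, ← map_add]; congr 1; apply Complex.ext <;> simp
  have hL := h1.ne'
  set V := fderiv ℝ f (Γ t) (deriv Γ t) with hV
  have hVV : euc V V = ((deriv Γ t).re ^ 2 + (deriv Γ t).im ^ 2)
      * euc (dx f (Γ t)) (dx f (Γ t)) := by
    have : euc V V = (deriv Γ t).re ^ 2 * euc (dx f (Γ t)) (dx f (Γ t))
        + 2 * (deriv Γ t).re * (deriv Γ t).im * euc (dx f (Γ t)) (dy f (Γ t))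
        + (deriv Γ t).im ^ 2 * euc (dy f (Γ t)) (dy f (Γ t)) := by
      rw [hV, e1]; simp [euc]; ring
    rw [this, ← h2, h3]; ring
  have hpos : 0 < hNorm (f (Γ t)) V := by
    rw [hNorm, hInner_eq]
    apply Real.sqrt_pos.2
    rw [hVV]
    have : 0 < (deriv Γ t).re ^ 2 + (deriv Γ t).im ^ 2 := by
      have := Complex.normSq_pos.2 hr
      rw [Complex.normSq_apply] at this
      nlinarith
    positivity
  -- The triple product V × (A × B) = ⟨V, B⟩A - ⟨V, A⟩B is, for a conformal frame, a multiple of V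
  -- rotated by a right angle in the tangent plane.
  have hcr : eucCross V (eucCross (dx f (Γ t)) (dy f (Γ t)))
      = (-euc (dx f (Γ t)) (dx f (Γ t))) • fderiv ℝ f (Γ t) (Complex.I * deriv Γ t) := by
    have e : eucCross V (eucCross (dx f (Γ t)) (dy f (Γ t)))
        = euc V (dy f (Γ t)) • dx f (Γ t) - euc V (dx f (Γ t)) • dy f (Γ t) := by
      refine Prod.ext (Complex.ext ?_ ?_) ?_ <;> simp [euc, eucCross] <;> ring
    rw [e, hV, e1, e1]
    simp only [euc_add_left, euc_smul_left, h3, ← h2, euc_comm (dy f (Γ t)) (dx f (Γ t))]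
    refine Prod.ext (Complex.ext ?_ ?_) ?_ <;> simp <;> ring
  have hcs : ∀ (r s : ℝ) (A B : ℂ × ℝ), eucCross (r • A) (s • B) = (r * s) • eucCross A B := by
    intro r s A B
    refine Prod.ext (Complex.ext ?_ ?_) ?_ <;> simp [eucCross] <;> ring
  rw [conormal, hd, hUnit, unitNormal_eq hp hc, hCross_eq, hcs, hcr]
  simp only [hInner_eq, euc_smul_left]
  field_simp

/-- The flux is the integral of the flux form. -/
lemma fluxValue_eq {Y : ℂ × ℝ → ℂ × ℝ} (hY : IsKillingField Y) {f K : ℂ → ℂ × ℝ} {Γ : ℝ → ℂ}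
    {r : ℝ} (hΓ : IsEndLoop r Γ) (hK : IsSpanningDisc f Γ K) (hf : ContDiffOn ℝ ∞ f (annulus r 1))
    (hm : ∀ z ∈ annulus r 1, f z ∈ halfSpace)
    (hc : ∀ z ∈ annulus r 1, IsConformalImmersionAt f z) :
    fluxValue f Γ K Y = ∫ t in (0 : ℝ)..(2 * Real.pi), fluxForm Y f (Γ t) (deriv Γ t) := by
  have hopen : IsOpen (annulus r 1) :=
    (isOpen_lt continuous_const continuous_norm).inter (isOpen_lt continuous_norm continuous_const)
  have hfd : ∀ t, DifferentiableAt ℝ f (Γ t) := fun t =>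
    (hf.differentiableOn (by simp)).differentiableAt (hopen.mem_nhds (hΓ.mem t))
  have hΓd : ∀ t, DifferentiableAt ℝ Γ t := fun t =>
    hΓ.smooth.contDiffAt.differentiableAt (by simp)
  have hd : ∀ t, deriv (fun s => f (Γ s)) t = fderiv ℝ f (Γ t) (deriv Γ t) := fun t =>
    ((hfd t).hasFDerivAt.comp_hasDerivAt t (hΓd t).hasDerivAt).deriv
  have hcf : Continuous (fun t => fderiv ℝ f (Γ t)) :=
    (hf.continuousOn_fderiv_of_isOpen hopen (by simp)).comp_continuous hΓ.smooth.continuous hΓ.mem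
  have hcfΓ : Continuous (fun t => f (Γ t)) :=
    hf.continuousOn.comp_continuous hΓ.smooth.continuous hΓ.mem
  have hcΓ' : Continuous (deriv Γ) := hΓ.smooth.continuous_deriv (by simp)
  have hmΓ : ∀ t, f (Γ t) ∈ halfSpace := fun t => hm _ (hΓ.mem t)
  have hcY : Continuous (fun t => Y (f (Γ t))) := hY.smooth.continuousOn.comp_continuous hcfΓ hmΓ
  -- the first integral
  have h1 : ∀ t, hInner (f (Γ t)) (conormal f Γ t) (Y (f (Γ t)))
      * hNorm (f (Γ t)) (deriv (fun s => f (Γ s)) t)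
      = -(eucL (fderiv ℝ f (Γ t) (Complex.I * deriv Γ t)) (Y (f (Γ t))) / (f (Γ t)).2 ^ 2) := by
    intro t
    rw [hInner_conormal (hfd t) (hΓd t) (hmΓ t) (hc _ (hΓ.mem t)) (hΓ.regular t), hInner_eq,
      eucL_apply]
  have hc1 : Continuous (fun t => -(eucL (fderiv ℝ f (Γ t) (Complex.I * deriv Γ t)) (Y (f (Γ t)))
      / (f (Γ t)).2 ^ 2)) :=
    (((eucL.continuous.comp (hcf.clm_apply (continuous_const.mul hcΓ'))).clm_apply hcY).div
      ((continuous_snd.comp hcfΓ).pow 2) fun t => pow_ne_zero 2 (ne_of_gt (hmΓ t))).neg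
  -- the second integral
  set U := K ⁻¹' halfSpace with hUdef
  have hU : IsOpen U := isOpen_halfSpace.preimage hK.smooth.continuous
  set α : ℂ → ℂ →L[ℝ] ℝ := fun z => (potential Y (K z)).comp (fderiv ℝ K z) with hα
  have hK2 : ∀ z, ContDiffAt ℝ 2 K z := fun z =>
    hK.smooth.contDiffAt.of_le (WithTop.coe_le_coe.2 le_top)
  have hαs : ContDiffOn ℝ ∞ α U :=
    ((contDiffOn_potential hY).comp hK.smooth.contDiffOn fun _ h => h).clm_comp
      (hK.smooth.fderiv_right (m := ∞) (by simp)).contDiffOn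
  have hαd : ∀ z ∈ U, ∀ v w, fderiv ℝ α z v w
      = fderiv ℝ (fun u => potential Y (K u) (fderiv ℝ K u w)) z v := by
    intro z hz v w
    have := (((hαs.differentiableOn (by simp)).differentiableAt
      (hU.mem_nhds hz)).hasFDerivAt.clm_apply (hasFDerivAt_const w z)).fderiv
    have h' : (fun u => potential Y (K u) (fderiv ℝ K u w)) = fun u => α u w := rfl
    rw [h', this]
    simp
  have h2 : ∫ z in Metric.ball (0 : ℂ) 1, hVol (K z) (dx K z) (dy K z) (Y (K z))
      = ∫ t in (0 : ℝ)..(2 * Real.pi), potential Y (f (Γ t)) (fderiv ℝ f (Γ t) (deriv Γ t)) := by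
    have hsub : Metric.closedBall (0 : ℂ) 1 ⊆ U := fun z hz =>
      hK.mem_halfSpace z (by simpa using hz)
    have hS := integral_ball_eq_integral_circle hU (hαs.of_le (by simp)) hsub
    have e : Set.EqOn (fun z => fderiv ℝ α z 1 Complex.I - fderiv ℝ α z Complex.I 1)
        (fun z => hVol (K z) (dx K z) (dy K z) (Y (K z))) (Metric.ball 0 1) := by
      intro z hz
      have hz' := hsub (Metric.ball_subset_closedBall hz)
      simp only [hαd z hz']
      exact fderiv_potential_comp_sub hY (hK2 z) hz' 1 Complex.I
    rw [← MeasureTheory.setIntegral_congr_fun Metric.isOpen_ball.measurableSet e, hS]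
    apply intervalIntegral.integral_congr
    intro t _
    have hd' : deriv (fun s : ℝ => K (Complex.exp (s * Complex.I))) t
        = fderiv ℝ K (Complex.exp (t * Complex.I)) (Complex.I * Complex.exp (t * Complex.I)) :=
      (((hK2 _).differentiableAt (by norm_num)).hasFDerivAt.comp_hasDerivAt t
        (hasDerivAt_exp_mul_I t)).deriv
    simp only [hα, ContinuousLinearMap.comp_apply, ← hd', ← hd, hK.boundary]
  have hc2 : Continuous (fun t => potential Y (f (Γ t)) (fderiv ℝ f (Γ t) (deriv Γ t))) :=
    (((contDiffOn_potential hY).continuousOn.comp_continuous hcfΓ hmΓ).clm_apply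
      (hcf.clm_apply hcΓ'))
  rw [fluxValue, h2, ← intervalIntegral.integral_const_mul]
  simp only [h1]
  rw [← intervalIntegral.integral_sub (hc1.intervalIntegrable _ _)
    ((hc2.const_mul 2).intervalIntegrable _ _)]
  apply intervalIntegral.integral_congr
  intro t _
  simp only [fluxForm_apply, hInner_eq, eucL_apply]

/-! ### Periods of closed forms on an annulus -/

lemma isOpen_annulus (r s : ℝ) : IsOpen (annulus r s) :=
  (isOpen_lt continuous_const continuous_norm).inter (isOpen_lt continuous_norm continuous_const)

lemma contDiff_of_tsupport {E F : Type*} [NormedAddCommGroup E] [NormedSpace ℝ E]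
    [NormedAddCommGroup F] [NormedSpace ℝ F] {n : WithTop ℕ∞} {f : E → F}
    (h : ∀ x ∈ tsupport f, ContDiffAt ℝ n f x) : ContDiff ℝ n f := by
  rw [contDiff_iff_contDiffAt]
  intro x
  by_cases hx : x ∈ tsupport f
  · exact h x hx
  · exact contDiffAt_const.congr_of_eventuallyEq (notMem_tsupport_iff_eventuallyEq.1 hx)

/-- A logarithm of a smooth curve is differentiable. -/
lemma hasDerivAt_of_exp_eq {Γ L : ℝ → ℂ} {t : ℝ} {Γ' : ℂ} (hΓ : HasDerivAt Γ Γ' t)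
    (hL : Continuous L) (h : ∀ t, Γ t = Complex.exp (L t)) : HasDerivAt L (Γ' / Γ t) t := by
  have hne : Γ t ≠ 0 := by rw [h]; exact Complex.exp_ne_zero _
  -- Near t the continuous logarithm L is L t plus the principal logarithm of Γ s / Γ t, since the
  -- imaginary part of L s - L t stays within (-π, π).
  have h1 : HasDerivAt (fun s => L t + Complex.log (Γ s / Γ t)) (Γ' / Γ t) t := by
    have h2 : HasDerivAt (fun s => Γ s / Γ t) (Γ' / Γ t) t := hΓ.div_const _
    have := (h2.clog_real (by simp [div_self hne])).const_add (L t)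
    simpa [div_self hne] using this
  refine h1.congr_of_eventuallyEq ?_
  have h3 : Filter.Tendsto (fun s => (L s - L t).im) (𝓝 t) (𝓝 0) := by
    have : Continuous fun s => (L s - L t).im :=
      Complex.continuous_im.comp (hL.sub continuous_const)
    simpa using this.tendsto t
  filter_upwards [h3 (Ioo_mem_nhds (neg_lt_zero.2 Real.pi_pos) Real.pi_pos)] with s hs
  have hs1 : -Real.pi < (L s - L t).im := hs.1
  have hs2 : (L s - L t).im < Real.pi := hs.2
  rw [h s, h t, ← Complex.exp_sub, Complex.log_exp hs1 hs2.le]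
  ring

/-- The integral of a closed form over the generators of the fundamental group of an annulus. -/
lemma exists_period {θ : ℂ → ℂ →L[ℝ] ℝ} {r : ℝ} (hθ : ContDiffOn ℝ 1 θ (annulus r 1))
    (hcl : ∀ z ∈ annulus r 1, ∀ v w, fderiv ℝ θ z v w = fderiv ℝ θ z w v) :
    ∃ c : ℝ, ∀ Γ : ℝ → ℂ, IsEndLoop r Γ →
      ∫ t in (0 : ℝ)..(2 * Real.pi), θ (Γ t) (deriv Γ t) = c := by
  have hopen := isOpen_annulus r 1
  -- The universal cover of the annulus is a convex vertical strip, or half-plane if r = 0, on which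
  -- the pulled-back closed form has a primitive F.
  set S : Set ℂ := {L | Complex.exp L ∈ annulus r 1} with hS
  have hSo : IsOpen S := hopen.preimage Complex.continuous_exp
  have hSc : Convex ℝ S := by
    have : S = Complex.reLm ⁻¹' {x : ℝ | r < Real.exp x ∧ Real.exp x < 1} := by
      ext L; simp [hS, annulus, Complex.norm_exp]
    rw [this]
    apply Convex.linear_preimage
    apply Set.OrdConnected.convex
    refine ⟨fun x hx y hy z hz => ⟨hx.1.trans_le (Real.exp_le_exp.2 hz.1),
      (Real.exp_le_exp.2 hz.2).trans_lt hy.2⟩⟩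
  set m : ℂ → ℂ →L[ℝ] ℂ := fun L => ContinuousLinearMap.mul ℝ ℂ (Complex.exp L) with hm
  have hexp : ∀ L, HasFDerivAt Complex.exp (m L) L := fun L => by
    have := (Complex.hasDerivAt_exp L).hasFDerivAt.restrictScalars ℝ
    refine this.congr_fderiv ?_
    ext <;> simp [hm, mul_comm]
  have hmd : ∀ L, HasFDerivAt m ((ContinuousLinearMap.mul ℝ ℂ).comp (m L)) L := fun L =>
    (ContinuousLinearMap.mul ℝ ℂ).hasFDerivAt.comp L (hexp L)
  set θ' : ℂ → ℂ →L[ℝ] ℝ := fun L => (θ (Complex.exp L)).comp (m L) with hθ'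
  have hθd : ∀ z ∈ annulus r 1, HasFDerivAt θ (fderiv ℝ θ z) z := fun z hz =>
    ((hθ.differentiableOn one_ne_zero).differentiableAt (hopen.mem_nhds hz)).hasFDerivAt
  have hd : ∀ L ∈ S, HasFDerivAt θ' _ L := fun L hL =>
    ((hθd _ hL).comp L (hexp L)).clm_comp (hmd L)
  obtain ⟨F, hF⟩ := hSc.exists_forall_hasFDerivAt_of_fderiv_symmetric hSo
    (fun L hL => (hd L hL).differentiableAt.differentiableWithinAt) (by
      intro L hL v w
      rw [(hd L hL).fderiv]
      have := hcl _ hL (m L v) (m L w)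
      simp [hm, mul_comm, mul_left_comm] at this ⊢
      linarith)
  have hper : ∀ L, Complex.exp (L - 2 * Real.pi * Complex.I) = Complex.exp L := fun L => by
    rw [Complex.exp_sub, Complex.exp_two_pi_mul_I, div_one]
  have hSper : ∀ L ∈ S, L - 2 * Real.pi * Complex.I ∈ S := fun L hL => by
    simpa [hS, hper] using hL
  -- The pulled-back form is invariant under the deck transformation L ↦ L - 2πi, so F changes by a
  -- constant under it. That constant is the period, as the logarithm of an end loop drops by 2πi.
  have hG : ∀ L ∈ S, HasFDerivAt (fun L => F (L - 2 * Real.pi * Complex.I) - F L)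
      (0 : ℂ →L[ℝ] ℝ) L := by
    intro L hL
    have h1 := (hF _ (hSper L hL)).comp L ((hasFDerivAt_id L).sub_const (2 * Real.pi * Complex.I))
    refine (h1.sub (hF L hL)).congr_fderiv ?_
    simp only [hθ', hm, hper]
    ext <;> simp
  obtain ⟨c, hc⟩ : ∃ c, ∀ L ∈ S, F (L - 2 * Real.pi * Complex.I) - F L = c := by
    rcases S.eq_empty_or_nonempty with he | ⟨L₀, hL₀⟩
    · exact ⟨0, by simp [he]⟩
    · exact ⟨_, fun L hL => hSo.is_const_of_fderiv_eq_zero hSc.isPreconnected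
        (fun L hL => (hG L hL).differentiableAt.differentiableWithinAt)
        (fun L hL => (hG L hL).fderiv) hL hL₀⟩
  refine ⟨c, fun Γ hΓ => ?_⟩
  obtain ⟨L, hLc, hLe, hLp⟩ := hΓ.winding
  have hLS : ∀ t, L t ∈ S := fun t => by
    have := hΓ.mem t
    rwa [hLe] at this
  have hΓd : ∀ t, HasDerivAt Γ (deriv Γ t) t := fun t =>
    (hΓ.smooth.contDiffAt.differentiableAt (by simp)).hasDerivAt
  have hder : ∀ t ∈ Set.uIcc (0 : ℝ) (2 * Real.pi),
      HasDerivAt (fun t => F (L t)) (θ (Γ t) (deriv Γ t)) t := by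
    intro t _
    have h1 := (hF _ (hLS t)).comp_hasDerivAt t (hasDerivAt_of_exp_eq (hΓd t) hLc hLe)
    refine h1.congr_deriv ?_
    have hne : Γ t ≠ 0 := by rw [hLe]; exact Complex.exp_ne_zero _
    simp only [hθ', hm, ContinuousLinearMap.comp_apply, ContinuousLinearMap.mul_apply', ← hLe]
    rw [mul_div_cancel₀ _ hne]
  have hcont : Continuous (fun t => θ (Γ t) (deriv Γ t)) :=
    (hθ.continuousOn.comp_continuous hΓ.smooth.continuous hΓ.mem).clm_apply
      (hΓ.smooth.continuous_deriv (by simp))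
  rw [intervalIntegral.integral_eq_sub_of_hasDerivAt hder (hcont.intervalIntegrable _ _)]
  have := hLp 0
  rw [zero_add] at this
  rw [this]
  exact hc _ (hLS 0)

/-- The circle of radius `ρ`, run clockwise. -/
def circleLoop (ρ : ℝ) (t : ℝ) : ℂ := ρ * Complex.exp (-t * Complex.I)

lemma hasDerivAt_circleLoop (ρ t : ℝ) :
    HasDerivAt (circleLoop ρ) (-Complex.I * circleLoop ρ t) t := by
  have h := ((((hasDerivAt_id t).ofReal_comp.neg).mul_const Complex.I).cexp).const_mul (ρ : ℂ)
  refine h.congr_deriv ?_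
  simp [circleLoop]; ring

lemma norm_circleLoop {ρ : ℝ} (hρ : 0 ≤ ρ) (t : ℝ) : ‖circleLoop ρ t‖ = ρ := by
  have : Complex.exp (-t * Complex.I) = Complex.exp (((-t : ℝ) : ℂ) * Complex.I) := by simp
  rw [circleLoop, norm_mul, this, Complex.norm_exp_ofReal_mul_I]
  simp [abs_of_nonneg hρ]

lemma isEndLoop_circleLoop {r ρ : ℝ} (hr : 0 ≤ r) (h1 : r < ρ) (h2 : ρ < 1) :
    IsEndLoop r (circleLoop ρ) := by
  have hρ : 0 < ρ := hr.trans_lt h1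
  have hn := norm_circleLoop hρ.le
  have hne : ∀ t, circleLoop ρ t ≠ 0 := fun t => by
    rw [← norm_pos_iff, hn]; exact hρ
  refine ⟨?_, fun t => ?_, fun t => ?_, fun t => Real.log ρ - t * Complex.I, ?_, fun t => ?_,
    fun t => ?_⟩
  · unfold circleLoop
    have h : ContDiff ℝ ∞ (fun t : ℝ => -(t : ℂ) * Complex.I) :=
      Complex.ofRealCLM.contDiff.neg.mul contDiff_const
    exact contDiff_const.mul h.cexp
  · simpa [annulus, hn] using ⟨h1, h2⟩
  · rw [(hasDerivAt_circleLoop ρ t).deriv]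
    exact mul_ne_zero (neg_ne_zero.2 Complex.I_ne_zero) (hne t)
  · fun_prop
  · rw [Complex.exp_sub, ← Complex.ofReal_exp, Real.exp_log hρ, circleLoop, neg_mul,
      Complex.exp_neg]
    rfl
  · push_cast; ring

/-- End loops run clockwise and polar angles counterclockwise; periodicity reconciles the two
intervals of integration. -/
lemma integral_circle_eq_neg {θ : ℂ → ℂ →L[ℝ] ℝ} (ρ : ℝ) :
    ∫ t in (-Real.pi)..Real.pi, θ (polarMap (ρ, t)) (Complex.I * polarMap (ρ, t))
      = -∫ t in (0 : ℝ)..(2 * Real.pi), θ (circleLoop ρ t) (deriv (circleLoop ρ) t) := by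
  have h1 : ∀ t, θ (circleLoop ρ t) (deriv (circleLoop ρ) t)
      = -θ (polarMap (ρ, -t)) (Complex.I * polarMap (ρ, -t)) := by
    intro t
    have : circleLoop ρ t = polarMap (ρ, -t) := by simp [circleLoop, polarMap]
    rw [(hasDerivAt_circleLoop ρ t).deriv, this, neg_mul, map_neg]
  simp only [h1]
  rw [intervalIntegral.integral_neg, neg_neg,
    intervalIntegral.integral_comp_neg (fun t => θ (polarMap (ρ, t)) (Complex.I * polarMap (ρ, t)))]
  have hper : Function.Periodic
      (fun t : ℝ => θ (polarMap (ρ, t)) (Complex.I * polarMap (ρ, t))) (2 * Real.pi) := by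
    intro t
    have : polarMap (ρ, t + 2 * Real.pi) = polarMap (ρ, t) := by
      simp only [polarMap]
      rw [← Complex.exp_periodic (t * Complex.I)]; congr 2; push_cast; ring
    simp only [this]
  have := hper.intervalIntegral_add_eq (-Real.pi) (-(2 * Real.pi))
  rw [show -Real.pi + 2 * Real.pi = Real.pi by ring, neg_add_cancel] at this
  rw [this, neg_zero]

/-- Any map of the annulus to the half-space sends the circles to boundaries of discs. -/
lemma exists_isSpanningDisc {f : ℂ → ℂ × ℝ} {r : ℝ} (hr : 0 ≤ r) (hr1 : r < 1)
    (hf : ContDiffOn ℝ ∞ f (annulus r 1)) (hm : ∀ z, f z ∈ halfSpace) :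
    ∃ Γ K, IsEndLoop r Γ ∧ IsSpanningDisc f Γ K := by
  set ρ : ℝ := (r + 1) / 2 with hρ
  have h1 : r < ρ := by rw [hρ]; linarith
  have h2 : ρ < 1 := by rw [hρ]; linarith
  have hρ0 : 0 < ρ := hr.trans_lt h1
  -- The margin δ keeps ρz̄ inside the annulus whenever |z|² is within δ of 1, that is, on the
  -- closed support of the bump function below.
  obtain ⟨δ, hδ, hδ1, hδ2⟩ : ∃ δ : ℝ, 0 < δ ∧ r ^ 2 < ρ ^ 2 * (1 - δ) ∧ ρ ^ 2 * (1 + δ) < 1 := by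
    have e1 : 0 < ρ ^ 2 - r ^ 2 := by nlinarith
    have e2 : 0 < 1 - ρ ^ 2 := by nlinarith
    refine ⟨min (ρ ^ 2 - r ^ 2) (1 - ρ ^ 2) / 2, by positivity, ?_, ?_⟩
    · have := min_le_left (ρ ^ 2 - r ^ 2) (1 - ρ ^ 2)
      nlinarith
    · have := min_le_right (ρ ^ 2 - r ^ 2) (1 - ρ ^ 2)
      nlinarith
  let χ : ContDiffBump (1 : ℝ) := ⟨δ / 2, δ, by linarith, by linarith⟩
  set q : ℂ → ℝ := fun z => z.re ^ 2 + z.im ^ 2 with hq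
  have hqs : ContDiff ℝ ∞ q :=
    (Complex.reCLM.contDiff.pow 2).add (Complex.imCLM.contDiff.pow 2)
  have hqn : ∀ z, q z = ‖z‖ ^ 2 := fun z => by
    rw [← Complex.normSq_eq_norm_sq, Complex.normSq_apply]; simp only [hq]; ring
  set c := f 0 with hc
  -- The disc interpolates between the values of f near the unit circle and the constant c, by
  -- convexity of the half-space. Conjugation matches the clockwise loop. The point 0 is outside the
  -- annulus, so c = f 0 is an arbitrary point of the half-space.
  refine ⟨circleLoop ρ, fun z => χ (q z) • (f (ρ * starRingEnd ℂ z) - c) + c,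
    isEndLoop_circleLoop hr h1 h2, ?_, fun z _ => ?_, fun t => ?_⟩
  · refine ContDiff.add (contDiff_of_tsupport fun z hz => ?_) contDiff_const
    have hz1 : q z ∈ Metric.closedBall (1 : ℝ) δ := by
      have hsub : tsupport (fun z => χ (q z) • (f (ρ * starRingEnd ℂ z) - c))
          ⊆ q ⁻¹' Metric.closedBall (1 : ℝ) δ := by
        refine closure_minimal (fun z hz => ?_) (Metric.isClosed_closedBall.preimage hqs.continuous)
        have : χ (q z) ≠ 0 := fun h => hz (by simp [h])
        exact Metric.ball_subset_closedBall (by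
          have h := Function.mem_support.2 this
          rwa [χ.support_eq] at h)
      exact hsub hz
    have hmem : (ρ : ℂ) * starRingEnd ℂ z ∈ annulus r 1 := by
      rw [Metric.mem_closedBall, Real.dist_eq, abs_le, hqn] at hz1
      have hn : ‖(ρ : ℂ) * starRingEnd ℂ z‖ = ρ * ‖z‖ := by
        simp [abs_of_pos hρ0]
      have hz0 := norm_nonneg z
      have ea : r ^ 2 < (ρ * ‖z‖) ^ 2 := by nlinarith [sq_nonneg ρ]
      have eb : (ρ * ‖z‖) ^ 2 < 1 := by nlinarith [sq_nonneg ρ]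
      refine ⟨?_, ?_⟩
      · rw [hn]; exact lt_of_pow_lt_pow_left₀ 2 (by positivity) ea
      · rw [hn]; exact lt_of_pow_lt_pow_left₀ 2 zero_le_one (by simpa using eb)
    have hfs : ContDiffAt ℝ ∞ f ((ρ : ℂ) * starRingEnd ℂ z) :=
      (hf _ hmem).contDiffAt ((isOpen_annulus r 1).mem_nhds hmem)
    have hin : ContDiff ℝ ∞ (fun z => (ρ : ℂ) * starRingEnd ℂ z) :=
      contDiff_const.mul Complex.conjCLE.contDiff
    exact (χ.contDiff.contDiffAt.comp z hqs.contDiffAt).smul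
      ((hfs.comp z hin.contDiffAt).sub contDiffAt_const)
  · have ha := hm (ρ * starRingEnd ℂ z)
    have hb : c ∈ halfSpace := hm 0
    have h0 := χ.nonneg (x := q z)
    have h1 := χ.le_one (x := q z)
    simp only [halfSpace, Set.mem_ofPred_eq] at ha hb ⊢
    simp only [Prod.snd_add, Prod.smul_snd, Prod.snd_sub, smul_eq_mul]
    rcases h1.lt_or_eq with h | h
    · nlinarith [mul_nonneg h0 ha.le, mul_pos (sub_pos.2 h) hb]
    · rw [h]; linarith
  · have : q (Complex.exp (t * Complex.I)) = 1 := by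
      rw [hqn, Complex.norm_exp_ofReal_mul_I]; norm_num
    have hχ : χ 1 = 1 := χ.one_of_mem_closedBall (by simp [χ]; linarith)
    simp only [this, hχ, one_smul, sub_add_cancel]
    congr 1
    rw [circleLoop, ← Complex.exp_conj]
    simp

/-! ### Holomorphic charts -/

/-- An injective holomorphic function has a non-vanishing derivative. -/
lemma deriv_ne_zero_of_injOn {U : Set ℂ} (hU : IsOpen U) {h : ℂ → ℂ} (hd : DifferentiableOn ℂ h U)
    (hi : Set.InjOn h U) {z : ℂ} (hz : z ∈ U) : deriv h z ≠ 0 := by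
  have han : ∀ u ∈ U, AnalyticAt ℂ h u := fun u hu => hd.analyticAt (hU.mem_nhds hu)
  have hnotconst : ¬ ∀ᶠ u in 𝓝 z, h u = h z := by
    intro hc
    have h1 : ∀ᶠ u in 𝓝[≠] z, u ∈ U ∧ h u = h z ∧ u ≠ z := by
      filter_upwards [nhdsWithin_le_nhds (hU.mem_nhds hz), nhdsWithin_le_nhds hc,
        self_mem_nhdsWithin] with u h1 h2 h3 using ⟨h1, h2, h3⟩
    obtain ⟨u, h1, h2, h3⟩ := h1.exists
    exact h3 (hi h1 hz h2)
  have hne : ∀ᶠ u in 𝓝[≠] z, deriv h u ≠ 0 := by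
    rcases (han z hz).deriv.eventually_eq_zero_or_eventually_ne_zero with h0 | h0
    · exfalso
      obtain ⟨ε, hε, hb⟩ := Metric.mem_nhds_iff.1 (h0.and (hU.mem_nhds hz))
      apply hnotconst
      filter_upwards [Metric.ball_mem_nhds z hε] with u hu
      exact Metric.isOpen_ball.is_const_of_deriv_eq_zero (convex_ball z ε).isPreconnected
        (hd.mono fun v hv => (hb hv).2) (fun v hv => (hb hv).1) hu (Metric.mem_ball_self hε)
    · exact h0
  have hopen : 𝓝 (h z) ≤ Filter.map h (𝓝 z) :=
    (han z hz).eventually_constant_or_nhds_le_map_nhds.resolve_left hnotconst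
  -- The inverse k is continuous by openness of h, and holomorphic off h z because the zeros of h'
  -- are isolated. If it is holomorphic at h z too, the chain rule k'·h' = 1 excludes a zero of h'
  -- at z.
  set k := Function.invFunOn h U with hk
  have hkl : ∀ u ∈ U, k (h u) = u := fun u hu => hi.leftInvOn_invFunOn hu
  have hkz := hkl z hz
  have hkc : ∀ u ∈ U, 𝓝 (h u) ≤ Filter.map h (𝓝 u) → Filter.Tendsto k (𝓝 (h u)) (𝓝 u) := by
    intro u hu hle
    refine (Filter.tendsto_map'_iff.2 ?_ : Filter.Tendsto k (Filter.map h (𝓝 u)) (𝓝 u)).mono_left hle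
    refine Filter.Tendsto.congr' ?_ Filter.tendsto_id
    filter_upwards [hU.mem_nhds hu] with v hv
    exact (hkl v hv).symm
  have hkd : ∀ u ∈ U, deriv h u ≠ 0 → DifferentiableAt ℂ k (h u) := by
    intro u hu hu'
    have hs := (han u hu).hasStrictDerivAt
    have hm := hs.map_nhds_eq hu'
    have hfk : ∀ᶠ y in 𝓝 (h u), h (k y) = y := by
      rw [← hm, Filter.eventually_map]
      filter_upwards [hU.mem_nhds hu] with v hv
      rw [hkl v hv]
    have hcont : ContinuousAt k (h u) := by
      have := hkc u hu hm.ge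
      rwa [ContinuousAt, hkl u hu]
    exact (HasDerivAt.of_local_left_inverse (f := h) (f' := deriv h u) hcont
      (by rw [hkl u hu]; exact hs.hasDerivAt) hu' hfk).differentiableAt
  have hkcz : ContinuousAt k (h z) := by
    have := hkc z hz hopen
    rwa [ContinuousAt, hkz]
  have hpd : ∀ᶠ y in 𝓝[≠] (h z), DifferentiableAt ℂ k y := by
    rw [eventually_nhdsWithin_iff] at hne ⊢
    refine hopen (Filter.mem_map.2 ?_)
    filter_upwards [hne, hU.mem_nhds hz] with u hu huU hne'
    exact hkd u huU (hu fun h' => hne' (by rw [h']; rfl))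
  -- Riemann's removable singularity theorem.
  have hka : DifferentiableAt ℂ k (h z) :=
    (Complex.analyticAt_of_differentiable_on_punctured_nhds_of_continuousAt hpd
      hkcz).differentiableAt
  intro h0
  have h1 : HasDerivAt (fun u => k (h u)) (deriv k (h z) * deriv h z) z :=
    hka.hasDerivAt.comp z (han z hz).differentiableAt.hasDerivAt
  have h2 : HasDerivAt (fun u => k (h u)) 1 z := by
    refine (hasDerivAt_id z).congr_of_eventuallyEq ?_
    filter_upwards [hU.mem_nhds hz] with u hu using hkl u hu
  have := h1.unique h2
  rw [h0, mul_zero] at this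
  exact zero_ne_one this

lemma mem_contDiffGroupoid_self {𝕜 E : Type*} [NontriviallyNormedField 𝕜] [NormedAddCommGroup E]
    [NormedSpace 𝕜 E] {n : WithTop ℕ∞} {h : OpenPartialHomeomorph E E} :
    h ∈ contDiffGroupoid n 𝓘(𝕜, E) ↔
      ContDiffOn 𝕜 n h h.source ∧ ContDiffOn 𝕜 n h.symm h.target := by
  rw [contDiffGroupoid, mem_groupoid_of_pregroupoid]
  simp [contDiffPregroupoid]

lemma contDiffGroupoid_real_of_complex {h : OpenPartialHomeomorph ℂ ℂ}
    (hh : h ∈ contDiffGroupoid ω 𝓘(ℂ)) : h ∈ contDiffGroupoid ∞ 𝓘(ℝ, ℂ) := by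
  rw [mem_contDiffGroupoid_self] at hh ⊢
  exact ⟨(hh.1.restrict_scalars ℝ).of_le le_top, (hh.2.restrict_scalars ℝ).of_le le_top⟩

section Charts

variable {M : Type*} [TopologicalSpace M] [ChartedSpace ℂ M]

lemma mem_maximalAtlas_real {e : OpenPartialHomeomorph M ℂ}
    (he : e ∈ IsManifold.maximalAtlas 𝓘(ℂ) ω M) : e ∈ IsManifold.maximalAtlas 𝓘(ℝ, ℂ) ∞ M := by
  rw [IsManifold.mem_maximalAtlas_iff, mem_maximalAtlas_iff] at he ⊢
  exact fun e' he' => ⟨contDiffGroupoid_real_of_complex (he e' he').1,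
    contDiffGroupoid_real_of_complex (he e' he').2⟩

lemma contDiffOn_transition {e e' : OpenPartialHomeomorph M ℂ}
    (he : e ∈ IsManifold.maximalAtlas 𝓘(ℂ) ω M) (he' : e' ∈ IsManifold.maximalAtlas 𝓘(ℂ) ω M) :
    ContDiffOn ℂ ω (fun z => e' (e.symm z)) (e.symm ≫ₕ e').source :=
  (mem_contDiffGroupoid_self.1 (IsManifold.compatible_of_mem_maximalAtlas he he')).1

lemma hasFDerivAt_transition {e e' : OpenPartialHomeomorph M ℂ}
    (he : e ∈ IsManifold.maximalAtlas 𝓘(ℂ) ω M)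
    (he' : e' ∈ IsManifold.maximalAtlas 𝓘(ℂ) ω M) {z : ℂ} (hz : z ∈ (e.symm ≫ₕ e').source) :
    HasFDerivAt (fun z => e' (e.symm z))
      (ContinuousLinearMap.mul ℝ ℂ (deriv (fun z => e' (e.symm z)) z)) z := by
  have h := (((contDiffOn_transition he he').differentiableOn (by simp)).differentiableAt
    ((e.symm ≫ₕ e').open_source.mem_nhds hz)).hasDerivAt.hasFDerivAt.restrictScalars ℝ
  refine h.congr_fderiv ?_
  ext
  simp [mul_comm]

variable [IsManifold 𝓘(ℂ) ω M]

lemma isManifold_real : IsManifold 𝓘(ℝ, ℂ) ∞ M where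
  compatible he he' := contDiffGroupoid_real_of_complex (StructureGroupoid.compatible _ he he')

/-- An injective holomorphic map from an open subset of `ℂ` is the inverse of a chart. -/
lemma exists_chart_of_injOn {U : Set ℂ} (hU : IsOpen U) {φ : ℂ → M}
    (hφ : ContMDiffOn 𝓘(ℂ) 𝓘(ℂ) ω φ U) (hi : Set.InjOn φ U) :
    ∃ e ∈ IsManifold.maximalAtlas 𝓘(ℂ) ω M, e.target = U ∧ ⇑e.symm = φ := by
  have hcomp : ∀ c ∈ IsManifold.maximalAtlas 𝓘(ℂ) ω M,
      IsOpen (U ∩ φ ⁻¹' c.source) ∧ ContDiffOn ℂ ω (fun z => c (φ z)) (U ∩ φ ⁻¹' c.source) := by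
    intro c hc
    refine ⟨hφ.continuousOn.isOpen_inter_preimage hU c.open_source, ?_⟩
    rw [← contMDiffOn_iff_contDiffOn]
    exact (contMDiffOn_of_mem_maximalAtlas hc).comp (hφ.mono Set.inter_subset_left)
      fun z hz => hz.2
  have hinj : ∀ c : OpenPartialHomeomorph M ℂ,
      Set.InjOn (fun z => c (φ z)) (U ∩ φ ⁻¹' c.source) := fun c z hz z' hz' h =>
    hi hz.1 hz'.1 (c.injOn hz.2 hz'.2 h)
  -- φ is open: read in a chart it is an injective holomorphic function, whose derivative does not
  -- vanish, so the inverse function theorem applies.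
  have hnhds : ∀ z ∈ U, Filter.map φ (𝓝 z) = 𝓝 (φ z) := by
    intro z hz
    set c := chartAt ℂ (φ z)
    have hc := IsManifold.chart_mem_maximalAtlas (I := 𝓘(ℂ)) (n := ω) (φ z)
    obtain ⟨ho, hs⟩ := hcomp c hc
    have hzc : z ∈ U ∩ φ ⁻¹' c.source := ⟨hz, mem_chart_source ℂ (φ z)⟩
    have hd := hs.differentiableOn (by simp)
    have h1 := (hd.analyticAt (ho.mem_nhds hzc)).hasStrictDerivAt.map_nhds_eq
      (deriv_ne_zero_of_injOn ho hd (hinj c) hzc)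
    have h2 : Filter.map c.symm (𝓝 (c (φ z))) = 𝓝 (φ z) := by
      have := c.symm.map_nhds_eq (c.map_source hzc.2)
      rwa [c.left_inv hzc.2] at this
    rw [← h2, ← h1, Filter.map_map]
    apply Filter.map_congr
    filter_upwards [ho.mem_nhds hzc] with u hu
    exact (c.left_inv hu.2).symm
  set p := OpenPartialHomeomorph.ofContinuousOpenRestrict (hi.toPartialEquiv φ U) hφ.continuousOn
    (by
      change IsOpenMap (U.domRestrict φ)
      rw [isOpenMap_iff_nhds_le]
      rintro ⟨z, hz⟩
      change 𝓝 (φ z) ≤ Filter.map (φ ∘ Subtype.val) (𝓝 ⟨z, hz⟩)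
      rw [← Filter.map_map, map_nhds_subtype_val, hU.nhdsWithin_eq hz, hnhds z hz]) hU with hp
  have hpφ : ⇑p = φ := rfl
  have hps : p.source = U := rfl
  refine ⟨p.symm, ?_, rfl, rfl⟩
  rw [IsManifold.mem_maximalAtlas_iff, mem_maximalAtlas_iff]
  intro c hc
  have hc' : c ∈ IsManifold.maximalAtlas 𝓘(ℂ) ω M := IsManifold.subset_maximalAtlas hc
  have key : p ≫ₕ c ∈ contDiffGroupoid ω 𝓘(ℂ) := by
    rw [mem_contDiffGroupoid_self]
    obtain ⟨ho, hs⟩ := hcomp c hc'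
    have hsrc : (p ≫ₕ c).source = U ∩ φ ⁻¹' c.source := by
      rw [OpenPartialHomeomorph.trans_source]; rfl
    refine ⟨by rw [hsrc]; exact hs, fun y hy => ContDiffAt.contDiffWithinAt ?_⟩
    have hy' := (p ≫ₕ c).map_target hy
    rw [hsrc] at hy'
    have hd := hs.differentiableOn (by simp)
    exact (p ≫ₕ c).contDiffAt_symm_deriv (deriv_ne_zero_of_injOn ho hd (hinj c) hy') hy
      ((hd.differentiableAt (ho.mem_nhds hy')).hasDerivAt)
      ((hs _ hy').contDiffAt (ho.mem_nhds hy'))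
  refine ⟨by simpa using key, ?_⟩
  have := (contDiffGroupoid ω 𝓘(ℂ)).symm key
  rwa [OpenPartialHomeomorph.trans_symm_eq_symm_trans_symm] at this

lemma AnnularEnd.exists_chart (E : AnnularEnd M) :
    ∃ e ∈ IsManifold.maximalAtlas 𝓘(ℂ) ω M,
      e.target = annulus E.radius 1 ∧ ⇑e.symm = E.param :=
  exists_chart_of_injOn (isOpen_annulus _ _) E.holomorphic E.injective

lemma contDiffOn_comp_symm {F : Type*} [NormedAddCommGroup F] [NormedSpace ℝ F] {g : M → F}
    (hg : ContMDiff 𝓘(ℝ, ℂ) 𝓘(ℝ, F) ∞ g) {e : OpenPartialHomeomorph M ℂ}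
    (he : e ∈ IsManifold.maximalAtlas 𝓘(ℂ) ω M) :
    ContDiffOn ℝ ∞ (fun z => g (e.symm z)) e.target := by
  have := isManifold_real (M := M)
  rw [← contMDiffOn_iff_contDiffOn]
  exact hg.comp_contMDiffOn (contMDiffOn_symm_of_mem_maximalAtlas (mem_maximalAtlas_real he))

/-- The flux form of `Y` along `X` in the chart `e`. -/
def chartForm (Y : ℂ × ℝ → ℂ × ℝ) (X : M → ℂ × ℝ) (e : OpenPartialHomeomorph M ℂ) :
    ℂ → ℂ →L[ℝ] ℝ :=
  fluxForm Y (fun z => X (e.symm z))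

variable {Y : ℂ × ℝ → ℂ × ℝ} {X : M → ℂ × ℝ} {e e' : OpenPartialHomeomorph M ℂ}

lemma contDiffOn_chartForm (hY : IsKillingField Y) (hX : IsBryantImmersion X)
    (he : e ∈ IsManifold.maximalAtlas 𝓘(ℂ) ω M) :
    ContDiffOn ℝ ∞ (chartForm Y X e) e.target :=
  contDiffOn_fluxForm hY e.open_target (contDiffOn_comp_symm hX.smooth he)
    fun _ _ => hX.mem_halfSpace _

lemma chartForm_closed (hY : IsKillingField Y) (hX : IsBryantImmersion X)
    (he : e ∈ IsManifold.maximalAtlas 𝓘(ℂ) ω M) {z : ℂ} (hz : z ∈ e.target) (v w : ℂ) :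
    fderiv ℝ (chartForm Y X e) z v w = fderiv ℝ (chartForm Y X e) z w v := by
  have hn := e.open_target.mem_nhds hz
  refine fluxForm_closed hY ?_ (hX.mem_halfSpace _) ?_ (hX.meanCurvature_eq_one e he z hz) v w
  · exact ((contDiffOn_comp_symm hX.smooth he z hz).contDiffAt hn).of_le
      (WithTop.coe_le_coe.2 le_top)
  · filter_upwards [hn] with u hu using hX.conformal e he u hu

/-- The derivatives of a function in two charts. -/
lemma fderiv_comp_symm {F : Type*} [NormedAddCommGroup F] [NormedSpace ℝ F] {g : M → F}
    (hg : ContMDiff 𝓘(ℝ, ℂ) 𝓘(ℝ, F) ∞ g)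
    (he : e ∈ IsManifold.maximalAtlas 𝓘(ℂ) ω M)
    (he' : e' ∈ IsManifold.maximalAtlas 𝓘(ℂ) ω M) {z : ℂ} (hz : z ∈ (e.symm ≫ₕ e').source)
    (v : ℂ) :
    fderiv ℝ (fun u => g (e.symm u)) z v = fderiv ℝ (fun u => g (e'.symm u)) (e' (e.symm z))
      (deriv (fun z => e' (e.symm z)) z * v) := by
  have ht : e' (e.symm z) ∈ e'.target := e'.map_source hz.2
  have h1 : DifferentiableAt ℝ (fun u => g (e'.symm u)) (e' (e.symm z)) :=
    ((contDiffOn_comp_symm hg he').differentiableOn (by simp)).differentiableAt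
      (e'.open_target.mem_nhds ht)
  have h2 := HasFDerivAt.comp (f := fun z => e' (e.symm z)) z h1.hasFDerivAt (hasFDerivAt_transition he he' hz)
  have h3 : (fun u => g (e.symm u)) =ᶠ[𝓝 z]
      (fun u => g (e'.symm u)) ∘ (fun z => e' (e.symm z)) := by
    filter_upwards [(e.symm ≫ₕ e').open_source.mem_nhds hz] with u hu
    have : e'.symm (e' (e.symm u)) = e.symm u := e'.left_inv hu.2
    simp [this]
  rw [(h2.congr_of_eventuallyEq h3).fderiv]
  simp

/-- The differential of a holomorphic transition is multiplication by a complex number, and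
therefore commutes with multiplication by I. -/
lemma chartForm_transition (hX : IsBryantImmersion X)
    (he : e ∈ IsManifold.maximalAtlas 𝓘(ℂ) ω M) (he' : e' ∈ IsManifold.maximalAtlas 𝓘(ℂ) ω M)
    {z : ℂ} (hz : z ∈ (e.symm ≫ₕ e').source) (v : ℂ) :
    chartForm Y X e z v
      = chartForm Y X e' (e' (e.symm z)) (deriv (fun z => e' (e.symm z)) z * v) := by
  have hz' : e.symm z ∈ e'.source := hz.2
  simp only [chartForm, fluxForm_apply, fderiv_comp_symm hX.smooth he he' hz, e'.left_inv hz']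
  rw [mul_left_comm]

end Charts

/-! ### Integration of `dg ∧ θ` in charts -/

/-- Integration by parts against the constant 1. -/
lemma integral_fderiv_eq_zero {φ : ℂ → ℝ} (hφ : ContDiff ℝ 1 φ) (hc : HasCompactSupport φ) (v : ℂ) :
    ∫ z, fderiv ℝ φ z v = 0 := by
  have h1 : MeasureTheory.Integrable (fun z => fderiv ℝ φ z v) :=
    ((hφ.continuous_fderiv one_ne_zero).clm_apply continuous_const).integrable_of_hasCompactSupport
      (hc.fderiv_apply ℝ v)
  have h2 := integral_mul_fderiv_eq_neg_fderiv_mul_of_integrable (μ := MeasureTheory.volume)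
    (f := fun _ : ℂ => (1 : ℝ)) (g := φ) (v := v) (by simp) (by simpa using h1)
    (by simpa using hφ.continuous.integrable_of_hasCompactSupport hc)
    (fun _ _ => differentiableAt_const _) (fun x _ => hφ.differentiable one_ne_zero x)
  simpa using h2

/-- The determinant of multiplication by c is the field norm of ℂ over ℝ. -/
lemma det_mul_complex (c : ℂ) : (ContinuousLinearMap.mul ℝ ℂ c).det = ‖c‖ ^ 2 := by
  rw [← Complex.normSq_eq_norm_sq, ← Algebra.norm_complex_apply, Algebra.norm_apply]
  rfl

section Wedge

variable {M : Type*} [TopologicalSpace M]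
  {Y : ℂ × ℝ → ℂ × ℝ} {X : M → ℂ × ℝ} {e e' : OpenPartialHomeomorph M ℂ} {g : M → ℝ}

/-- The coefficient of `dg ∧ θ` in the chart `e`, where `θ` is the flux form. -/
def wedge (Y : ℂ × ℝ → ℂ × ℝ) (X : M → ℂ × ℝ) (g : M → ℝ) (e : OpenPartialHomeomorph M ℂ)
    (z : ℂ) : ℝ :=
  fderiv ℝ (fun u => g (e.symm u)) z 1 * chartForm Y X e z Complex.I
    - fderiv ℝ (fun u => g (e.symm u)) z Complex.I * chartForm Y X e z 1

lemma wedge_eq_zero {z : ℂ} (hz : z ∈ e.target) (h : ∀ᶠ y in 𝓝 (e.symm z), g y = g (e.symm z)) :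
    wedge Y X g e z = 0 := by
  have h1 : (fun u => g (e.symm u)) =ᶠ[𝓝 z] fun _ => g (e.symm z) :=
    (e.symm.continuousAt hz).eventually h
  rw [wedge, h1.fderiv_eq]
  simp

/-- A continuous function on the target of a chart that vanishes off a compact set is
integrable. -/
lemma integrableOn_target_of_compact {F : ℂ → ℝ} (hF : ContinuousOn F e.target) {C : Set M}
    (hC : IsCompact C) (hCe : C ⊆ e.source) (h0 : ∀ z ∈ e.target, e.symm z ∉ C → F z = 0) :
    MeasureTheory.IntegrableOn F e.target := by
  have hK : IsCompact (e '' C) := hC.image_of_continuousOn (e.continuousOn.mono hCe)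
  have hsub : e '' C ⊆ e.target := by
    rintro _ ⟨x, hx, rfl⟩; exact e.map_source (hCe hx)
  refine ((hF.mono hsub).integrableOn_compact hK).of_forall_sdiff_eq_zero
    e.open_target.measurableSet fun z hz => h0 z hz.1 fun h => hz.2 ⟨_, h, e.right_inv hz.1⟩

variable [ChartedSpace ℂ M] [IsManifold 𝓘(ℂ) ω M]

lemma differentiableAt_comp_symm {F : Type*} [NormedAddCommGroup F] [NormedSpace ℝ F] {g : M → F}
    (hg : ContMDiff 𝓘(ℝ, ℂ) 𝓘(ℝ, F) ∞ g) (he : e ∈ IsManifold.maximalAtlas 𝓘(ℂ) ω M) {z : ℂ}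
    (hz : z ∈ e.target) : DifferentiableAt ℝ (fun u => g (e.symm u)) z :=
  ((contDiffOn_comp_symm hg he).differentiableOn (by simp)).differentiableAt
      (e.open_target.mem_nhds hz)

lemma wedge_sum {ι : Type*} {s : Finset ι} {g : ι → M → ℝ}
    (hg : ∀ i ∈ s, ContMDiff 𝓘(ℝ, ℂ) 𝓘(ℝ) ∞ (g i)) (he : e ∈ IsManifold.maximalAtlas 𝓘(ℂ) ω M)
    {z : ℂ} (hz : z ∈ e.target) :
    wedge Y X (fun x => ∑ i ∈ s, g i x) e z = ∑ i ∈ s, wedge Y X (g i) e z := by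
  have h := fderiv_fun_sum (𝕜 := ℝ) (x := z) (u := s) (A := fun i u => g i (e.symm u))
    fun i hi => differentiableAt_comp_symm (hg i hi) he hz
  simp only [wedge, h, sum_apply, Finset.sum_mul, Finset.sum_sub_distrib]

lemma continuousOn_wedge (hY : IsKillingField Y) (hX : IsBryantImmersion X)
    (hg : ContMDiff 𝓘(ℝ, ℂ) 𝓘(ℝ) ∞ g) (he : e ∈ IsManifold.maximalAtlas 𝓘(ℂ) ω M) :
    ContinuousOn (wedge Y X g e) e.target := by
  have h1 := (contDiffOn_comp_symm hg he).continuousOn_fderiv_of_isOpen e.open_target (by simp)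
  have h2 := (contDiffOn_chartForm hY hX he).continuousOn
  exact ((h1.clm_apply continuousOn_const).mul (h2.clm_apply continuousOn_const)).sub
    ((h1.clm_apply continuousOn_const).mul (h2.clm_apply continuousOn_const))

/-- A 2-form is pulled back by the Jacobian determinant. It is positive here, so change of variables
needs no choice of orientation. -/
lemma wedge_transition (hX : IsBryantImmersion X) (hg : ContMDiff 𝓘(ℝ, ℂ) 𝓘(ℝ) ∞ g)
    (he : e ∈ IsManifold.maximalAtlas 𝓘(ℂ) ω M) (he' : e' ∈ IsManifold.maximalAtlas 𝓘(ℂ) ω M)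
    {z : ℂ} (hz : z ∈ (e.symm ≫ₕ e').source) :
    wedge Y X g e z
      = ‖deriv (fun z => e' (e.symm z)) z‖ ^ 2 * wedge Y X g e' (e' (e.symm z)) := by
  simp only [wedge, chartForm_transition hX he he' hz, fderiv_comp_symm hg he he' hz]
  set c := deriv (fun z => e' (e.symm z)) z
  have h1 : c * 1 = c.re • (1 : ℂ) + c.im • Complex.I := by apply Complex.ext <;> simp
  have h2 : c * Complex.I = (-c.im) • (1 : ℂ) + c.re • Complex.I := by
    apply Complex.ext <;> simp
  rw [h1, h2, ← Complex.normSq_eq_norm_sq, Complex.normSq_apply]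
  simp only [map_add, map_smul, smul_eq_mul]
  ring

/-- Change of charts in the integral of `ρ dg ∧ θ`. -/
lemma integral_wedge_transition (hX : IsBryantImmersion X) (hg : ContMDiff 𝓘(ℝ, ℂ) 𝓘(ℝ) ∞ g)
    (he : e ∈ IsManifold.maximalAtlas 𝓘(ℂ) ω M) (he' : e' ∈ IsManifold.maximalAtlas 𝓘(ℂ) ω M)
    (ρ : M → ℝ)
    (h1 : ∀ z ∈ e.target, e.symm z ∉ e'.source → ρ (e.symm z) * wedge Y X g e z = 0)
    (h2 : ∀ z ∈ e'.target, e'.symm z ∉ e.source → ρ (e'.symm z) * wedge Y X g e' z = 0) :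
    ∫ z in e.target, ρ (e.symm z) * wedge Y X g e z
      = ∫ z in e'.target, ρ (e'.symm z) * wedge Y X g e' z := by
  -- Both integrands vanish off the overlap of the charts, so both integrals can be taken over the
  -- source and the target of the transition map.
  set τ := e.symm ≫ₕ e' with hτ
  have hs : τ.source = e.target ∩ e.symm ⁻¹' e'.source := OpenPartialHomeomorph.trans_source _ _
  have ht : τ.target = e'.target ∩ e'.symm ⁻¹' e.source := OpenPartialHomeomorph.trans_target _ _
  have a1 : ∫ z in τ.source, ρ (e.symm z) * wedge Y X g e z
      = ∫ z in e.target, ρ (e.symm z) * wedge Y X g e z :=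
    Eq.symm <| MeasureTheory.setIntegral_eq_of_subset_of_forall_sdiff_eq_zero e.open_target.measurableSet
      (by rw [hs]; exact Set.inter_subset_left) fun z hz => h1 z hz.1 fun h => hz.2 (by
        rw [hs]; exact ⟨hz.1, h⟩)
  have a2 : ∫ z in τ.target, ρ (e'.symm z) * wedge Y X g e' z
      = ∫ z in e'.target, ρ (e'.symm z) * wedge Y X g e' z :=
    Eq.symm <| MeasureTheory.setIntegral_eq_of_subset_of_forall_sdiff_eq_zero e'.open_target.measurableSet
      (by rw [ht]; exact Set.inter_subset_left) fun z hz => h2 z hz.1 fun h => hz.2 (by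
        rw [ht]; exact ⟨hz.1, h⟩)
  rw [← a1, ← a2, MeasureTheory.integral_target_eq_integral_abs_det_fderiv_smul
    MeasureTheory.volume (f := τ) fun z hz => hasFDerivAt_transition he he' hz]
  refine MeasureTheory.setIntegral_congr_fun τ.open_source.measurableSet fun z hz => ?_
  have hz' : e.symm z ∈ e'.source := by rw [hs] at hz; exact hz.2
  have hτz : τ z = e' (e.symm z) := rfl
  simp only [hτz, e'.left_inv hz', det_mul_complex, wedge_transition hX hg he he' hz, smul_eq_mul]
  rw [abs_of_nonneg (by positivity)]
  ring

/-- Green's formula for a function with compact support in a chart. -/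
lemma integral_wedge_eq_zero [T2Space M] (hY : IsKillingField Y) (hX : IsBryantImmersion X)
    (hg : ContMDiff 𝓘(ℝ, ℂ) 𝓘(ℝ) ∞ g) (he : e ∈ IsManifold.maximalAtlas 𝓘(ℂ) ω M)
    (hgc : HasCompactSupport g) (hge : tsupport g ⊆ e.source) :
    ∫ z in e.target, wedge Y X g e z = 0 := by
  set G : ℂ → ℝ := fun u => g (e.symm u) with hG
  set θ := chartForm Y X e with hθ
  have hGs : ContDiffOn ℝ ∞ G e.target := contDiffOn_comp_symm hg he
  have hθs : ContDiffOn ℝ ∞ θ e.target := contDiffOn_chartForm hY hX he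
  -- The components of gθ, extended by zero. As θ is closed, dg ∧ θ = d(gθ), a difference of
  -- derivatives of compactly supported functions.
  set φ : ℂ → ℂ → ℝ := fun v => e.target.indicator fun z => G z * θ z v with hφ
  have hK : IsCompact (e '' tsupport g) :=
    hgc.isCompact.image_of_continuousOn (e.continuousOn.mono hge)
  have hKt : e '' tsupport g ⊆ e.target := by
    rintro _ ⟨x, hx, rfl⟩; exact e.map_source (hge hx)
  have hsupp : ∀ v, tsupport (φ v) ⊆ e '' tsupport g := by
    intro v
    refine closure_minimal (fun z hz => ?_) hK.isClosed
    have hz1 : z ∈ e.target := by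
      by_contra h; exact hz (Set.indicator_of_notMem h _)
    have hz2 : g (e.symm z) ≠ 0 := by
      intro h
      apply hz
      simp only [hφ, Set.indicator_of_mem hz1, hG, h, zero_mul]
    exact ⟨_, subset_tsupport _ hz2, e.right_inv hz1⟩
  have hloc : ∀ v, ∀ z ∈ e.target, φ v =ᶠ[𝓝 z] fun z => G z * θ z v := fun v z hz => by
    filter_upwards [e.open_target.mem_nhds hz] with u hu
    simp only [hφ, Set.indicator_of_mem hu]
  have hφc : ∀ v, HasCompactSupport (φ v) := fun v =>
    hK.of_isClosed_subset (isClosed_tsupport _) (hsupp v)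
  have hφs : ∀ v, ContDiff ℝ 1 (φ v) := by
    intro v
    refine contDiff_of_tsupport fun z hz => ?_
    have hz' := hKt (hsupp v hz)
    have hn := e.open_target.mem_nhds hz'
    refine ContDiffAt.congr_of_eventuallyEq ?_ (hloc v z hz')
    exact (((hGs z hz').contDiffAt hn).mul
      (((hθs z hz').contDiffAt hn).clm_apply contDiffAt_const)).of_le (by simp)
  have hd : ∀ z ∈ e.target, ∀ v w, fderiv ℝ (φ v) z w
      = fderiv ℝ G z w * θ z v + G z * fderiv ℝ θ z w v := by
    intro z hz v w
    have hn := e.open_target.mem_nhds hz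
    have h1 := (hGs.differentiableOn (by simp)).differentiableAt hn |>.hasFDerivAt
    have h2 := ((hθs.differentiableOn (by simp)).differentiableAt hn |>.hasFDerivAt).clm_apply
      (hasFDerivAt_const v z)
    have h3 : HasFDerivAt (fun z => G z * θ z v) _ z := h1.mul h2
    rw [(hloc v z hz).fderiv_eq, h3.fderiv]
    simp
    ring
  have hint : ∀ v w, MeasureTheory.Integrable (fun z => fderiv ℝ (φ v) z w) := fun v w =>
    (((hφs v).continuous_fderiv one_ne_zero).clm_apply
      continuous_const).integrable_of_hasCompactSupport ((hφc v).fderiv_apply ℝ w)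
  have h0 : ∫ z, (fderiv ℝ (φ Complex.I) z 1 - fderiv ℝ (φ 1) z Complex.I) = 0 := by
    rw [MeasureTheory.integral_sub (hint _ _) (hint _ _), integral_fderiv_eq_zero (hφs _) (hφc _),
      integral_fderiv_eq_zero (hφs _) (hφc _), sub_zero]
  have hEq : Set.EqOn (wedge Y X g e)
      (fun z => fderiv ℝ (φ Complex.I) z 1 - fderiv ℝ (φ 1) z Complex.I) e.target := by
    intro z hz
    simp only [hd z hz, wedge]
    have := chartForm_closed hY hX he hz 1 Complex.I
    rw [← hθ] at this ⊢
    rw [← hG, this]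
    ring
  have hoff : ∀ z, z ∉ e.target →
      fderiv ℝ (φ Complex.I) z 1 - fderiv ℝ (φ 1) z Complex.I = 0 := by
    intro z hz
    have : ∀ v, fderiv ℝ (φ v) z = 0 := fun v =>
      image_eq_zero_of_notMem_tsupport fun h =>
        hz (hKt (hsupp v (tsupport_fderiv_subset ℝ h)))
    simp [this]
  rw [MeasureTheory.setIntegral_congr_fun e.open_target.measurableSet hEq,
    MeasureTheory.setIntegral_eq_integral_of_forall_compl_eq_zero hoff, h0]

end Wedge

/-! ### The global residue formula -/

section Global

/-- The function `g` is locally constant off the set `C`. -/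
def LocallyConstOff {M : Type*} [TopologicalSpace M] (g : M → ℝ) (C : Set M) : Prop := ∀ x ∉ C, ∀ᶠ y in 𝓝 x, g y = g x

lemma wedge_eq_zero_of_locallyConstOff {M : Type*} [TopologicalSpace M] {Y : ℂ × ℝ → ℂ × ℝ}
    {X : M → ℂ × ℝ} {g : M → ℝ} {C : Set M} (hC : LocallyConstOff g C) {e : OpenPartialHomeomorph M ℂ}
    {z : ℂ} (hz : z ∈ e.target) (h : e.symm z ∉ C) : wedge Y X g e z = 0 :=
  wedge_eq_zero hz (hC _ h)

variable {M : Type*} [TopologicalSpace M] [ChartedSpace ℂ M] [IsManifold 𝓘(ℂ) ω M] [T2Space M]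
  {Y : ℂ × ℝ → ℂ × ℝ} {X : M → ℂ × ℝ}

/-- A finite family of charts with a partition of unity on `S`. -/
structure ChartPartition (S : Set M) (ι : Type*) [Fintype ι] where
  chart : ι → OpenPartialHomeomorph M ℂ
  mem : ∀ i, chart i ∈ IsManifold.maximalAtlas 𝓘(ℂ) ω M
  fn : ι → M → ℝ
  smooth : ∀ i, ContMDiff 𝓘(ℝ, ℂ) 𝓘(ℝ) ∞ (fn i)
  tsupport_subset : ∀ i, tsupport (fn i) ⊆ (chart i).source
  sum_eq_one : ∀ x ∈ S, ∑ i, fn i x = 1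

lemma exists_chartPartition [SigmaCompactSpace M] {S : Set M} (hS : IsCompact S) :
    ∃ (t : Finset M), Nonempty (ChartPartition S t) := by
  have := isManifold_real (M := M)
  obtain ⟨t, ht⟩ := hS.elim_finite_subcover (fun x : M => (chartAt ℂ x).source)
    (fun x => (chartAt ℂ x).open_source) fun x _ => Set.mem_iUnion.2 ⟨x, mem_chart_source ℂ x⟩
  obtain ⟨χ, hχ⟩ := SmoothPartitionOfUnity.exists_isSubordinate 𝓘(ℝ, ℂ) hS.isClosed
    (fun x : t => (chartAt ℂ (x : M)).source) (fun x => (chartAt ℂ (x : M)).open_source)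
    (by simpa [Set.iUnion_subtype] using ht)
  refine ⟨t, ⟨⟨fun x => chartAt ℂ (x : M), fun x => IsManifold.chart_mem_maximalAtlas _,
    fun x => χ x, fun x => (χ x).contMDiff, hχ, fun x hx => ?_⟩⟩⟩
  rw [← finsum_eq_sum_of_fintype]
  exact χ.sum_eq_one hx

variable {S : Set M} {ι : Type*} [Fintype ι] {g : M → ℝ} {C : Set M}

/-- The integral of `dg ∧ θ` over the surface. -/
def ChartPartition.integral (P : ChartPartition S ι) (Y : ℂ × ℝ → ℂ × ℝ) (X : M → ℂ × ℝ)
    (g : M → ℝ) : ℝ :=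
  ∑ k, ∫ z in (P.chart k).target, P.fn k ((P.chart k).symm z) * wedge Y X g (P.chart k) z

/-- The integrand is continuous and vanishes off C ∩ `tsupport ρ`, a compact subset of the chart
domain. -/
lemma integrableOn_mul_wedge (hY : IsKillingField Y) (hX : IsBryantImmersion X)
    (hg : ContMDiff 𝓘(ℝ, ℂ) 𝓘(ℝ) ∞ g) (hC : LocallyConstOff g C) (hCc : IsCompact C)
    {ρ : M → ℝ} (hρ : ContMDiff 𝓘(ℝ, ℂ) 𝓘(ℝ) ∞ ρ) {e : OpenPartialHomeomorph M ℂ}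
    (he : e ∈ IsManifold.maximalAtlas 𝓘(ℂ) ω M) (hsub : C ∩ tsupport ρ ⊆ e.source) :
    MeasureTheory.IntegrableOn (fun z => ρ (e.symm z) * wedge Y X g e z) e.target := by
  refine integrableOn_target_of_compact
    ((contDiffOn_comp_symm hρ he).continuousOn.mul (continuousOn_wedge hY hX hg he))
    (hCc.inter_right (isClosed_tsupport ρ)) hsub fun z hz h => ?_
  by_cases h1 : e.symm z ∈ C
  · have : ρ (e.symm z) = 0 := image_eq_zero_of_notMem_tsupport fun h2 => h ⟨h1, h2⟩
    rw [this, zero_mul]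
  · rw [wedge_eq_zero_of_locallyConstOff hC hz h1, mul_zero]

/-- Each summand is moved to the chart e. There dg ∧ θ lives over C, where the functions of the
partition add up to one. In particular the integral does not depend on the partition. -/
lemma ChartPartition.integral_eq_of_subset (P : ChartPartition S ι) (hY : IsKillingField Y)
    (hX : IsBryantImmersion X) (hg : ContMDiff 𝓘(ℝ, ℂ) 𝓘(ℝ) ∞ g) (hC : LocallyConstOff g C)
    (hCc : IsCompact C) (hCS : C ⊆ S) {e : OpenPartialHomeomorph M ℂ}
    (he : e ∈ IsManifold.maximalAtlas 𝓘(ℂ) ω M) (hCe : C ⊆ e.source) :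
    P.integral Y X g = ∫ z in e.target, wedge Y X g e z := by
  have h1 : ∀ k, ∫ z in (P.chart k).target, P.fn k ((P.chart k).symm z) * wedge Y X g (P.chart k) z
      = ∫ z in e.target, P.fn k (e.symm z) * wedge Y X g e z := by
    intro k
    refine integral_wedge_transition hX hg (P.mem k) he (P.fn k) (fun z hz h => ?_)
      (fun z hz h => ?_)
    · rw [wedge_eq_zero_of_locallyConstOff hC hz fun h' => h (hCe h'), mul_zero]
    · rw [image_eq_zero_of_notMem_tsupport fun h' => h (P.tsupport_subset k h'), zero_mul]
  have hi : ∀ k, MeasureTheory.IntegrableOn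
      (fun z => P.fn k (e.symm z) * wedge Y X g e z) e.target := fun k =>
    integrableOn_mul_wedge hY hX hg hC hCc (P.smooth k) he (Set.inter_subset_left.trans hCe)
  simp only [ChartPartition.integral, h1]
  rw [← MeasureTheory.integral_finsetSum _ fun k _ => hi k]
  refine MeasureTheory.setIntegral_congr_fun e.open_target.measurableSet fun z hz => ?_
  by_cases h : e.symm z ∈ C
  · simp only [← Finset.sum_mul, P.sum_eq_one _ (hCS h), one_mul]
  · simp only [wedge_eq_zero_of_locallyConstOff hC hz h, mul_zero, Finset.sum_const_zero]

lemma ChartPartition.integral_sum (P : ChartPartition S ι) (hY : IsKillingField Y)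
    (hX : IsBryantImmersion X) {κ : Type*} {s : Finset κ} {g : κ → M → ℝ} {C : κ → Set M}
    (hg : ∀ i ∈ s, ContMDiff 𝓘(ℝ, ℂ) 𝓘(ℝ) ∞ (g i)) (hC : ∀ i ∈ s, LocallyConstOff (g i) (C i))
    (hCc : ∀ i ∈ s, IsCompact (C i)) :
    P.integral Y X (fun x => ∑ i ∈ s, g i x) = ∑ i ∈ s, P.integral Y X (g i) := by
  simp only [ChartPartition.integral]
  rw [Finset.sum_comm]
  refine Finset.sum_congr rfl fun k _ => ?_
  rw [← MeasureTheory.integral_finsetSum _ fun i hi => integrableOn_mul_wedge hY hX (hg i hi)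
    (hC i hi) (hCc i hi) (P.smooth k) (P.mem k) (Set.inter_subset_right.trans (P.tsupport_subset k))]
  refine MeasureTheory.setIntegral_congr_fun (P.chart k).open_target.measurableSet fun z hz => ?_
  simp only [wedge_sum hg (P.mem k) hz, Finset.mul_sum]

lemma locallyConstOff_tsupport (g : M → ℝ) : LocallyConstOff g (tsupport g) := fun x hx => by
  have h := notMem_tsupport_iff_eventuallyEq.1 hx
  filter_upwards [h] with y hy
  rw [hy, h.self_of_nhds]; rfl

/-- Stokes' theorem for functions with compact support. -/
lemma ChartPartition.integral_eq_zero (P : ChartPartition S ι) (hY : IsKillingField Y)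
    (hX : IsBryantImmersion X) (hg : ContMDiff 𝓘(ℝ, ℂ) 𝓘(ℝ) ∞ g) (hgc : HasCompactSupport g)
    (hgS : tsupport g ⊆ S) : P.integral Y X g = 0 := by
  have hsm : ∀ i, ContMDiff 𝓘(ℝ, ℂ) 𝓘(ℝ) ∞ (fun x => P.fn i x * g x) := fun i =>
    (P.smooth i).mul hg
  have hts : ∀ i, tsupport (fun x => P.fn i x * g x) ⊆ tsupport g := fun i =>
    closure_mono (Function.support_mul_subset_right _ _)
  have hts' : ∀ i, tsupport (fun x => P.fn i x * g x) ⊆ tsupport (P.fn i) := fun i =>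
    closure_mono (Function.support_mul_subset_left _ _)
  have hcs : ∀ i, HasCompactSupport (fun x => P.fn i x * g x) := fun i =>
    hgc.isCompact.of_isClosed_subset (isClosed_tsupport _) (hts i)
  -- The partition of unity splits g into functions with compact support in a single chart, to which
  -- Green's formula applies.
  have hsum : g = fun x => ∑ i, P.fn i x * g x := by
    funext x
    by_cases h : x ∈ tsupport g
    · rw [← Finset.sum_mul, P.sum_eq_one _ (hgS h), one_mul]
    · simp [image_eq_zero_of_notMem_tsupport h]
  rw [hsum, P.integral_sum hY hX (fun i _ => hsm i)
    (fun i _ => locallyConstOff_tsupport _) fun i _ => (hcs i).isCompact]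
  refine Finset.sum_eq_zero fun i _ => ?_
  have hsub := (hts' i).trans (P.tsupport_subset i)
  rw [P.integral_eq_of_subset hY hX (hsm i) (locallyConstOff_tsupport _) (hcs i).isCompact
    ((hts i).trans hgS) (P.mem i) hsub]
  exact integral_wedge_eq_zero hY hX (hsm i) (P.mem i) (hcs i) hsub

end Global

/-! ### Radial cutoffs and the integral of their differential against a closed form -/

section Ends

variable {M : Type*} [TopologicalSpace M] [ChartedSpace ℂ M]

/-- A smooth function which is `-1` for `t ≤ a` and `0` for `b ≤ t`. -/
def cutoff (a b t : ℝ) : ℝ := Real.smoothTransition ((t - a) / (b - a)) - 1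

lemma contDiff_cutoff (a b : ℝ) : ContDiff ℝ ∞ (cutoff a b) := by
  unfold cutoff
  exact (Real.smoothTransition.contDiff.comp ((contDiff_id.sub contDiff_const).div_const _)).sub
    contDiff_const

lemma cutoff_of_le {a b t : ℝ} (hab : a < b) (h : t ≤ a) : cutoff a b t = -1 := by
  rw [cutoff, Real.smoothTransition.zero_of_nonpos]
  · ring
  · exact div_nonpos_of_nonpos_of_nonneg (by linarith) (by linarith)

lemma cutoff_of_ge {a b t : ℝ} (hab : a < b) (h : b ≤ t) : cutoff a b t = 0 := by
  rw [cutoff, Real.smoothTransition.one_of_one_le]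
  · ring
  · rw [le_div_iff₀ (by linarith)]; linarith

/-- The integral of `d(h(|z|)) ∧ θ` over an annulus, for a closed form `θ`. -/
lemma integral_radial {θ : ℂ → ℂ →L[ℝ] ℝ} {r a b c : ℝ} (hr : 0 ≤ r) (ha : r < a) (hab : a < b)
    (hb : b < 1) (hθ : ContinuousOn θ (annulus r 1))
    (hc : ∀ ρ, r < ρ → ρ < 1 →
      ∫ t in (-Real.pi)..Real.pi, θ (polarMap (ρ, t)) (Complex.I * polarMap (ρ, t)) = c) :
    ∫ z in annulus r 1, (fderiv ℝ (fun u : ℂ => cutoff a b ‖u‖) z 1 * θ z Complex.I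
      - fderiv ℝ (fun u : ℂ => cutoff a b ‖u‖) z Complex.I * θ z 1) = c := by
  set η := cutoff a b with hη
  have hηd : ∀ t, HasDerivAt η (deriv η t) t := fun t =>
    ((contDiff_cutoff a b).differentiable (by simp) t).hasDerivAt
  have hηc : Continuous (deriv η) := (contDiff_cutoff a b).continuous_deriv (by simp)
  -- Intermediate radii give a closed annulus on which θ is continuous and outside which the
  -- differential of the cutoff vanishes, although θ need not be bounded on the whole annulus.
  obtain ⟨a', ha1, ha2⟩ := exists_between ha
  obtain ⟨b', hb1, hb2⟩ := exists_between hb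
  have hη0 : ∀ t, t ∉ Set.Icc a b → deriv η t = 0 := by
    intro t ht
    rw [Set.mem_Icc, not_and_or, not_le, not_le] at ht
    rcases ht with h | h
    · have : η =ᶠ[𝓝 t] fun _ => -1 := by
        filter_upwards [Iio_mem_nhds h] with s hs using cutoff_of_le hab (le_of_lt hs)
      rw [this.deriv_eq]; simp
    · have : η =ᶠ[𝓝 t] fun _ => 0 := by
        filter_upwards [Ioi_mem_nhds h] with s hs using cutoff_of_ge hab (le_of_lt hs)
      rw [this.deriv_eq]; simp
  have hfd : ∀ z : ℂ, z ≠ 0 → ∀ v, fderiv ℝ (fun u : ℂ => η ‖u‖) z v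
      = deriv η ‖z‖ / ‖z‖ * (z.re * v.re + z.im * v.im) := by
    intro z hz v
    have hz' : 0 < ‖z‖ := norm_pos_iff.2 hz
    have hq : HasFDerivAt (fun u : ℂ => u.re ^ 2 + u.im ^ 2)
        ((2 * z.re) • Complex.reCLM + (2 * z.im) • Complex.imCLM) z := by
      have := (Complex.reCLM.hasFDerivAt (x := z).pow 2).add
        (Complex.imCLM.hasFDerivAt (x := z).pow 2)
      refine (this.congr_of_eventuallyEq (Filter.Eventually.of_forall fun u => rfl)).congr_fderiv ?_
      ext <;> simp
    have hzq : z.re ^ 2 + z.im ^ 2 = ‖z‖ ^ 2 := by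
      rw [← Complex.normSq_eq_norm_sq, Complex.normSq_apply]; ring
    have hnq : (fun u : ℂ => ‖u‖) = fun u => Real.sqrt (u.re ^ 2 + u.im ^ 2) := by
      funext u
      simp only [Complex.norm_def, Complex.normSq_apply, ← pow_two]
    have hn := hq.sqrt (by rw [hzq]; positivity)
    rw [← hnq] at hn
    have hs : Real.sqrt (z.re ^ 2 + z.im ^ 2) = ‖z‖ := by
      rw [hzq, Real.sqrt_sq hz'.le]
    have hcomp := (hηd ‖z‖).comp_hasFDerivAt z hn
    change HasFDerivAt (fun u : ℂ => η ‖u‖) _ z at hcomp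
    rw [hcomp.fderiv]
    simp [hs]
    field_simp
  -- The differential of a radial function is a multiple of d|z|, so only the angular component
  -- θ(iz) survives in the wedge product.
  have hval : ∀ z : ℂ, z ≠ 0 → fderiv ℝ (fun u : ℂ => η ‖u‖) z 1 * θ z Complex.I
      - fderiv ℝ (fun u : ℂ => η ‖u‖) z Complex.I * θ z 1
      = deriv η ‖z‖ / ‖z‖ * θ z (Complex.I * z) := by
    intro z hz
    have e : Complex.I * z = (-z.im) • (1 : ℂ) + z.re • Complex.I := by
      apply Complex.ext <;> simp
    rw [hfd z hz, hfd z hz, e, map_add, map_smul, map_smul]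
    simp
    ring
  have hpos : ∀ z ∈ annulus r 1, z ≠ 0 := fun z hz h => by
    have := hz.1; rw [h, norm_zero] at this; linarith
  have hsub : annulus a' b' ⊆ annulus r 1 := fun z hz =>
    ⟨ha1.trans hz.1, hz.2.trans hb2⟩
  rw [MeasureTheory.setIntegral_congr_fun (isOpen_annulus r 1).measurableSet
    (fun z hz => hval z (hpos z hz)),
    MeasureTheory.setIntegral_eq_of_subset_of_forall_sdiff_eq_zero
      (isOpen_annulus r 1).measurableSet hsub]
  swap
  · intro z hz
    rw [hη0, zero_div, zero_mul]
    intro h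
    exact hz.2 ⟨ha2.trans_le h.1, h.2.trans_lt hb1⟩
  have ha0 : 0 < a' := hr.trans_lt ha1
  have hpi := Real.pi_pos
  change ∫ z in {z : ℂ | a' < ‖z‖ ∧ ‖z‖ < b'}, _ = c
  rw [integral_polar _ ha0.le]
  have hI : ∀ p ∈ Set.Icc (a', -Real.pi) (b', Real.pi),
      p.1 * (deriv η ‖polarMap p‖ / ‖polarMap p‖ * θ (polarMap p) (Complex.I * polarMap p))
      = deriv η p.1 * θ (polarMap p) (Complex.I * polarMap p) := by
    intro p hp
    have : 0 < p.1 := ha0.trans_le hp.1.1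
    rw [norm_polarMap, abs_of_pos this]
    field_simp
  rw [MeasureTheory.setIntegral_congr_fun measurableSet_Icc hI, ← Set.Icc_prod_Icc,
    MeasureTheory.Measure.volume_eq_prod, MeasureTheory.setIntegral_prod]
  -- The integral over the angle is the period c for every radius; the remaining radial integral of
  -- the derivative of the cutoff is 0 - (-1) = 1.
  · have hin : ∀ x ∈ Set.Icc a' b', ∫ y in Set.Icc (-Real.pi) Real.pi,
        deriv η x * θ (polarMap (x, y)) (Complex.I * polarMap (x, y)) = deriv η x * c := by
      intro x hx
      rw [MeasureTheory.integral_const_mul, MeasureTheory.integral_Icc_eq_integral_Ioc,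
        ← intervalIntegral.integral_of_le (by linarith),
        hc x (ha1.trans_le hx.1) (hx.2.trans_lt hb2)]
    rw [MeasureTheory.setIntegral_congr_fun measurableSet_Icc hin,
      MeasureTheory.integral_mul_const, MeasureTheory.integral_Icc_eq_integral_Ioc,
      ← intervalIntegral.integral_of_le (by linarith),
      intervalIntegral.integral_eq_sub_of_hasDerivAt (fun t _ => hηd t)
        (hηc.intervalIntegrable _ _), hη, cutoff_of_le hab ha2.le, cutoff_of_ge hab hb1.le]
    ring
  · rw [Set.Icc_prod_Icc]
    refine ContinuousOn.integrableOn_compact isCompact_Icc ?_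
    have hm : Set.MapsTo polarMap (Set.Icc (a', -Real.pi) (b', Real.pi)) (annulus r 1) := by
      intro p hp
      have : 0 < p.1 := ha0.trans_le hp.1.1
      rw [annulus, Set.mem_ofPred_eq, norm_polarMap, abs_of_pos this]
      exact ⟨ha1.trans_le hp.1.1, hp.2.1.trans_lt hb2⟩
    exact (hηc.comp continuous_fst).continuousOn.mul
      ((hθ.comp continuous_polarMap.continuousOn hm).clm_apply
        (continuous_const.mul continuous_polarMap).continuousOn)

end Ends

/-! ### Cutoffs along the ends and the sum of the periods -/

section EndCutoff

variable {M : Type*} [TopologicalSpace M] [ChartedSpace ℂ M]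

lemma AnnularEnd.isCompact_image (E : AnnularEnd M) {a b : ℝ} (ha : E.radius < a) (hb : b < 1) :
    IsCompact (E.param '' {z | a ≤ ‖z‖ ∧ ‖z‖ ≤ b}) := by
  have h : {z : ℂ | a ≤ ‖z‖ ∧ ‖z‖ ≤ b} = Metric.closedBall 0 b ∩ norm ⁻¹' Set.Ici a := by
    ext z; simp [and_comm]
  refine IsCompact.image_of_continuousOn ?_ (E.holomorphic.continuousOn.mono fun z hz =>
    ⟨ha.trans_le hz.1, hz.2.trans_lt hb⟩)
  rw [h]
  exact (isCompact_closedBall _ _).inter_right (isClosed_Ici.preimage continuous_norm)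

/-- Parameters close to the inner radius leave every compact set. Near a given point of M, only a
compact annulus δ ≤ |z| ≤ b can therefore contribute to the closure. -/
lemma AnnularEnd.isClosed_image [T2Space M] (E : AnnularEnd M) {b : ℝ} (hb : b < 1) :
    IsClosed (E.param '' {z | E.radius < ‖z‖ ∧ ‖z‖ ≤ b}) := by
  have := ChartedSpace.locallyCompactSpace ℂ M
  refine isClosed_of_closure_subset fun x hx => ?_
  obtain ⟨K, hK, hxK⟩ := exists_compact_mem_nhds x
  have h1 := E.escapes hK.compl_mem_cocompact
  rw [Filter.mem_map, Filter.mem_comap] at h1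
  obtain ⟨t, ht, htK⟩ := h1
  obtain ⟨δ, hδ, hδt⟩ := mem_nhdsGT_iff_exists_Ioo_subset.1 ht
  have hsub : interior K ∩ E.param '' {z | E.radius < ‖z‖ ∧ ‖z‖ ≤ b}
      ⊆ E.param '' {z | δ ≤ ‖z‖ ∧ ‖z‖ ≤ b} := by
    rintro _ ⟨hy, z, hz, rfl⟩
    refine ⟨z, ⟨not_lt.1 fun h => ?_, hz.2⟩, rfl⟩
    exact htK (hδt ⟨hz.1, h⟩ : z ∈ norm ⁻¹' t) (interior_subset hy)
  have h2 := closure_mono hsub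
    (isOpen_interior.inter_closure ⟨mem_interior_iff_mem_nhds.2 hxK, hx⟩)
  rw [(E.isCompact_image hδ hb).isClosed.closure_eq] at h2
  refine Set.image_mono ?_ h2
  exact fun z hz => ⟨lt_of_lt_of_le hδ hz.1, hz.2⟩

open Classical in
/-- The function equal to `cutoff a b |z|` in the annular chart `e` and to `0` elsewhere. -/
def endCutoff (e : OpenPartialHomeomorph M ℂ) (a b : ℝ) (x : M) : ℝ :=
  if x ∈ e.source then cutoff a b ‖e x‖ else 0

variable {E : AnnularEnd M} {e : OpenPartialHomeomorph M ℂ} {a b : ℝ}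

lemma endCutoff_of_mem {x : M} (hx : x ∈ e.source) : endCutoff e a b x = cutoff a b ‖e x‖ :=
  if_pos hx

lemma endCutoff_of_notMem {x : M} (hx : x ∉ e.source) : endCutoff e a b x = 0 :=
  if_neg hx

lemma mem_image_param (hs : ⇑e.symm = E.param) {x : M}
    (hx : x ∈ e.source) {A : Set ℂ} (hA : e x ∈ A) : x ∈ E.param '' A :=
  ⟨e x, hA, by rw [← hs, e.left_inv hx]⟩

lemma source_eq_image (ht : e.target = annulus E.radius 1) (hs : ⇑e.symm = E.param) :
    e.source = E.param '' annulus E.radius 1 := by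
  rw [← ht, ← hs, e.symm_image_target_eq_source]

/-- This makes the extension by zero smooth across the frontier of the chart domain: the cutoff is
supported in a set that is closed in M, not merely in the chart. -/
lemma eventually_endCutoff_eq_zero [T2Space M] (ht : e.target = annulus E.radius 1)
    (hs : ⇑e.symm = E.param) (hab : a < b) (hb : b < 1) {x : M} (hx : x ∉ e.source) :
    ∀ᶠ y in 𝓝 x, endCutoff e a b y = 0 := by
  have hx' : x ∈ (E.param '' {z | E.radius < ‖z‖ ∧ ‖z‖ ≤ b})ᶜ := fun h => hx <| by
    rw [source_eq_image ht hs]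
    refine Set.image_mono ?_ h
    exact fun z hz => ⟨hz.1, hz.2.trans_lt hb⟩
  filter_upwards [(E.isClosed_image hb).isOpen_compl.mem_nhds hx'] with y hy
  by_cases h : y ∈ e.source
  · rw [endCutoff_of_mem h]
    refine cutoff_of_ge hab (le_of_lt (not_le.1 fun h' => hy ?_))
    have h2 := e.map_source h
    rw [ht] at h2
    exact mem_image_param hs h ⟨h2.1, h'⟩
  · exact endCutoff_of_notMem h

lemma locallyConstOff_endCutoff [T2Space M] (ht : e.target = annulus E.radius 1)
    (hs : ⇑e.symm = E.param) (hab : a < b) (hb : b < 1) :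
    LocallyConstOff (endCutoff e a b) (E.param '' {z | a ≤ ‖z‖ ∧ ‖z‖ ≤ b}) := by
  intro x hx
  by_cases h : x ∈ e.source
  · have hc : Filter.Tendsto (fun y => ‖e y‖) (𝓝 x) (𝓝 ‖e x‖) :=
      (e.continuousAt h).norm
    rcases lt_or_ge ‖e x‖ a with h1 | h1
    · filter_upwards [e.open_source.mem_nhds h, hc.eventually (Iio_mem_nhds h1)] with y hy hy1
      rw [endCutoff_of_mem h, endCutoff_of_mem hy, cutoff_of_le hab h1.le,
        cutoff_of_le hab (le_of_lt hy1)]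
    · have h2 : b < ‖e x‖ := not_le.1 fun h2 => hx (mem_image_param hs h ⟨h1, h2⟩)
      filter_upwards [e.open_source.mem_nhds h, hc.eventually (Ioi_mem_nhds h2)] with y hy hy1
      rw [endCutoff_of_mem h, endCutoff_of_mem hy, cutoff_of_ge hab h2.le,
        cutoff_of_ge hab (le_of_lt hy1)]
  · rw [endCutoff_of_notMem h]
    exact eventually_endCutoff_eq_zero ht hs hab hb h

lemma contMDiff_endCutoff [T2Space M] [IsManifold 𝓘(ℂ) ω M]
    (he : e ∈ IsManifold.maximalAtlas 𝓘(ℂ) ω M) (ht : e.target = annulus E.radius 1)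
    (hs : ⇑e.symm = E.param) (hab : a < b) (hb : b < 1) :
    ContMDiff 𝓘(ℝ, ℂ) 𝓘(ℝ) ∞ (endCutoff e a b) := by
  have := isManifold_real (M := M)
  intro x
  by_cases h : x ∈ e.source
  · have h0 : e x ≠ 0 := by
      have h2 := e.map_source h
      rw [ht] at h2
      exact norm_pos_iff.1 (E.radius_nonneg.trans_lt h2.1)
    have h1 : ContMDiffAt 𝓘(ℝ, ℂ) 𝓘(ℝ, ℂ) ∞ e x :=
      contMDiffAt_of_mem_maximalAtlas (mem_maximalAtlas_real he) h
    have h3 : ContDiffAt ℝ ∞ (fun u : ℂ => cutoff a b ‖u‖) (e x) :=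
      (contDiff_cutoff a b).contDiffAt.comp _ (contDiffAt_norm ℝ h0)
    refine (h3.contMDiffAt.comp x h1).congr_of_eventuallyEq ?_
    filter_upwards [e.open_source.mem_nhds h] with y hy
    rw [endCutoff_of_mem hy]; rfl
  · exact (contMDiffAt_const (c := (0 : ℝ))).congr_of_eventuallyEq
      (eventually_endCutoff_eq_zero ht hs hab hb h)

/-- The sign comes from orientation: polar circles run opposite to the end loops that define c. -/
lemma integral_wedge_endCutoff [IsManifold 𝓘(ℂ) ω M] {Y : ℂ × ℝ → ℂ × ℝ} {X : M → ℂ × ℝ}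
    (hY : IsKillingField Y) (hX : IsBryantImmersion X)
    (he : e ∈ IsManifold.maximalAtlas 𝓘(ℂ) ω M) (ht : e.target = annulus E.radius 1)
    (ha : E.radius < a) (hab : a < b) (hb : b < 1) {c : ℝ}
    (hc : ∀ Γ : ℝ → ℂ, IsEndLoop E.radius Γ →
      ∫ t in (0 : ℝ)..(2 * Real.pi), chartForm Y X e (Γ t) (deriv Γ t) = c) :
    ∫ z in e.target, wedge Y X (endCutoff e a b) e z = -c := by
  rw [← integral_radial (θ := chartForm Y X e) E.radius_nonneg ha hab hb
    (by rw [← ht]; exact (contDiffOn_chartForm hY hX he).continuousOn) (c := -c), ← ht]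
  · refine MeasureTheory.setIntegral_congr_fun e.open_target.measurableSet fun z hz => ?_
    have h : (fun u => endCutoff e a b (e.symm u)) =ᶠ[𝓝 z] fun u => cutoff a b ‖u‖ := by
      filter_upwards [e.open_target.mem_nhds hz] with u hu
      rw [endCutoff_of_mem (e.map_target hu), e.right_inv hu]
    simp only [wedge, h.fderiv_eq]
  · intro ρ h1 h2
    rw [integral_circle_eq_neg, hc _ (isEndLoop_circleLoop E.radius_nonneg h1 h2)]

lemma isSigmaCompact_annulus (r s : ℝ) : IsSigmaCompact (annulus r s) := by
  have : LocallyCompactSpace (annulus r s) := (isOpen_annulus r s).locallyCompactSpace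
  exact isSigmaCompact_iff_sigmaCompactSpace.2 inferInstance

/-- The surface is the union of a compact core and finitely many images of annuli; countability at
infinity, needed for partitions of unity, follows. -/
lemma sigmaCompactSpace_of_ends {n : ℕ} {E : Fin n → AnnularEnd M} {s : ℝ} (hs : s < 1)
    (hc : IsCompact (⋃ j, (E j).param '' annulus (E j).radius s)ᶜ) : SigmaCompactSpace M := by
  rw [← isSigmaCompact_univ_iff, ← Set.compl_union_self (⋃ j, (E j).param '' annulus (E j).radius s)]
  rw [Set.union_eq_iUnion]
  refine isSigmaCompact_iUnion _ fun i => ?_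
  cases i
  · exact isSigmaCompact_iUnion _ fun j => (isSigmaCompact_annulus _ _).image_of_continuousOn
      ((E j).holomorphic.continuousOn.mono fun z hz => ⟨hz.1, hz.2.trans hs⟩)
  · exact hc.isSigmaCompact

/-- The residue formula: the periods of a flux form around the ends add up to zero. -/
theorem sum_periods_eq_zero [T2Space M] [IsManifold 𝓘(ℂ) ω M] {n : ℕ} {Y : ℂ × ℝ → ℂ × ℝ}
    {X : M → ℂ × ℝ} {E : Fin n → AnnularEnd M} (hY : IsKillingField Y)
    (hX : IsCatenoidalSurface X E) {c : Fin n → ℝ}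
    (hc : ∀ j, ∀ Γ : ℝ → ℂ, IsEndLoop (E j).radius Γ →
      ∫ t in (0 : ℝ)..(2 * Real.pi), fluxForm Y ((E j).map X) (Γ t) (deriv Γ t) = c j) :
    ∑ j, c j = 0 := by
  obtain ⟨s, hs1, hrs, hcore⟩ := hX.compact_core
  have := sigmaCompactSpace_of_ends hs1 hcore
  choose e he ht hs using fun j => (E j).exists_chart
  choose a ha hab using fun j => exists_between (hrs j)
  set C : Fin n → Set M := fun j => (E j).param '' {z | a j ≤ ‖z‖ ∧ ‖z‖ ≤ s} with hC
  have hCc : ∀ j, IsCompact (C j) := fun j => (E j).isCompact_image (ha j) hs1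
  -- A compact set that contains the core and the annuli on which the cutoffs vary.
  set S : Set M := (⋃ j, (E j).param '' annulus (E j).radius s)ᶜ ∪ ⋃ j, C j with hS
  have hSc : IsCompact S := hcore.union (isCompact_iUnion hCc)
  obtain ⟨t, ⟨P⟩⟩ := exists_chartPartition hSc
  -- The index `none` carries the constant 1 and `some j` the cutoff of the end j, so that the sum
  -- of the family is the compactly supported test function.
  set g : Option (Fin n) → M → ℝ := fun o => o.elim (fun _ => 1) fun j => endCutoff (e j) (a j) s
    with hg
  set D : Option (Fin n) → Set M := fun o => o.elim ∅ C with hD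
  have hgs : ∀ o, ContMDiff 𝓘(ℝ, ℂ) 𝓘(ℝ) ∞ (g o) := by
    rintro (_ | j)
    · exact contMDiff_const
    · exact contMDiff_endCutoff (he j) (ht j) (hs j) (hab j) hs1
  have hgD : ∀ o, LocallyConstOff (g o) (D o) := by
    rintro (_ | j)
    · exact fun x _ => Filter.Eventually.of_forall fun y => rfl
    · exact locallyConstOff_endCutoff (ht j) (hs j) (hab j) hs1
  have hDc : ∀ o, IsCompact (D o) := by
    rintro (_ | j)
    · exact isCompact_empty
    · exact hCc j
  have hDS : ∀ o, D o ⊆ S := by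
    rintro (_ | j)
    · exact Set.empty_subset _
    · exact (Set.subset_iUnion C j).trans Set.subset_union_right
  have hsum := P.integral_sum hY hX.bryant (s := Finset.univ) (fun o _ => hgs o)
    (fun o _ => hgD o) fun o _ => hDc o
  -- Deep in an end, its cutoff is -1 and cancels the constant 1; by disjointness of the ends, the
  -- other cutoffs vanish.
  have hzero : ∀ x ∉ S, ∑ o, g o x = 0 := by
    intro x hx
    rw [hS, Set.mem_union, not_or, Set.notMem_compl_iff, Set.mem_iUnion, Set.mem_iUnion,
      not_exists] at hx
    obtain ⟨⟨j, z, hz, rfl⟩, hx2⟩ := hx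
    have hza : ‖z‖ < a j := not_le.1 fun h => hx2 j ⟨z, ⟨h, hz.2.le⟩, rfl⟩
    have hzt : z ∈ annulus (E j).radius 1 := ⟨hz.1, hz.2.trans hs1⟩
    rw [Fintype.sum_option, Finset.sum_eq_single j]
    · have h1 : (E j).param z ∈ (e j).source := by
        rw [source_eq_image (ht j) (hs j)]
        exact Set.mem_image_of_mem _ hzt
      have h2 : e j ((E j).param z) = z := by
        rw [← hs j, (e j).right_inv (by rw [ht j]; exact hzt)]
      change 1 + endCutoff (e j) (a j) s _ = 0
      rw [endCutoff_of_mem h1, h2, cutoff_of_le (hab j) hza.le]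
      norm_num
    · intro i _ hij
      refine endCutoff_of_notMem fun h => ?_
      rw [source_eq_image (ht i) (hs i)] at h
      exact Set.disjoint_left.1 (hX.disjoint hij) h (Set.mem_image_of_mem _ hzt)
    · exact fun h => absurd (Finset.mem_univ _) h
  have hsupp : tsupport (fun x => ∑ o, g o x) ⊆ S :=
    closure_minimal (fun x hx => by_contra fun h => hx (hzero x h)) hSc.isClosed
  rw [P.integral_eq_zero hY hX.bryant (contMDiff_finsetSum fun o _ => hgs o)
    (hSc.of_isClosed_subset (isClosed_tsupport _) hsupp) hsupp, Fintype.sum_option] at hsum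
  -- The differential of the constant 1 is zero, so the vanishing of the total leaves only the
  -- contributions of the ends.
  have h0 : P.integral Y X (g none) = 0 := by
    refine Finset.sum_eq_zero fun k _ => ?_
    rw [MeasureTheory.setIntegral_congr_fun (g := fun _ => (0 : ℝ))
      (P.chart k).open_target.measurableSet fun z hz => ?_, MeasureTheory.integral_zero]
    simp only [wedge_eq_zero_of_locallyConstOff (hgD none) hz (Set.notMem_empty _), mul_zero]
  have h1 : ∀ j, P.integral Y X (g (some j)) = -c j := by
    intro j
    have hCe : C j ⊆ (e j).source := by
      rw [source_eq_image (ht j) (hs j)]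
      exact Set.image_mono fun z hz => ⟨(ha j).trans_le hz.1, hz.2.trans_lt hs1⟩
    rw [P.integral_eq_of_subset hY hX.bryant (hgs (some j)) (hgD (some j)) (hDc (some j))
      (hDS (some j)) (he j) hCe]
    refine integral_wedge_endCutoff hY hX.bryant (he j) (ht j) (ha j) (hab j) hs1 ?_
    have := hc j
    rwa [show (E j).map X = fun z => X ((e j).symm z) by rw [hs j]; rfl] at this
  simp only [h0, h1, zero_add, Finset.sum_neg_distrib] at hsum
  linarith

end EndCutoff

/-! ### The flux of an end as the period of the flux form -/

section Flux

variable {M : Type*} [TopologicalSpace M] [ChartedSpace ℂ M] [IsManifold 𝓘(ℂ) ω M]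
  {X : M → ℂ × ℝ} {Y : ℂ × ℝ → ℂ × ℝ}

lemma AnnularEnd.contDiffOn_map (E : AnnularEnd M) (hX : IsBryantImmersion X) :
    ContDiffOn ℝ ∞ (E.map X) (annulus E.radius 1) := by
  obtain ⟨e, he, ht, hs⟩ := E.exists_chart
  have := contDiffOn_comp_symm hX.smooth he
  rwa [ht, hs] at this

/-- The flux form has the same integral along all generators of the end. -/
lemma AnnularEnd.exists_flux (E : AnnularEnd M) (hX : IsBryantImmersion X)
    (hY : IsKillingField Y) :
    ∃ c : ℝ, (∀ Γ : ℝ → ℂ, IsEndLoop E.radius Γ →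
      ∫ t in (0 : ℝ)..(2 * Real.pi), fluxForm Y (E.map X) (Γ t) (deriv Γ t) = c) ∧
      ∀ φ, HasFlux X E Y φ ↔ φ = c := by
  obtain ⟨e, he, ht, hs⟩ := E.exists_chart
  have hmap : E.map X = fun z => X (e.symm z) := by rw [hs]; rfl
  have h1 := contDiffOn_chartForm hY hX he
  have h2 : ∀ z ∈ annulus E.radius 1, ∀ v w, fderiv ℝ (chartForm Y X e) z v w
      = fderiv ℝ (chartForm Y X e) z w v := fun z hz => chartForm_closed hY hX he (ht ▸ hz)
  rw [ht] at h1
  obtain ⟨c, hc⟩ := exists_period (h1.of_le (by simp)) h2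
  rw [chartForm, ← hmap] at hc
  have hflux : ∀ Γ K, IsEndLoop E.radius Γ → IsSpanningDisc (E.map X) Γ K →
      fluxValue (E.map X) Γ K Y = c := fun Γ K hΓ hK => by
    rw [fluxValue_eq hY hΓ hK (E.contDiffOn_map hX) (fun z _ => hX.mem_halfSpace _), hc Γ hΓ]
    intro z hz
    rw [hmap]
    exact hX.conformal e he z (ht ▸ hz)
  refine ⟨c, hc, fun φ => ⟨?_, ?_⟩⟩
  · rintro ⟨Γ, K, hΓ, hK, rfl⟩
    exact hflux Γ K hΓ hK
  · rintro rfl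
    obtain ⟨Γ, K, hΓ, hK⟩ := exists_isSpanningDisc E.radius_nonneg E.radius_lt_one
      (E.contDiffOn_map hX) fun z => hX.mem_halfSpace _
    exact ⟨Γ, K, hΓ, hK, (hflux Γ K hΓ hK).symm⟩

end Flux

/-! ### The Killing fields of translations and rotations -/

section QuadraticField

/-- The Killing field of hyperbolic space that extends the holomorphic vector field
`A ζ² + B ζ + C` of the asymptotic boundary. -/
def quadraticField (A B C : ℂ) (p : ℂ × ℝ) : ℂ × ℝ :=
  (A * p.1 ^ 2 + B * p.1 + C - ((p.2 ^ 2 : ℝ) : ℂ) * starRingEnd ℂ A,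
    p.2 * (2 * A * p.1 + B).re)

lemma contDiff_quadraticField (A B C : ℂ) : ContDiff ℝ ∞ (quadraticField A B C) := by
  have h1 : ContDiff ℝ ∞ fun p : ℂ × ℝ => p.1 := contDiff_fst
  have h2 : ContDiff ℝ ∞ fun p : ℂ × ℝ => p.2 := contDiff_snd
  refine ContDiff.prodMk ?_ (h2.mul (Complex.reCLM.contDiff.comp
    ((contDiff_const.mul h1).add contDiff_const)))
  exact ((((contDiff_const.mul (h1.pow 2)).add (contDiff_const.mul h1)).add contDiff_const).sub
    ((Complex.ofRealCLM.contDiff.comp (h2.pow 2)).mul contDiff_const))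

lemma fderiv_quadraticField (A B C : ℂ) (p a : ℂ × ℝ) :
    fderiv ℝ (quadraticField A B C) p a
      = ((2 * A * p.1 + B) * a.1 - ((2 * p.2 * a.2 : ℝ) : ℂ) * starRingEnd ℂ A,
        a.2 * (2 * A * p.1 + B).re + p.2 * (2 * A * a.1).re) := by
  have h1 : HasDerivAt (fun s : ℝ => p.1 + (s : ℂ) * a.1) a.1 0 := by
    simpa using ((Complex.ofRealCLM.hasDerivAt (x := 0)).mul_const a.1).const_add p.1
  have h2 : HasDerivAt (fun s : ℝ => p.2 + s * a.2) a.2 0 := by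
    simpa using ((hasDerivAt_id (0 : ℝ)).mul_const a.2).const_add p.2
  have h3 := (((((h1.pow 2).const_mul A).add (h1.const_mul B)).add_const C).sub
    ((h2.pow 2).ofReal_comp.mul_const (starRingEnd ℂ A)))
  have h4 := h2.mul (Complex.reCLM.hasFDerivAt.comp_hasDerivAt (0 : ℝ)
    ((h1.const_mul (2 * A)).add_const B))
  have h5 := h3.prodMk h4
  have hl : HasDerivAt (fun s : ℝ => p + s • a) a 0 := by
    simpa using ((hasDerivAt_id (0 : ℝ)).smul_const a).const_add p
  have hd : HasFDerivAt (quadraticField A B C) (fderiv ℝ (quadraticField A B C) p)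
      (p + (0 : ℝ) • a) := by
    rw [zero_smul, add_zero]
    exact ((contDiff_quadraticField A B C).differentiable (by simp) p).hasFDerivAt
  have h6 := hd.comp_hasDerivAt (0 : ℝ) hl
  have h7 : (quadraticField A B C ∘ fun s : ℝ => p + s • a) = fun s : ℝ =>
      (A * (p.1 + (s : ℂ) * a.1) ^ 2 + B * (p.1 + (s : ℂ) * a.1) + C
        - (((p.2 + s * a.2) ^ 2 : ℝ) : ℂ) * starRingEnd ℂ A,
      (p.2 + s * a.2) * (2 * A * (p.1 + (s : ℂ) * a.1) + B).re) := by
    funext s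
    simp [quadraticField]
  rw [h7] at h6
  rw [h6.unique h5]
  ext1
  · simp; ring
  · simp

lemma isKillingField_quadraticField (A B C : ℂ) : IsKillingField (quadraticField A B C) where
  smooth := (contDiff_quadraticField A B C).contDiffOn
  killing p hp a b := by
    have hw : p.2 ≠ 0 := ne_of_gt hp
    rw [(hasFDerivAt_hInner hp a b).fderiv, hInner_eq, hInner_eq, fderiv_quadraticField, fderiv_quadraticField]
    simp [euc, quadraticField]
    field_simp
    ring

lemma quadraticField_add (A B C A' B' C' : ℂ) :
    quadraticField (A + A') (B + B') (C + C') = fun p => quadraticField A B C p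
      + quadraticField A' B' C' p := by
  funext p
  ext1
  · simp [quadraticField]; ring
  · simp [quadraticField]; ring

lemma quadraticField_smul (s : ℝ) (A B C : ℂ) :
    quadraticField (s * A) (s * B) (s * C) = fun p => s • quadraticField A B C p := by
  funext p
  ext1
  · simp [quadraticField]; ring
  · simp [quadraticField]; ring

end QuadraticField

/-! ### The Möbius action on the half-space and its one-parameter groups -/

section Isometries

/-- The denominator in `hAct`. -/
def hDenom (g : SL(2, ℂ)) (p : ℂ × ℝ) : ℝ :=
  ‖g 1 0 * p.1 + g 1 1‖ ^ 2 + ‖g 1 0‖ ^ 2 * p.2 ^ 2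

/-- The numerator in `hAct`. -/
def hNumer (g : SL(2, ℂ)) (p : ℂ × ℝ) : ℂ :=
  (g 0 0 * p.1 + g 0 1) * starRingEnd ℂ (g 1 0 * p.1 + g 1 1)
    + g 0 0 * starRingEnd ℂ (g 1 0) * ((p.2 ^ 2 : ℝ) : ℂ)

lemma hAct_eq (g : SL(2, ℂ)) (p : ℂ × ℝ) :
    hAct g p = (hNumer g p / (hDenom g p : ℂ), p.2 / hDenom g p) := rfl

lemma SL_det (g : SL(2, ℂ)) : g 0 0 * g 1 1 - g 0 1 * g 1 0 = 1 := by
  have := g.det_coe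
  rwa [Matrix.det_fin_two] at this

lemma hDenom_pos (g : SL(2, ℂ)) {p : ℂ × ℝ} (hp : p ∈ halfSpace) : 0 < hDenom g p := by
  have hw : 0 < p.2 := hp
  rw [hDenom]
  by_cases h : g 1 0 = 0
  · have h1 : g 1 1 ≠ 0 := fun h1 => by
      have := SL_det g
      rw [h, h1] at this
      simp at this
    have := norm_pos_iff.2 h1
    simp only [h, zero_mul, zero_add, norm_zero]
    positivity
  · have := norm_pos_iff.2 h
    positivity

lemma hAct_mem_halfSpace (g : SL(2, ℂ)) {p : ℂ × ℝ} (hp : p ∈ halfSpace) :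
    hAct g p ∈ halfSpace :=
  div_pos hp (hDenom_pos g hp)

lemma ofReal_hDenom (g : SL(2, ℂ)) (p : ℂ × ℝ) :
    (hDenom g p : ℂ) = (g 1 0 * p.1 + g 1 1) * starRingEnd ℂ (g 1 0 * p.1 + g 1 1)
      + g 1 0 * starRingEnd ℂ (g 1 0) * (p.2 : ℂ) ^ 2 := by
  rw [hDenom, Complex.mul_conj, Complex.mul_conj, Complex.normSq_eq_norm_sq,
    Complex.normSq_eq_norm_sq]
  push_cast
  ring

/-- The denominator is a cocycle of the action; together with the analogous formula for the
numerator this yields the composition law. -/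
lemma hDenom_mul (g h : SL(2, ℂ)) {p : ℂ × ℝ} (hp : p ∈ halfSpace) :
    hDenom (g * h) p = hDenom g (hAct h p) * hDenom h p := by
  have hr : (hDenom h p : ℂ) ≠ 0 := Complex.ofReal_ne_zero.2 (hDenom_pos h hp).ne'
  apply Complex.ofReal_injective
  have hd := SL_det h
  have hd' := congrArg (starRingEnd ℂ) hd
  push_cast
  rw [ofReal_hDenom (g * h), ofReal_hDenom g, hAct_eq]
  simp only [Matrix.SpecialLinearGroup.coe_mul, Matrix.mul_apply, Fin.sum_univ_two, map_add,
    map_mul, map_div₀, Complex.conj_ofReal, map_sub, map_one, Complex.ofReal_div] at hd' ⊢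
  field_simp
  rw [ofReal_hDenom, hNumer]
  simp only [map_add, map_mul, map_pow, Complex.conj_ofReal, Complex.conj_conj,
    Complex.ofReal_pow]
  -- With the conjugates as independent variables, the claim is a polynomial identity modulo det h =
  -- 1 and its conjugate.
  generalize starRingEnd ℂ (g 1 0) = c', starRingEnd ℂ (g 1 1) = d', starRingEnd ℂ (h 0 0) = α',
    starRingEnd ℂ (h 0 1) = β', starRingEnd ℂ (h 1 0) = γ', starRingEnd ℂ (h 1 1) = δ',
    starRingEnd ℂ p.1 = ζ' at *
  generalize g 1 0 = c, g 1 1 = d, h 0 0 = α, h 0 1 = β, h 1 0 = γ, h 1 1 = δ, p.1 = ζ,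
    (p.2 : ℂ) = w at *
  linear_combination c * c' * w ^ 2 * (α' * δ' - β' * γ') * hd + c * c' * w ^ 2 * hd'

lemma hNumer_mul (g h : SL(2, ℂ)) {p : ℂ × ℝ} (hp : p ∈ halfSpace) :
    hNumer (g * h) p = hNumer g (hAct h p) * hDenom h p := by
  have hr : (hDenom h p : ℂ) ≠ 0 := Complex.ofReal_ne_zero.2 (hDenom_pos h hp).ne'
  have hd := SL_det h
  have hd' := congrArg (starRingEnd ℂ) hd
  rw [hNumer, hNumer, hAct_eq]
  simp only [Matrix.SpecialLinearGroup.coe_mul, Matrix.mul_apply, Fin.sum_univ_two, map_add,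
    map_mul, map_div₀, Complex.conj_ofReal, map_sub, map_one, Complex.ofReal_div,
    Complex.ofReal_pow] at hd' ⊢
  field_simp
  rw [ofReal_hDenom, hNumer]
  simp only [map_add, map_mul, map_pow, Complex.conj_ofReal, Complex.conj_conj,
    Complex.ofReal_pow]
  generalize starRingEnd ℂ (g 1 0) = c', starRingEnd ℂ (g 1 1) = d', starRingEnd ℂ (h 0 0) = α',
    starRingEnd ℂ (h 0 1) = β', starRingEnd ℂ (h 1 0) = γ', starRingEnd ℂ (h 1 1) = δ',
    starRingEnd ℂ p.1 = ζ' at *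
  generalize g 0 0 = a, g 0 1 = b, h 0 0 = α, h 0 1 = β, h 1 0 = γ, h 1 1 = δ, p.1 = ζ,
    (p.2 : ℂ) = w at *
  linear_combination a * c' * w ^ 2 * (α' * δ' - β' * γ') * hd + a * c' * w ^ 2 * hd'

lemma hAct_mul (g h : SL(2, ℂ)) {p : ℂ × ℝ} (hp : p ∈ halfSpace) :
    hAct (g * h) p = hAct g (hAct h p) := by
  have h1 := (hDenom_pos h hp).ne'
  have h2 := (hDenom_pos g (hAct_mem_halfSpace h hp)).ne'
  have h1' : (hDenom h p : ℂ) ≠ 0 := Complex.ofReal_ne_zero.2 h1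
  have h2' : (hDenom g (hAct h p) : ℂ) ≠ 0 := Complex.ofReal_ne_zero.2 h2
  rw [hAct_eq (g * h), hAct_eq g, hDenom_mul g h hp, hNumer_mul g h hp]
  ext1
  · push_cast
    exact mul_div_mul_right _ _ h1'
  · change p.2 / _ = p.2 / hDenom h p / _
    rw [div_div, mul_comm]

lemma hAct_one (p : ℂ × ℝ) : hAct 1 p = p := by
  rw [hAct_eq]
  simp [hNumer, hDenom]

/-- The diagonal matrix with eigenvalues `exp (τ / 2)` and `exp (-τ / 2)`. -/
def axialMatrix (τ : ℂ) : SL(2, ℂ) :=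
  ⟨!![Complex.exp (τ / 2), 0; 0, Complex.exp (-(τ / 2))], by
    rw [Matrix.det_fin_two_of, ← Complex.exp_add]; simp⟩

lemma axialMatrix_add (σ τ : ℂ) : axialMatrix (σ + τ) = axialMatrix σ * axialMatrix τ := by
  ext i j
  rw [Matrix.SpecialLinearGroup.coe_mul, Matrix.mul_apply, Fin.sum_univ_two]
  fin_cases i <;> fin_cases j <;> simp [axialMatrix, ← Complex.exp_add] <;> ring_nf

lemma axialMatrix_zero : axialMatrix 0 = 1 := by
  ext i j
  fin_cases i <;> fin_cases j <;> simp [axialMatrix]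

lemma hAct_axialMatrix (τ : ℂ) (p : ℂ × ℝ) :
    hAct (axialMatrix τ) p = (Complex.exp τ * p.1, Real.exp τ.re * p.2) := by
  have hd : hDenom (axialMatrix τ) p = Real.exp (-τ.re) := by
    simp [hDenom, axialMatrix, Complex.norm_exp, ← Real.exp_nat_mul]
    ring
  have hd' : (hDenom (axialMatrix τ) p : ℂ)
      = Complex.exp (-(τ / 2)) * starRingEnd ℂ (Complex.exp (-(τ / 2))) := by
    rw [ofReal_hDenom]; simp [axialMatrix]
  have hn : hNumer (axialMatrix τ) p
      = Complex.exp (τ / 2) * p.1 * starRingEnd ℂ (Complex.exp (-(τ / 2))) := by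
    simp [hNumer, axialMatrix]
  rw [hAct_eq]
  ext1
  · change hNumer _ _ / _ = _
    rw [hd', hn, mul_div_mul_right _ _
      ((map_ne_zero (starRingEnd ℂ)).2 (Complex.exp_ne_zero _)), Complex.exp_neg, div_inv_eq_mul,
      mul_right_comm, ← Complex.exp_add, add_halves]
  · change p.2 / _ = _
    rw [hd, Real.exp_neg, div_inv_eq_mul, mul_comm]

lemma axialTranslation_eq (t : ℝ) : axialTranslation t = hAct (axialMatrix (t * 1)) := by
  funext p
  rw [hAct_axialMatrix, axialTranslation]
  ext1 <;> simp

lemma axialRotation_eq (t : ℝ) : axialRotation t = hAct (axialMatrix (t * Complex.I)) := by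
  funext p
  rw [hAct_axialMatrix, axialRotation]
  ext1 <;> simp

/-- The derivative at the identity of the action along a curve of matrices. -/
lemma hasDerivAt_hAct {m : ℝ → SL(2, ℂ)} {a b c d : ℂ} (h0 : m 0 = 1)
    (ha : HasDerivAt (fun s => m s 0 0) a 0) (hb : HasDerivAt (fun s => m s 0 1) b 0)
    (hc : HasDerivAt (fun s => m s 1 0) c 0) (hd : HasDerivAt (fun s => m s 1 1) d 0)
    (had : a + d = 0) (p : ℂ × ℝ) :
    HasDerivAt (fun s => hAct (m s) p) (quadraticField (-c) (a - d) b p) 0 := by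
  have hv := (hc.mul_const p.1).add hd
  have hu := (ha.mul_const p.1).add hb
  have e00 : m 0 0 0 = 1 := by rw [h0]; simp
  have e01 : m 0 0 1 = 0 := by rw [h0]; simp
  have e10 : m 0 1 0 = 0 := by rw [h0]; simp
  have e11 : m 0 1 1 = 1 := by rw [h0]; simp
  have hD : HasDerivAt (fun s => hDenom (m s) p) (2 * (c * p.1 + d).re) 0 := by
    have := hv.norm_sq.add (hc.norm_sq.mul_const (p.2 ^ 2))
    refine this.congr_deriv ?_
    simp [e10, e11, Complex.inner]
  have hN : HasDerivAt (fun s => hNumer (m s) p) (a * p.1 + b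
      + p.1 * starRingEnd ℂ (c * p.1 + d) + starRingEnd ℂ c * ((p.2 ^ 2 : ℝ) : ℂ)) 0 := by
    have := (hu.mul hv.star).add ((ha.mul hc.star).mul_const ((p.2 ^ 2 : ℝ) : ℂ))
    refine this.congr_deriv ?_
    simp [e00, e01, e10, e11]
  have hD0 : hDenom (m 0) p = 1 := by simp [hDenom, e10, e11]
  have hN0 : hNumer (m 0) p = p.1 := by simp [hNumer, e00, e01, e10, e11]
  have h1 := hN.div hD.ofReal_comp (by rw [hD0]; simp)
  have h2 := (hasDerivAt_const (0 : ℝ) p.2).div hD (by rw [hD0]; simp)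
  refine (h1.prodMk h2).congr_deriv ?_
  obtain rfl : d = -a := by linear_combination had
  ext1
  · simp only [hD0, hN0, quadraticField]
    apply Complex.ext <;> simp [pow_two] <;> ring
  · simp [hD0, quadraticField]
    ring

lemma coe_conj_axialMatrix (g : SL(2, ℂ)) (τ : ℂ) :
    ((g⁻¹ * axialMatrix τ * g : SL(2, ℂ)) : Matrix (Fin 2) (Fin 2) ℂ)
      = !![g 0 0 * g 1 1 * Complex.exp (τ / 2) - g 0 1 * g 1 0 * Complex.exp (-(τ / 2)),
        g 0 1 * g 1 1 * (Complex.exp (τ / 2) - Complex.exp (-(τ / 2)));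
        -(g 0 0 * g 1 0) * (Complex.exp (τ / 2) - Complex.exp (-(τ / 2))),
        g 0 0 * g 1 1 * Complex.exp (-(τ / 2)) - g 0 1 * g 1 0 * Complex.exp (τ / 2)] := by
  rw [Matrix.SpecialLinearGroup.coe_mul, Matrix.SpecialLinearGroup.coe_mul,
    Matrix.SpecialLinearGroup.coe_inv, Matrix.adjugate_fin_two]
  ext i j
  fin_cases i <;> fin_cases j <;>
    simp [Matrix.mul_apply, Fin.sum_univ_two, axialMatrix] <;> ring

/-- The flow of a one-parameter group of isometries conjugate to a group of diagonal matrices. -/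
lemma hasDerivAt_conj_axialMatrix (g : SL(2, ℂ)) (κ : ℂ) {p : ℂ × ℝ} (hp : p ∈ halfSpace) (t : ℝ) :
    HasDerivAt (fun s : ℝ => hAct g⁻¹ (hAct (axialMatrix (s * κ)) (hAct g p)))
      (quadraticField (κ * (g 0 0 * g 1 0)) (κ * (g 0 0 * g 1 1 + g 0 1 * g 1 0))
        (κ * (g 0 1 * g 1 1)) (hAct g⁻¹ (hAct (axialMatrix (t * κ)) (hAct g p)))) t := by
  set m : ℝ → SL(2, ℂ) := fun s => g⁻¹ * axialMatrix (s * κ) * g with hm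
  have hact : ∀ s : ℝ, hAct g⁻¹ (hAct (axialMatrix (s * κ)) (hAct g p)) = hAct (m s) p := fun s => by
    rw [hm, hAct_mul _ _ hp, hAct_mul _ _ (hAct_mem_halfSpace g hp)]
  simp only [hact]
  -- The group law reduces the derivative at time t to the derivative at time 0, taken at the point
  -- already reached.
  have hadd : ∀ s, m s = m (s - t) * m t := fun s => by
    simp only [hm]
    rw [show ((s : ℝ) : ℂ) * κ = ((s - t : ℝ) : ℂ) * κ + t * κ by push_cast; ring,
      axialMatrix_add]
    group
  have hq := hAct_mem_halfSpace (m t) hp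
  have hexp : HasDerivAt (fun s : ℝ => Complex.exp (s * κ / 2)) (κ / 2) 0 := by
    have := (((Complex.ofRealCLM.hasDerivAt (x := 0)).mul_const κ).div_const 2).cexp
    simpa using this
  have hexp' : HasDerivAt (fun s : ℝ => Complex.exp (-(s * κ / 2))) (-(κ / 2)) 0 := by
    have := (((Complex.ofRealCLM.hasDerivAt (x := 0)).mul_const κ).div_const 2).neg.cexp
    simpa using this
  have key : HasDerivAt (fun s => hAct (m s) (hAct (m t) p)) (quadraticField (κ * (g 0 0 * g 1 0))
      (κ * (g 0 0 * g 1 1 + g 0 1 * g 1 0)) (κ * (g 0 1 * g 1 1)) (hAct (m t) p)) 0 := by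
    have hm0 : m 0 = 1 := by simp [hm, axialMatrix_zero]
    have hentry : ∀ s : ℝ, (m s : Matrix (Fin 2) (Fin 2) ℂ) = _ := fun s =>
      coe_conj_axialMatrix g (s * κ)
    have := hasDerivAt_hAct (m := m) (a := κ / 2 * (g 0 0 * g 1 1 + g 0 1 * g 1 0))
      (b := κ * (g 0 1 * g 1 1)) (c := -(κ * (g 0 0 * g 1 0)))
      (d := -(κ / 2 * (g 0 0 * g 1 1 + g 0 1 * g 1 0))) hm0 ?_ ?_ ?_ ?_ (by ring) (hAct (m t) p)
    · convert this using 2 <;> ring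
    all_goals simp only [hentry, Matrix.of_apply, Matrix.cons_val_zero, Matrix.cons_val_one,
      Matrix.cons_val', Matrix.cons_val_fin_one]
    · refine ((hexp.const_mul (g 0 0 * g 1 1)).sub
        (hexp'.const_mul (g 0 1 * g 1 0))).congr_deriv ?_
      ring
    · refine ((hexp.sub hexp').const_mul (g 0 1 * g 1 1)).congr_deriv ?_
      ring
    · refine ((hexp.sub hexp').const_mul (-(g 0 0 * g 1 0))).congr_deriv ?_
      ring
    · refine ((hexp'.const_mul (g 0 0 * g 1 1)).sub
        (hexp.const_mul (g 0 1 * g 1 0))).congr_deriv ?_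
      ring
  have h2 : HasDerivAt (fun s => hAct (m (s - t)) (hAct (m t) p)) (quadraticField
      (κ * (g 0 0 * g 1 0)) (κ * (g 0 0 * g 1 1 + g 0 1 * g 1 0)) (κ * (g 0 1 * g 1 1))
      (hAct (m t) p)) t := by
    have key' := key
    rw [← sub_self t] at key'
    exact key'.comp_sub_const t t
  refine h2.congr_of_eventuallyEq (Filter.Eventually.of_forall fun s => ?_)
  change hAct (m s) p = _
  rw [hadd s, hAct_mul _ _ hp]

/-- The Killing field of the translation along the geodesic carried to the axis by `g` (for
`κ = 1`), or of the rotation about it (for `κ = I`). -/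
def axisField (κ : ℂ) (g : SL(2, ℂ)) : ℂ × ℝ → ℂ × ℝ :=
  quadraticField (κ * (g 0 0 * g 1 0)) (κ * (g 0 0 * g 1 1 + g 0 1 * g 1 0)) (κ * (g 0 1 * g 1 1))

lemma isVelocityField_axisField (κ : ℂ) (g : SL(2, ℂ)) :
    IsVelocityField (fun s p => hAct g⁻¹ (hAct (axialMatrix (s * κ)) (hAct g p)))
      (axisField κ g) :=
  fun _ hp t => hasDerivAt_conj_axialMatrix g κ hp t

/-- At time 0 the flow is the identity, so it determines its velocity field at every point of the
half-space, and nothing outside. -/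
lemma eqOn_axisField {κ : ℂ} {g : SL(2, ℂ)} {Y : ℂ × ℝ → ℂ × ℝ}
    (hY : IsVelocityField (fun s p => hAct g⁻¹ (hAct (axialMatrix (s * κ)) (hAct g p))) Y) :
    Set.EqOn Y (axisField κ g) halfSpace := by
  intro p hp
  have h := (hY p hp 0).unique (isVelocityField_axisField κ g p hp 0)
  have h0 : hAct g⁻¹ (hAct (axialMatrix ((0 : ℝ) * κ)) (hAct g p)) = p := by
    rw [Complex.ofReal_zero, zero_mul, axialMatrix_zero, hAct_one, ← hAct_mul _ _ hp,
      inv_mul_cancel, hAct_one]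
  simpa only [h0] using h

lemma IsTranslationField.exists_eqOn {C D : OnePoint ℂ} {Y : ℂ × ℝ → ℂ × ℝ}
    (hY : IsTranslationField C D Y) :
    ∃ g : SL(2, ℂ), SendsToAxis g C D ∧ Set.EqOn Y (axisField 1 g) halfSpace := by
  obtain ⟨g, hg, h⟩ := hY
  simp only [axialTranslation_eq] at h
  exact ⟨g, hg, eqOn_axisField h⟩

lemma IsRotationField.exists_eqOn {C D : OnePoint ℂ} {Y : ℂ × ℝ → ℂ × ℝ}
    (hY : IsRotationField C D Y) :
    ∃ g : SL(2, ℂ), SendsToAxis g C D ∧ Set.EqOn Y (axisField Complex.I g) halfSpace := by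
  obtain ⟨g, hg, h⟩ := hY
  simp only [axialRotation_eq] at h
  exact ⟨g, hg, eqOn_axisField h⟩

lemma SendsToAxis.isTranslationField {g : SL(2, ℂ)} {C D : OnePoint ℂ} (hg : SendsToAxis g C D) :
    IsTranslationField C D (axisField 1 g) := by
  refine ⟨g, hg, ?_⟩
  simp only [axialTranslation_eq]
  exact isVelocityField_axisField 1 g

lemma SendsToAxis.isRotationField {g : SL(2, ℂ)} {C D : OnePoint ℂ} (hg : SendsToAxis g C D) :
    IsRotationField C D (axisField Complex.I g) := by
  refine ⟨g, hg, ?_⟩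
  simp only [axialRotation_eq]
  exact isVelocityField_axisField Complex.I g

/-- As the determinant is one, numerator and denominator of the Möbius map have no common zero; thus
C is a zero and D a pole. -/
lemma sendsToAxis_coe_coe {g : SL(2, ℂ)} {C D : ℂ} :
    SendsToAxis g C D ↔ g 0 0 * C + g 0 1 = 0 ∧ g 1 0 * D + g 1 1 = 0 := by
  have hd := SL_det g
  have h1 : g 0 0 * C + g 0 1 = 0 → g 1 0 * C + g 1 1 ≠ 0 := fun h h' => by
    apply one_ne_zero (α := ℂ)
    linear_combination g 0 0 * h' - g 1 0 * h - hd
  rw [SendsToAxis, OnePoint.smul_some_eq_ite, OnePoint.smul_some_eq_ite]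
  split_ifs <;> simp_all

lemma sendsToAxis_infty_coe {g : SL(2, ℂ)} {D : ℂ} :
    SendsToAxis g OnePoint.infty D ↔ g 0 0 = 0 ∧ g 1 0 * D + g 1 1 = 0 := by
  have hd := SL_det g
  rw [SendsToAxis, OnePoint.smul_some_eq_ite, OnePoint.smul_infty_eq_ite]
  split_ifs <;> simp_all

lemma sendsToAxis_coe_infty {g : SL(2, ℂ)} {C : ℂ} :
    SendsToAxis g C OnePoint.infty ↔ g 0 0 * C + g 0 1 = 0 ∧ g 1 0 = 0 := by
  have hd := SL_det g
  rw [SendsToAxis, OnePoint.smul_some_eq_ite, OnePoint.smul_infty_eq_ite]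
  split_ifs <;> simp_all

lemma exists_sendsToAxis {C D : OnePoint ℂ} (h : C ≠ D) : ∃ g : SL(2, ℂ), SendsToAxis g C D := by
  induction C using OnePoint.rec with
  | infty =>
    induction D using OnePoint.rec with
    | infty => exact absurd rfl h
    | coe D =>
      refine ⟨⟨!![0, -1; 1, -D], by simp [Matrix.det_fin_two_of]⟩, sendsToAxis_infty_coe.2 ?_⟩
      simp
  | coe C =>
    induction D using OnePoint.rec with
    | infty =>
      refine ⟨⟨!![1, -C; 0, 1], by simp [Matrix.det_fin_two_of]⟩, sendsToAxis_coe_infty.2 ?_⟩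
      simp
    | coe D =>
      have hCD : C - D ≠ 0 := sub_ne_zero.2 fun h' => h (by rw [h'])
      -- The map ζ ↦ (ζ - C)/(ζ - D), with its second row scaled to give determinant one.
      refine ⟨⟨!![1, -C; (C - D)⁻¹, -(C - D)⁻¹ * D], ?_⟩, sendsToAxis_coe_coe.2 ?_⟩
      · rw [Matrix.det_fin_two_of]
        field_simp
        ring
      · simp

end Isometries

/-! ### Flux polynomials and their quotients on the Riemann sphere -/

section FluxPolynomial

/-- The polynomial `α - β (X + Y) + γ X Y`. -/
def fluxPolynomial (α β γ : ℂ) : MvPolynomial (Fin 2) ℂ :=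
  MvPolynomial.C α - MvPolynomial.C β * (MvPolynomial.X 0 + MvPolynomial.X 1)
    + MvPolynomial.C γ * (MvPolynomial.X 0 * MvPolynomial.X 1)

lemma eval_fluxPolynomial (α β γ C D : ℂ) :
    MvPolynomial.eval ![C, D] (fluxPolynomial α β γ) = α - β * (C + D) + γ * (C * D) := by
  simp [fluxPolynomial]

lemma diagonal_fluxPolynomial (α β γ : ℂ) :
    diagonal (fluxPolynomial α β γ) = Polynomial.C α - Polynomial.C β * (2 * Polynomial.X)
      + Polynomial.C γ * Polynomial.X ^ 2 := by
  simp [diagonal, fluxPolynomial]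
  ring

/-- The filter of the pairs of complex numbers that converge to `(C, D)` in the Riemann sphere. -/
lemma comap_coe_nhds_prod (C D : OnePoint ℂ) :
    Filter.comap (fun q : ℂ × ℂ => ((q.1 : OnePoint ℂ), (q.2 : OnePoint ℂ))) (𝓝 (C, D))
      = Filter.comap (fun z : ℂ => (z : OnePoint ℂ)) (𝓝 C)
        ×ˢ Filter.comap (fun z : ℂ => (z : OnePoint ℂ)) (𝓝 D) := by
  rw [nhds_prod_eq, Filter.prod_comap_comap_eq]

lemma comap_coe_nhds_neBot (C : OnePoint ℂ) :
    (Filter.comap (fun z : ℂ => (z : OnePoint ℂ)) (𝓝 C)).NeBot :=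
  OnePoint.isDenseEmbedding_coe.isDenseInducing.comap_nhds_neBot C

/-- The plane is dense in the sphere, so the filter along which the limit is taken is nontrivial. -/
lemma IsQuotientValue.unique {P : MvPolynomial (Fin 2) ℂ} {C D : OnePoint ℂ} {v w : ℂ}
    (hv : IsQuotientValue P C D v) (hw : IsQuotientValue P C D w) : v = w := by
  have h1 := comap_coe_nhds_neBot C
  have h2 := comap_coe_nhds_neBot D
  have h3 := comap_coe_nhds_prod C D
  rw [IsQuotientValue, h3] at hv hw
  exact tendsto_nhds_unique hv hw

lemma isQuotientValue_coe (P : MvPolynomial (Fin 2) ℂ) {C D : ℂ} (h : C ≠ D) :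
    IsQuotientValue P C D (MvPolynomial.eval ![C, D] P / (C - D)) := by
  rw [IsQuotientValue, comap_coe_nhds_prod, OnePoint.comap_coe_nhds, OnePoint.comap_coe_nhds,
    ← nhds_prod_eq]
  have h1 : Continuous fun q : ℂ × ℂ => MvPolynomial.eval ![q.1, q.2] P :=
    (MvPolynomial.continuous_eval P).comp (continuous_pi fun i => by
      fin_cases i
      · exact continuous_fst
      · exact continuous_snd)
  exact (h1.tendsto (C, D)).div (((continuous_fst.sub continuous_snd).tendsto (C, D)))
    (sub_ne_zero.2 h)

lemma comap_coe_nhds_infty_eq :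
    Filter.comap (fun z : ℂ => (z : OnePoint ℂ)) (𝓝 OnePoint.infty) = Bornology.cobounded ℂ := by
  rw [OnePoint.comap_coe_nhds_infty, Filter.coclosedCompact_eq_cocompact,
    Metric.cobounded_eq_cocompact]

/-- Numerator and denominator are divided by the first variable, whose inverse tends to 0. No bound
on the total degree would do: what matters is degree at most one in each variable. -/
lemma tendsto_fluxPolynomial_cobounded (α β γ D : ℂ) :
    Filter.Tendsto (fun q : ℂ × ℂ => (α - β * (q.1 + q.2) + γ * (q.1 * q.2)) / (q.1 - q.2))
      (Bornology.cobounded ℂ ×ˢ 𝓝 D) (𝓝 (-β + γ * D)) := by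
  have h1 : Filter.Tendsto (fun q : ℂ × ℂ => q.1⁻¹) (Bornology.cobounded ℂ ×ˢ 𝓝 D) (𝓝 0) :=
    Filter.tendsto_inv₀_cobounded.comp Filter.tendsto_fst
  have h2 : Filter.Tendsto (fun q : ℂ × ℂ => q.2) (Bornology.cobounded ℂ ×ˢ 𝓝 D) (𝓝 D) :=
    Filter.tendsto_snd
  have h3 := (((h1.const_mul α).sub ((h2.mul h1).const_add 1 |>.const_mul β)).add
    (h2.const_mul γ)).div ((h2.mul h1).const_sub 1) (by simp)
  have h4 : (α * 0 - β * (1 + D * 0) + γ * D) / (1 - D * 0) = -β + γ * D := by simp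
  rw [h4] at h3
  refine h3.congr' ?_
  have h5 : ∀ᶠ q : ℂ × ℂ in Bornology.cobounded ℂ ×ˢ 𝓝 D, q.1 ≠ 0 :=
    Filter.tendsto_fst.eventually (Bornology.eventually_ne_cobounded 0)
  filter_upwards [h5] with q hq
  have e1 : α * q.1⁻¹ - β * (1 + q.2 * q.1⁻¹) + γ * q.2
      = (α - β * (q.1 + q.2) + γ * (q.1 * q.2)) / q.1 := by
    field_simp
  have e2 : 1 - q.2 * q.1⁻¹ = (q.1 - q.2) / q.1 := by field_simp
  simp only [Pi.div_apply, e1, e2]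
  rw [div_div_div_cancel_right₀ hq]

/-- The value at `(C, D)` of the quotient defined by `fluxPolynomial`, in terms of an isometry that
carries the geodesic `(C, D)` to the axis. -/
lemma isQuotientValue_fluxPolynomial (α β γ : ℂ) {g : SL(2, ℂ)} {C D : OnePoint ℂ}
    (hg : SendsToAxis g C D) :
    IsQuotientValue (fluxPolynomial α β γ) C D
      (g 0 0 * g 1 0 * α + (g 0 0 * g 1 1 + g 0 1 * g 1 0) * β + g 0 1 * g 1 1 * γ) := by
  have hd := SL_det g
  induction C using OnePoint.rec with
  | infty =>
    induction D using OnePoint.rec with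
    | infty =>
      have := hg.1.symm.trans hg.2
      exact absurd this (OnePoint.coe_ne_infty _)
    | coe D =>
      obtain ⟨h1, h2⟩ := sendsToAxis_infty_coe.1 hg
      rw [IsQuotientValue, comap_coe_nhds_prod, comap_coe_nhds_infty_eq, OnePoint.comap_coe_nhds]
      simp only [eval_fluxPolynomial]
      convert tendsto_fluxPolynomial_cobounded α β γ D using 2
      rw [h1] at hd ⊢
      linear_combination (g 0 1 * γ) * h2 - (β - γ * D) * hd
  | coe C =>
    induction D using OnePoint.rec with
    | infty =>
      obtain ⟨h1, h2⟩ := sendsToAxis_coe_infty.1 hg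
      rw [IsQuotientValue, comap_coe_nhds_prod, comap_coe_nhds_infty_eq, OnePoint.comap_coe_nhds,
        Filter.prod_comm, Filter.tendsto_map'_iff]
      simp only [eval_fluxPolynomial]
      -- The numerator is symmetric and the denominator antisymmetric, so exchanging the variables
      -- changes the sign of the quotient.
      convert (tendsto_fluxPolynomial_cobounded α β γ C).neg using 2
      · rename_i q
        simp only [Function.comp_apply, Prod.fst_swap, Prod.snd_swap]
        rw [← div_neg, neg_sub, add_comm q.2, mul_comm q.2]
      · rw [h2] at hd ⊢
        linear_combination (g 1 1 * γ) * h1 + (β - γ * C) * hd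
    | coe D =>
      obtain ⟨h1, h2⟩ := sendsToAxis_coe_coe.1 hg
      -- The determinant condition normalizes the leading coefficient of the axis field to 1/(C -
      -- D), whichever g is chosen.
      have hk : g 0 0 * g 1 0 * (C - D) = 1 := by
        linear_combination hd + g 1 0 * h1 - g 0 0 * h2
      have hCD : C ≠ D := fun h => by rw [h] at hk; simp at hk
      convert isQuotientValue_coe (fluxPolynomial α β γ) hCD using 1
      rw [eval_fluxPolynomial, eq_div_iff (sub_ne_zero.2 hCD)]
      have e1 : g 0 1 = -(g 0 0 * C) := by linear_combination h1
      have e2 : g 1 1 = -(g 1 0 * D) := by linear_combination h2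
      rw [e1, e2]
      linear_combination (α - β * (C + D) + γ * (C * D)) * hk

end FluxPolynomial

/-! ### Linearity of the flux and the polynomial of an end -/

section EncodedFlux

variable {M : Type*} [TopologicalSpace M] [ChartedSpace ℂ M] {X : M → ℂ × ℝ}

lemma hInner_add_right (p a b c : ℂ × ℝ) : hInner p a (b + c) = hInner p a b + hInner p a c := by
  simp only [hInner_eq, euc, Prod.fst_add, Prod.snd_add, Complex.add_re, Complex.add_im]
  ring

lemma hInner_smul_right (p a b : ℂ × ℝ) (s : ℝ) : hInner p a (s • b) = s * hInner p a b := by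
  simp only [hInner_eq, euc, Prod.smul_fst, Prod.smul_snd, Complex.smul_re, Complex.smul_im,
    smul_eq_mul]
  ring

lemma fluxForm_add {Y Y' : ℂ × ℝ → ℂ × ℝ} (hY : IsKillingField Y) (hY' : IsKillingField Y')
    {f : ℂ → ℂ × ℝ} {z : ℂ} (hz : f z ∈ halfSpace) (v : ℂ) :
    fluxForm (fun p => Y p + Y' p) f z v = fluxForm Y f z v + fluxForm Y' f z v := by
  simp only [fluxForm_apply, hInner_add_right, potential,
    fderiv_fun_add (hY.differentiableAt hz) (hY'.differentiableAt hz), add_apply, smul_apply,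
    Prod.fst_add, Prod.snd_add, Complex.add_re, Complex.add_im, smul_eq_mul]
  ring

lemma fluxForm_smul {Y : ℂ × ℝ → ℂ × ℝ} (hY : IsKillingField Y) (s : ℝ)
    {f : ℂ → ℂ × ℝ} {z : ℂ} (hz : f z ∈ halfSpace) (v : ℂ) :
    fluxForm (fun p => s • Y p) f z v = s * fluxForm Y f z v := by
  simp only [fluxForm_apply, hInner_smul_right, potential,
    fderiv_fun_const_smul (hY.differentiableAt hz), add_apply, smul_apply,
    Prod.smul_fst, Prod.smul_snd, Complex.smul_re, Complex.smul_im, smul_eq_mul]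
  ring

/-- Translation and rotation fields are prescribed only on the half-space; this allows them to be
replaced by globally defined quadratic fields. -/
lemma hasFlux_congr (hX : ∀ x, X x ∈ halfSpace) (E : AnnularEnd M) {Y Y' : ℂ × ℝ → ℂ × ℝ}
    (h : Set.EqOn Y Y' halfSpace) {φ : ℝ} : HasFlux X E Y φ ↔ HasFlux X E Y' φ := by
  have key : ∀ Γ K, IsSpanningDisc (E.map X) Γ K →
      fluxValue (E.map X) Γ K Y = fluxValue (E.map X) Γ K Y' := by
    intro Γ K hK
    have h1 : ∀ t, Y (E.map X (Γ t)) = Y' (E.map X (Γ t)) := fun t => h (hX _)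
    rw [fluxValue, fluxValue]
    congr 2
    · simp only [h1]
    · refine MeasureTheory.setIntegral_congr_fun measurableSet_ball fun z hz => ?_
      have hz' : ‖z‖ ≤ 1 := (mem_ball_zero_iff.1 hz).le
      simp only [h (hK.mem_halfSpace z hz')]
  refine exists_congr fun Γ => exists_congr fun K => and_congr_right fun _ =>
    and_congr_right fun hK => ?_
  rw [key Γ K hK]

variable [IsManifold 𝓘(ℂ) ω M]

lemma HasFlux.unique {E : AnnularEnd M} (hX : IsBryantImmersion X) {Y : ℂ × ℝ → ℂ × ℝ}
    (hY : IsKillingField Y) {φ ψ : ℝ} (h1 : HasFlux X E Y φ) (h2 : HasFlux X E Y ψ) : φ = ψ := by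
  obtain ⟨c, -, hc⟩ := E.exists_flux hX hY
  rw [(hc φ).1 h1, (hc ψ).1 h2]

lemma exists_isEndLoop (E : AnnularEnd M) : ∃ Γ, IsEndLoop E.radius Γ := by
  obtain ⟨ρ, h1, h2⟩ := exists_between E.radius_lt_one
  exact ⟨_, isEndLoop_circleLoop E.radius_nonneg h1 h2⟩

lemma intervalIntegrable_fluxForm (E : AnnularEnd M) (hX : IsBryantImmersion X)
    {Y : ℂ × ℝ → ℂ × ℝ} (hY : IsKillingField Y) {Γ : ℝ → ℂ} (hΓ : IsEndLoop E.radius Γ)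
    (a b : ℝ) :
    IntervalIntegrable (fun t => fluxForm Y (E.map X) (Γ t) (deriv Γ t)) MeasureTheory.volume
      a b := by
  have h1 : Continuous fun t => fluxForm Y (E.map X) (Γ t) :=
    (contDiffOn_fluxForm hY (isOpen_annulus _ _) (E.contDiffOn_map hX)
      fun _ _ => hX.mem_halfSpace _).continuousOn.comp_continuous hΓ.smooth.continuous hΓ.mem
  exact (h1.clm_apply (hΓ.smooth.continuous_deriv (by simp))).intervalIntegrable _ _

lemma HasFlux.add {E : AnnularEnd M} (hX : IsBryantImmersion X) {Y Y' : ℂ × ℝ → ℂ × ℝ}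
    (hY : IsKillingField Y) (hY' : IsKillingField Y')
    (hS : IsKillingField fun p => Y p + Y' p) {φ φ' : ℝ} (h : HasFlux X E Y φ)
    (h' : HasFlux X E Y' φ') : HasFlux X E (fun p => Y p + Y' p) (φ + φ') := by
  obtain ⟨c, h1, hc⟩ := E.exists_flux hX hY
  obtain ⟨c', h1', hc'⟩ := E.exists_flux hX hY'
  obtain ⟨d, h2, hd⟩ := E.exists_flux hX hS
  obtain ⟨Γ, hΓ⟩ := exists_isEndLoop E
  rw [hd, (hc φ).1 h, (hc' φ').1 h', ← h1 Γ hΓ, ← h1' Γ hΓ, ← h2 Γ hΓ,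
    ← intervalIntegral.integral_add (intervalIntegrable_fluxForm E hX hY hΓ _ _)
      (intervalIntegrable_fluxForm E hX hY' hΓ _ _)]
  exact intervalIntegral.integral_congr fun t _ =>
    (fluxForm_add hY hY' (hX.mem_halfSpace _) _).symm

lemma HasFlux.smul {E : AnnularEnd M} (hX : IsBryantImmersion X) {Y : ℂ × ℝ → ℂ × ℝ}
    (hY : IsKillingField Y) {s : ℝ} (hS : IsKillingField fun p => s • Y p) {φ : ℝ}
    (h : HasFlux X E Y φ) : HasFlux X E (fun p => s • Y p) (s * φ) := by
  obtain ⟨c, h1, hc⟩ := E.exists_flux hX hY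
  obtain ⟨d, h2, hd⟩ := E.exists_flux hX hS
  obtain ⟨Γ, hΓ⟩ := exists_isEndLoop E
  rw [hd, (hc φ).1 h, ← h1 Γ hΓ, ← h2 Γ hΓ, ← intervalIntegral.integral_const_mul]
  exact intervalIntegral.integral_congr fun t _ => (fluxForm_smul hY s (hX.mem_halfSpace _) _).symm

/-- The flux is the real part of a complex linear form in the coefficients of a quadratic field. -/
lemma exists_flux_quadraticField (E : AnnularEnd M) (hX : IsBryantImmersion X) :
    ∃ α β γ : ℂ, ∀ A B C : ℂ,
      HasFlux X E (quadraticField A B C) (A * α + B * β + C * γ).re := by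
  have hK := isKillingField_quadraticField
  have hex : ∀ A B C : ℂ, ∃ φ, HasFlux X E (quadraticField A B C) φ := fun A B C => by
    obtain ⟨c, -, hc⟩ := E.exists_flux hX (hK A B C)
    exact ⟨c, (hc c).2 rfl⟩
  choose F hF using hex
  have hadd : ∀ {A B C A' B' C' : ℂ} {φ φ' : ℝ}, HasFlux X E (quadraticField A B C) φ →
      HasFlux X E (quadraticField A' B' C') φ' →
      HasFlux X E (quadraticField (A + A') (B + B') (C + C')) (φ + φ') := by
    intro A B C A' B' C' φ φ' h h'
    have hS := hK (A + A') (B + B') (C + C')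
    rw [quadraticField_add] at hS ⊢
    exact h.add hX (hK _ _ _) (hK _ _ _) hS h'
  have hsmul : ∀ (s : ℝ) (A B C : ℂ),
      HasFlux X E (quadraticField (s * A) (s * B) (s * C)) (s * F A B C) := by
    intro s A B C
    have hS := hK (s * A) (s * B) (s * C)
    rw [quadraticField_smul] at hS ⊢
    exact (hF A B C).smul hX (hK _ _ _) hS
  -- A real linear form ℓ on ℂ is A ↦ Re(Aα) with α = ℓ(1) - iℓ(i).
  refine ⟨F 1 0 0 - F Complex.I 0 0 * Complex.I, F 0 1 0 - F 0 Complex.I 0 * Complex.I,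
    F 0 0 1 - F 0 0 Complex.I * Complex.I, fun A B C => ?_⟩
  have h := hadd (hadd (hadd (hsmul A.re 1 0 0) (hsmul A.im Complex.I 0 0))
    (hadd (hsmul B.re 0 1 0) (hsmul B.im 0 Complex.I 0)))
    (hadd (hsmul C.re 0 0 1) (hsmul C.im 0 0 Complex.I))
  convert h using 1
  · congr 1 <;> apply Complex.ext <;> simp
  · simp

/-- Pairing the coefficients of an axis field with (α, β, γ) gives κv, where v is the quotient
value; κ = 1 gives Re v and κ = I gives -Im v. Uniqueness of the limit removes the dependence on the
isometry g. -/
lemma encodesFlux_fluxPolynomial {E : AnnularEnd M} (hX : IsBryantImmersion X) {α β γ : ℂ}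
    (h : ∀ A B C : ℂ, HasFlux X E (quadraticField A B C) (A * α + B * β + C * γ).re) :
    EncodesFlux X E (fluxPolynomial α β γ) := by
  have haxis : ∀ (κ : ℂ) (g : SL(2, ℂ)), HasFlux X E (axisField κ g) (κ * (g 0 0 * g 1 0 * α
      + (g 0 0 * g 1 1 + g 0 1 * g 1 0) * β + g 0 1 * g 1 1 * γ)).re := fun κ g => by
    rw [mul_add, mul_add, ← mul_assoc, ← mul_assoc κ _ β, ← mul_assoc κ _ γ]
    exact h _ _ _
  intro C D hCD
  obtain ⟨g, hg⟩ := exists_sendsToAxis hCD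
  have hv := isQuotientValue_fluxPolynomial α β γ hg
  refine ⟨_, hv, fun Y hY => ?_, fun Y hY => ?_⟩
  · obtain ⟨g', hg', hYg⟩ := hY.exists_eqOn
    rw [hv.unique (isQuotientValue_fluxPolynomial α β γ hg'), hasFlux_congr hX.mem_halfSpace E hYg]
    simpa only [one_mul] using haxis 1 g'
  · obtain ⟨g', hg', hYg⟩ := hY.exists_eqOn
    rw [hv.unique (isQuotientValue_fluxPolynomial α β γ hg'), hasFlux_congr hX.mem_halfSpace E hYg]
    rw [← Complex.I_mul_re]
    exact haxis Complex.I g'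

/-- Translation and rotation fluxes determine the real and imaginary parts of the quotient, hence
the polynomial off the diagonal. -/
lemma EncodesFlux.unique {E : AnnularEnd M} (hX : IsBryantImmersion X)
    {P Q : MvPolynomial (Fin 2) ℂ} (hP : EncodesFlux X E P) (hQ : EncodesFlux X E Q) : P = Q := by
  have key : ∀ C D : ℂ, C ≠ D → MvPolynomial.eval ![C, D] P = MvPolynomial.eval ![C, D] Q := by
    intro C D hCD
    have hCD' : (C : OnePoint ℂ) ≠ D := fun h => hCD (OnePoint.coe_injective h)
    obtain ⟨v, hv, hv1, hv2⟩ := hP C D hCD'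
    obtain ⟨w, hw, hw1, hw2⟩ := hQ C D hCD'
    obtain ⟨g, hg⟩ := exists_sendsToAxis hCD'
    have h1 := (hv1 _ hg.isTranslationField).unique hX (isKillingField_quadraticField _ _ _)
      (hw1 _ hg.isTranslationField)
    have h2 := (hv2 _ hg.isRotationField).unique hX (isKillingField_quadraticField _ _ _)
      (hw2 _ hg.isRotationField)
    have hvw : v = w := Complex.ext h1 (neg_injective h2)
    rw [hv.unique (isQuotientValue_coe P hCD), hw.unique (isQuotientValue_coe Q hCD)] at hvw
    exact (div_left_inj' (sub_ne_zero.2 hCD)).1 hvw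
  have hne : (MvPolynomial.X 0 - MvPolynomial.X 1 : MvPolynomial (Fin 2) ℂ) ≠ 0 := fun h => by
    have := congrArg (MvPolynomial.eval ![(1 : ℂ), 0]) h
    simp at this
  -- Multiplication by X - Y makes the two sides agree on the diagonal as well, so they are equal as
  -- functions on all of ℂ².
  refine mul_left_cancel₀ hne (MvPolynomial.funext fun x => ?_)
  have hx : x = ![x 0, x 1] := by
    funext i
    fin_cases i <;> rfl
  rw [map_mul, map_mul, map_sub, MvPolynomial.eval_X, MvPolynomial.eval_X]
  by_cases h : x 0 = x 1
  · rw [h, sub_self, zero_mul, zero_mul]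
  · rw [hx, key _ _ h]

end EncodedFlux

end BryantFlux

end

/-! ### Balancing formulas for the fluxes and for the flux polynomials -/

theorem mainTheorem8 {M : Type*} [TopologicalSpace M] [T2Space M] [ConnectedSpace M]
    [ChartedSpace ℂ M] [IsManifold 𝓘(ℂ) ω M] {n : ℕ} (X : M → ℂ × ℝ)
    (E : Fin n → BryantFlux.AnnularEnd M) (hX : BryantFlux.IsCatenoidalSurface X E) :
    (∀ Y : ℂ × ℝ → ℂ × ℝ, BryantFlux.IsKillingField Y →
      (∀ j, ∃! φ : ℝ, BryantFlux.HasFlux X (E j) Y φ) ∧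
      ∀ φ : Fin n → ℝ, (∀ j, BryantFlux.HasFlux X (E j) Y (φ j)) → ∑ j, φ j = 0) ∧
    (∀ j, ∃! P : MvPolynomial (Fin 2) ℂ, BryantFlux.EncodesFlux X (E j) P) ∧
    (∀ P : Fin n → MvPolynomial (Fin 2) ℂ, (∀ j, BryantFlux.EncodesFlux X (E j) (P j)) →
      ∑ j, BryantFlux.diagonal (P j) = 0) := by
  have hb := hX.bryant
  have hsum : ∀ Y : ℂ × ℝ → ℂ × ℝ, BryantFlux.IsKillingField Y → ∀ φ : Fin n → ℝ,
      (∀ j, BryantFlux.HasFlux X (E j) Y (φ j)) → ∑ j, φ j = 0 := by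
    intro Y hY φ hφ
    choose c hc hcφ using fun j => (E j).exists_flux hb hY
    obtain rfl : φ = c := funext fun j => (hcφ j _).1 (hφ j)
    exact BryantFlux.sum_periods_eq_zero hY hX hc
  choose α β γ hflux using fun j => BryantFlux.exists_flux_quadraticField (E j) hb
  have henc := fun j => BryantFlux.encodesFlux_fluxPolynomial hb (hflux j)
  refine ⟨fun Y hY => ⟨fun j => ?_, hsum Y hY⟩, fun j => ⟨_, henc j, fun P hP =>
    hP.unique hb (henc j)⟩, fun P hP => ?_⟩
  · obtain ⟨c, -, hc⟩ := (E j).exists_flux hb hY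
    exact ⟨c, (hc c).2 rfl, fun φ hφ => (hc φ).1 hφ⟩
  · have hlin : ∀ A B C : ℂ, A * ∑ j, α j + B * ∑ j, β j + C * ∑ j, γ j = 0 := by
      have hre : ∀ A B C : ℂ, (A * ∑ j, α j + B * ∑ j, β j + C * ∑ j, γ j).re = 0 := by
        intro A B C
        rw [← hsum _ (BryantFlux.isKillingField_quadraticField A B C) _ fun j => hflux j A B C,
          ← Complex.re_sum, Finset.sum_add_distrib, Finset.sum_add_distrib, Finset.mul_sum,
          Finset.mul_sum, Finset.mul_sum]
      intro A B C
      refine Complex.ext (hre A B C) ?_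
      -- The quadratic fields form a complex vector space, so the real identity for I times the
      -- coefficients gives the imaginary part.
      have h := hre (Complex.I * A) (Complex.I * B) (Complex.I * C)
      rw [mul_assoc, mul_assoc, mul_assoc, ← mul_add, ← mul_add, Complex.I_mul_re] at h
      exact neg_eq_zero.1 h
    have hα : ∑ j, α j = 0 := by simpa using hlin 1 0 0
    have hβ : ∑ j, β j = 0 := by simpa using hlin 0 1 0
    have hγ : ∑ j, γ j = 0 := by simpa using hlin 0 0 1
    have hdiag : ∀ j, BryantFlux.diagonal (P j) = Polynomial.C (α j)
        - Polynomial.C (β j) * (2 * Polynomial.X) + Polynomial.C (γ j) * Polynomial.X ^ 2 :=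
      fun j => by
        rw [(hP j).unique hb (henc j), BryantFlux.diagonal_fluxPolynomial]
    simp only [hdiag, Finset.sum_add_distrib, Finset.sum_sub_distrib, ← Finset.sum_mul,
      ← map_sum, hα, hβ, hγ, map_zero, zero_mul, sub_zero, add_zero]
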